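/- \textbf{Theorem.} Let $P$ be the law of a unit $(\boldsymbol{x},T,Y_1,Y_0)$, where $\boldsymbol{x}\in\mathbb{R}^p$ is a covariate vector, $T\in\{0,1\}$ a treatment indicator and $Y_1,Y_0$ are the real potential outcomes. Put $\tilde{\boldsymbol{x}}=(1,\boldsymbol{x}^\top)^\top$, $\tau(\boldsymbol{x};\boldsymbol{\alpha})=\exp(\tilde{\boldsymbol{x}}^\top\boldsymbol{\alpha})/\{1+\exp(\tilde{\boldsymbol{x}}^\top\boldsymbol{\alpha})\}$, $\mu_i^0=\operatorname{E}(Y_i)$, $\theta^0=\mu_1^0-\mu_0^0$. Assume: (i) $T$ is independent of $(Y_1,Y_0)$ given $\boldsymbol{x}$; (ii) $P(T=1\mid\boldsymbol{x})=\tau(\boldsymbol{x};\boldsymbol{\alpha}^0)$ almost surely for some $\boldsymbol{\alpha}^0\in\mathbb{R}^{p+1}$, and $c_1\le\tau(\boldsymbol{x};\boldsymbol{\alpha}^0)\le c_2$ almost surely for some constants $0<c_1\le c_2<1$; (iii) $\operatorname{E}(Y_1^2)$, $\operatorname{E}(Y_0^2)$ and $\operatorname{E}\|\boldsymbol{x}\|^2$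 are finite; (iv) $\operatorname{E}(\tilde{\boldsymbol{x}}\tilde{\boldsymbol{x}}^\top)$ is positive definite, and the asymptotic variance $V$ defined below is positive. Let $(\boldsymbol{x}_j,T_j,Y_{1j},Y_{0j})$, $j=1,2,\dots$, be i.i.d. with law $P$. For the sample $j=1,\dots,n$ let $\mathcal{S}_1=\{j:T_j=1\}$ and $\mathcal{S}_0=\{j:T_j=0\}$; let $\hat{\boldsymbol{\alpha}}$ be a maximum likelihood estimator, i.e. a maximizer of $\prod_{j=1}^n\tau(\boldsymbol{x}_j;\boldsymbol{\alpha})^{T_j}\{1-\tau(\boldsymbol{x}_j;\boldsymbol{\alpha})\}^{1-T_j}$ over $\boldsymbol{\alpha}\in\mathbb{R}^{p+1}$; put $\hat\tau_j=\tau(\boldsymbol{x}_j;\hat{\boldsymbol{\alpha}})$ and $$\tilde a_{1j}=\frac{\hat\tau_j^{-1}}{\sum_{l\in\mathcal{S}_1}\hat\tau_l^{-1}},\quad \tilde a_{0j}=\frac{(1-\hat\tau_j)^{-1}}{\sum_{l\in\mathcal{S}_0}(1-\hat\tau_l)^{-1}},\quad \hat\mu_i=\sum_{j\in\mathcal{S}_i}\tilde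 a_{ij}Y_{ij}\ (i=0,1),\quad \hat\theta=\hat\mu_1-\hat\mu_0 .$$ For positive vectors $\boldsymbol{p}_1=(p_{1j})_{j\in\mathcal{S}_1}$, $\boldsymbol{p}_0=(p_{0j})_{j\in\mathcal{S}_0}$ let $$\ell(\boldsymbol{p}_1,\boldsymbol{p}_0)=n\Big\{\tfrac12\sum_{j\in\mathcal{S}_1}\tilde a_{1j}\log p_{1j}+\tfrac12\sum_{j\in\mathcal{S}_0}\tilde a_{0j}\log p_{0j}\Big\}.$$ Let $(\hat{\boldsymbol{p}}_1,\hat{\boldsymbol{p}}_0)$ maximize $\ell$ subject to $\sum_{j\in\mathcal{S}_1}p_{1j}=\sum_{j\in\mathcal{S}_0}p_{0j}=1$, let $(\hat{\boldsymbol{p}}_1(\theta),\hat{\boldsymbol{p}}_0(\theta))$ maximize $\ell$ subject to these constraints and $\sum_{j\in\mathcal{S}_1}p_{1j}Y_{1j}-\sum_{j\in\mathcal{S}_0}p_{0j}Y_{0j}=\theta$, and set $r_{\rm PEL}(\theta)=\ell(\hat{\boldsymbol{p}}_1(\theta),\hat{\boldsymbol{p}}_0(\theta))-\ell(\hat{\boldsymbol{p}}_1,\hat{\boldsymbol{p}}_0)$.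 (Where one of the maxima is not attained, the corresponding maximizer is given an arbitrary value; all are taken to be measurable.) For $\boldsymbol{\Psi}=(\mu_1,\theta,\boldsymbol{\alpha}^\top)^\top$ let $$\boldsymbol{U}_j(\boldsymbol{\Psi})=\Big(\tfrac{T_j(Y_{1j}-\mu_1)}{\tau(\boldsymbol{x}_j;\boldsymbol{\alpha})},\ \tfrac{(1-T_j)(Y_{0j}-(\mu_1-\theta))}{1-\tau(\boldsymbol{x}_j;\boldsymbol{\alpha})},\ \tilde{\boldsymbol{x}}_j^\top(T_j-\tau(\boldsymbol{x}_j;\boldsymbol{\alpha}))\Big)^\top,\qquad \boldsymbol{H}(\boldsymbol{\Psi})=\frac1n\sum_{j=1}^n\frac{\partial\boldsymbol{U}_j(\boldsymbol{\Psi})}{\partial\boldsymbol{\Psi}},$$ $\boldsymbol{\Psi}^0=(\mu_1^0,\theta^0,\{\boldsymbol{\alpha}^0\}^\top)^\top$, $\hat{\boldsymbol{\Psi}}=(\hat\mu_1,\hat\theta,\hat{\boldsymbol{\alpha}}^\top)^\top$. Let $\operatorname{var}(\hat\theta)$ be the second diagonal entry of $$\boldsymbol{H}(\hat{\boldsymbol{\Psi}})^{-1}\Big\{\frac1{n^2}\sum_{j=1}^n\boldsymbol{U}_j(\hat{\boldsymbol{\Psi}})\boldsymbol{U}_j(\hat{\boldsymbol{\Psi}})^\top\Big\}\{\boldsymbol{H}(\hat{\boldsymbol{\Psi}})^\top\}^{-1},$$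 let $V$ be the second diagonal entry of $[\operatorname{E}\boldsymbol{H}(\boldsymbol{\Psi}^0)]^{-1}\operatorname{E}\{\boldsymbol{U}_j(\boldsymbol{\Psi}^0)\boldsymbol{U}_j(\boldsymbol{\Psi}^0)^\top\}[\operatorname{E}\boldsymbol{H}(\boldsymbol{\Psi}^0)^\top]^{-1}$, and put $$\hat c=n\Big\{2\Big[\sum_{j\in\mathcal{S}_1}\tilde a_{1j}Y_{1j}^2+\sum_{j\in\mathcal{S}_0}\tilde a_{0j}Y_{0j}^2-\hat\mu_1^2-\hat\mu_0^2\Big]\Big\}^{-1}\operatorname{var}(\hat\theta),\qquad c=\big\{2[\operatorname{E}(Y_1^2+Y_0^2)-(\mu_1^0)^2-(\mu_0^0)^2]\big\}^{-1}V .$$ Then, as $n\to\infty$: with probability tending to one the maximum of the likelihood and both maxima of $\ell$ (the unrestricted one, and the restricted one at $\theta=\theta^0$) are attained; $c>0$ and $\hat c\to c$ in probability; and $$-2\,r_{\rm PEL}(\theta^0)/\hat c\ \longrightarrow\ \chi^2_1\quad\text{in distribution.}$$ -/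

import Mathlib

open MeasureTheory ProbabilityTheory Filter Topology

noncomputable section

namespace PELCausal

/-! ### Units, covariates, propensity scores -/

/-- The full record `(x, T, Y₁, Y₀)` of one unit: covariate vector, treatment indicator
(`true` is treatment, `false` is control), and the two potential outcomes. -/
abbrev Rec (p : ℕ) : Type := EuclideanSpace ℝ (Fin p) × Bool × ℝ × ℝ

variable {p : ℕ}

/-- The covariate vector `x`. -/
def cov (u : Rec p) : EuclideanSpace ℝ (Fin p) := u.1

/-- The treatment assignment as a Boolean. -/
def trt (u : Rec p) : Bool := u.2.1

/-- The treatment indicator `T` as a real number, `1` for treatment and `0` for control. -/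
def T (u : Rec p) : ℝ := if trt u = true then 1 else 0

/-- The potential outcome under treatment. -/
def Y₁ (u : Rec p) : ℝ := u.2.2.1

/-- The potential outcome under control. -/
def Y₀ (u : Rec p) : ℝ := u.2.2.2

lemma measurable_cov : Measurable (cov : Rec p → EuclideanSpace ℝ (Fin p)) := measurable_fst

/-- The vector `(1, xᵀ)ᵀ`. -/
def xt (x : EuclideanSpace ℝ (Fin p)) : Fin (p + 1) → ℝ := Fin.cons 1 (fun i => x i)

/-- The logistic propensity score `τ(x; α) = exp(x̃ᵀα) / (1 + exp(x̃ᵀα))`. -/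
def ps (x : EuclideanSpace ℝ (Fin p)) (α : Fin (p + 1) → ℝ) : ℝ :=
  Real.exp (xt x ⬝ᵥ α) / (1 + Real.exp (xt x ⬝ᵥ α))

/-- `q` maximizes `f` over `C`. -/
def IsMaximizer {β : Type*} (f : β → ℝ) (C : Set β) (q : β) : Prop := q ∈ C ∧ IsMaxOn f C q

/-! ### Statistics of a sample `s` of size `n` -/

variable {n : ℕ}

/-- The treated subjects. -/
def S₁ (s : Fin n → Rec p) : Finset (Fin n) := Finset.univ.filter fun j => trt (s j) = true

/-- The control subjects. -/
def S₀ (s : Fin n → Rec p) : Finset (Fin n) := Finset.univ.filter fun j => trt (s j) = false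

/-- The likelihood `L(α)` of the propensity score model. -/
def lik (s : Fin n → Rec p) (α : Fin (p + 1) → ℝ) : ℝ :=
  ∏ j, ps (cov (s j)) α ^ T (s j) * (1 - ps (cov (s j)) α) ^ (1 - T (s j))

/-- `α` is a maximum likelihood estimate of the propensity score parameter. -/
def IsMLE (s : Fin n → Rec p) (α : Fin (p + 1) → ℝ) : Prop :=
  IsMaximizer (lik s) Set.univ α

/-- Normalized inverse probability weights of the treated subjects. -/
def a₁ (s : Fin n → Rec p) (α : Fin (p + 1) → ℝ) (j : Fin n) : ℝ :=
  (ps (cov (s j)) α)⁻¹ / ∑ l ∈ S₁ s, (ps (cov (s l)) α)⁻¹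

/-- Normalized inverse probability weights of the control subjects. -/
def a₀ (s : Fin n → Rec p) (α : Fin (p + 1) → ℝ) (j : Fin n) : ℝ :=
  (1 - ps (cov (s j)) α)⁻¹ / ∑ l ∈ S₀ s, (1 - ps (cov (s l)) α)⁻¹

/-- The Hájek-type IPW estimator of `E Y₁`. -/
def muHat₁ (s : Fin n → Rec p) (α : Fin (p + 1) → ℝ) : ℝ := ∑ j ∈ S₁ s, a₁ s α j * Y₁ (s j)

/-- The Hájek-type IPW estimator of `E Y₀`. -/
def muHat₀ (s : Fin n → Rec p) (α : Fin (p + 1) → ℝ) : ℝ := ∑ j ∈ S₀ s, a₀ s α j * Y₀ (s j)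

/-- The Hájek-type IPW estimator of the average treatment effect. -/
def thetaHat (s : Fin n → Rec p) (α : Fin (p + 1) → ℝ) : ℝ := muHat₁ s α - muHat₀ s α

/-- The joint two-sample pseudo-empirical log-likelihood with `w₁ = w₀ = 1/2`. Since the subjects
are split into the treated and the control ones, a pair `(p₁, p₀)` of a vector indexed by
the former and one indexed by the latter is the same as one vector `q` indexed by all subjects. -/
def pel (s : Fin n → Rec p) (α : Fin (p + 1) → ℝ) (q : Fin n → ℝ) : ℝ :=
  n * (1 / 2 * ∑ j ∈ S₁ s, a₁ s α j * Real.log (q j)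
    + 1 / 2 * ∑ j ∈ S₀ s, a₀ s α j * Real.log (q j))

/-- The normalization constraints. Only positive masses are admitted: at a vanishing mass
the pseudo-empirical log-likelihood is `-∞`. -/
def normSet (s : Fin n → Rec p) : Set (Fin n → ℝ) :=
  {q | (∀ j, 0 < q j) ∧ ∑ j ∈ S₁ s, q j = 1 ∧ ∑ j ∈ S₀ s, q j = 1}

/-- The normalization constraints together with the constraint for the parameter `θ`. -/
def ateSet (s : Fin n → Rec p) (θ : ℝ) : Set (Fin n → ℝ) :=
  {q | q ∈ normSet s ∧ ∑ j ∈ S₁ s, q j * Y₁ (s j) - ∑ j ∈ S₀ s, q j * Y₀ (s j) = θ}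

/-! ### Estimating functions and sandwich variance -/

/-- Index of the parameter vector `Ψ = (μ₁, θ, αᵀ)ᵀ`. -/
abbrev Idx (p : ℕ) : Type := Fin 2 ⊕ Fin (p + 1)

/-- The parameter vector `(μ₁, θ, αᵀ)ᵀ`. -/
def mkPsi (μ₁ θ : ℝ) (α : Fin (p + 1) → ℝ) : Idx p → ℝ := Sum.elim ![μ₁, θ] α

/-- The estimating function of one unit `u` for the Hájek-type IPW estimators:
`(T(Y₁ - μ₁)/τ, (1 - T)(Y₀ - (μ₁ - θ))/(1 - τ), x̃(T - τ))`. -/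
def U (u : Rec p) (Ψ : Idx p → ℝ) : Idx p → ℝ :=
  Sum.elim
    ![T u * (Y₁ u - Ψ (Sum.inl 0)) / ps (cov u) (fun k => Ψ (Sum.inr k)),
      (1 - T u) * (Y₀ u - (Ψ (Sum.inl 0) - Ψ (Sum.inl 1)))
        / (1 - ps (cov u) (fun k => Ψ (Sum.inr k)))]
    (fun i => xt (cov u) i * (T u - ps (cov u) (fun k => Ψ (Sum.inr k))))

/-- The Jacobian matrix `∂U_j(Ψ)/∂Ψ` of the estimating function of one unit. -/
def jac (u : Rec p) (Ψ : Idx p → ℝ) : Matrix (Idx p) (Idx p) ℝ :=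
  Matrix.of fun i k => deriv (fun t => U u (Function.update Ψ k t) i) (Ψ k)

/-- `H(Ψ)`, the Jacobian of the averaged estimating function. -/
def H (s : Fin n → Rec p) (Ψ : Idx p → ℝ) : Matrix (Idx p) (Idx p) ℝ :=
  (n : ℝ)⁻¹ • ∑ j, jac (s j) Ψ

/-- `n⁻² ∑ⱼ Uⱼ(Ψ) Uⱼ(Ψ)ᵀ`. -/
def meat (s : Fin n → Rec p) (Ψ : Idx p → ℝ) : Matrix (Idx p) (Idx p) ℝ :=
  ((n : ℝ) ^ 2)⁻¹ • ∑ j, Matrix.vecMulVec (U (s j) Ψ) (U (s j) Ψ)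

/-- The sandwich variance estimator of the Hájek-type IPW estimator of the average
treatment effect: the entry belonging to `θ` of the sandwich matrix at `Ψ̂`. -/
def varHat (s : Fin n → Rec p) (α : Fin (p + 1) → ℝ) : ℝ :=
  let Ψ := mkPsi (muHat₁ s α) (thetaHat s α) α
  ((H s Ψ)⁻¹ * meat s Ψ * ((H s Ψ).transpose)⁻¹) (Sum.inl 1) (Sum.inl 1)

/-- The scaling factor `ĉ`. -/
def cHat (s : Fin n → Rec p) (α : Fin (p + 1) → ℝ) : ℝ :=
  n * (2 * (∑ j ∈ S₁ s, a₁ s α j * Y₁ (s j) ^ 2 + ∑ j ∈ S₀ s, a₀ s α j * Y₀ (s j) ^ 2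
    - muHat₁ s α ^ 2 - muHat₀ s α ^ 2))⁻¹ * varHat s α

/-! ### Population quantities -/

/-- `μ₁⁰ = E Y₁`. -/
def mu₁ (P : Measure (Rec p)) : ℝ := ∫ u, Y₁ u ∂P

/-- `μ₀⁰ = E Y₀`. -/
def mu₀ (P : Measure (Rec p)) : ℝ := ∫ u, Y₀ u ∂P

/-- The true average treatment effect `θ⁰`. -/
def ate (P : Measure (Rec p)) : ℝ := mu₁ P - mu₀ P

/-- The second moment matrix `E(x̃ x̃ᵀ)`. -/
def design (P : Measure (Rec p)) : Matrix (Fin (p + 1)) (Fin (p + 1)) ℝ :=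
  Matrix.of fun i k => ∫ u, xt (cov u) i * xt (cov u) k ∂P

/-- The true value `Ψ⁰ = (μ₁⁰, θ⁰, α⁰)`. -/
def psi0 (P : Measure (Rec p)) (α₀ : Fin (p + 1) → ℝ) : Idx p → ℝ := mkPsi (mu₁ P) (ate P) α₀

/-- `E H(Ψ⁰)`. -/
def popH (P : Measure (Rec p)) (α₀ : Fin (p + 1) → ℝ) : Matrix (Idx p) (Idx p) ℝ :=
  Matrix.of fun i k => ∫ u, jac u (psi0 P α₀) i k ∂P

/-- `E(Uⱼ(Ψ⁰) Uⱼ(Ψ⁰)ᵀ)`. -/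
def popMeat (P : Measure (Rec p)) (α₀ : Fin (p + 1) → ℝ) : Matrix (Idx p) (Idx p) ℝ :=
  Matrix.of fun i k => ∫ u, U u (psi0 P α₀) i * U u (psi0 P α₀) k ∂P

/-- The asymptotic variance `V` of `√n (θ̂ - θ⁰)` in sandwich form. -/
def asympVar (P : Measure (Rec p)) (α₀ : Fin (p + 1) → ℝ) : ℝ :=
  ((popH P α₀)⁻¹ * popMeat P α₀ * ((popH P α₀).transpose)⁻¹) (Sum.inl 1) (Sum.inl 1)

/-- The population scaling constant `c`. -/
def cPop (P : Measure (Rec p)) (α₀ : Fin (p + 1) → ℝ) : ℝ :=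
  (2 * (∫ u, (Y₁ u ^ 2 + Y₀ u ^ 2) ∂P - mu₁ P ^ 2 - mu₀ P ^ 2))⁻¹ * asympVar P α₀

/-- The `χ²` distribution with one degree of freedom: the law of the square of a
standard normal variable. -/
def chiSquaredOne : Measure ℝ := (gaussianReal 0 1).map fun z => z ^ 2

instance : IsProbabilityMeasure chiSquaredOne :=
  Measure.isProbabilityMeasure_map (by fun_prop)

/-- The observed sample of size `n` at the outcome `ω`. -/
def sample {Ω : Type*} (W : ℕ → Ω → Rec p) (n : ℕ) (ω : Ω) : Fin n → Rec p := fun j => W j ω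

end PELCausal

end

open MeasureTheory ProbabilityTheory Filter Topology

noncomputable section

namespace PELCausal

/-! ### Weighted empirical likelihood in two groups -/

section EmpiricalLikelihood

variable {J : Type*} [Fintype J] [DecidableEq J]

/-! The likelihood ratio is a quadratic form in `θ̂ − θ⁰`. The unrestricted maximizer of the PEL
function is the weight vector `wt` itself (Gibbs' inequality, `isMaximizer_weights`). In terms of
the signed centred outcomes `dev`, the constraint at `θ⁰` reads `∑ q dev = θ⁰ − θ̂`. With `S =
varSum` and `β = (θ̂ − θ⁰)/S`, the weights `wt (1 − β dev)` satisfy it, which bounds the restricted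
maximum from below, and a Lagrangian bound with multiplier `1 + β dev` bounds it from above. Both
agree up to a third-order error, so `−2 r = n(θ̂ − θ⁰)²/(2S) + o(1)` whenever `β dev` is uniformly
small (`abs_pelRatio_sub_le`).

The remaining ingredients are M-estimation. Strong concavity of the logistic log-likelihood near
`α⁰` gives root-`n` consistency of `α̂` (`Regime.exists_mle`). The Hájek estimators and `α̂` jointly
solve `∑ U(Ψ̂) = 0`, and a mean value expansion gives `√n(Ψ̂ − Ψ⁰) ≈ −H⁻¹ Z`, where `Z` is the
normalized sum of `U(Ψ⁰)` (`Regime.tendsto_sqrt_smul_psiHat_sub`). Since `S` tends to the sum `σ²`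
of the two outcome variances and `ĉ` to `V/(2σ²)`, the scaled ratio is asymptotically `(H⁻¹Z)_θ²/V`.
By the central limit theorem this converges to the square of a standard normal variable.

Covariates are only square integrable, so exponentials of `x̃ᵀα` need care: overlap bounds the
predictor at `α⁰`, and `max_j ‖x̃_j‖ = o(√n)` together with `α̂ − α⁰ = O(n^{-1/2})` in probability
makes the change of the predictor uniformly small. All moment bounds are then by powers of `env` of
degree at most two.

Analysis and probability are kept apart. `Regime` collects what is needed of samples indexed along
an arbitrary filter: laws of large numbers, a negligible envelope, and convergence of `Z` to some
`z`. From these everything follows deterministically (`Regime.tendsto_pelRatio`). For random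
samples, convergence in probability is convergence along `probFilter`. There `Z` is merely tight,
but by compactness it suffices to argue along finer filters on which `Z` converges
(`eventually_probFilter_of_tight`). -/

/-- Positive mass functions normalized on `S` and on its complement. -/
def twoSimplex (S : Finset J) : Set (J → ℝ) :=
  {q | (∀ j, 0 < q j) ∧ ∑ j ∈ S, q j = 1 ∧ ∑ j ∈ Sᶜ, q j = 1}

lemma sum_eq_two_of_mem_twoSimplex {S : Finset J} {q : J → ℝ} (hq : q ∈ twoSimplex S) :
    ∑ j, q j = 2 := by
  rw [← Finset.sum_add_sum_compl S, hq.2.1, hq.2.2]; norm_num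

lemma le_one_of_mem_twoSimplex {S : Finset J} {q : J → ℝ} (hq : q ∈ twoSimplex S) (j : J) :
    q j ≤ 1 := by
  by_cases hj : j ∈ S
  · rw [← hq.2.1]
    exact Finset.single_le_sum (fun i _ => (hq.1 i).le) hj
  · rw [← hq.2.2]
    exact Finset.single_le_sum (fun i _ => (hq.1 i).le) (Finset.mem_compl.2 hj)

/-- Gibbs' inequality: `a log (q / a) ≤ q − a` termwise, and the right-hand sides sum to zero
because both total masses are 2. -/
lemma isMaximizer_weights {S : Finset J} {a : J → ℝ} (ha : a ∈ twoSimplex S) :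
    IsMaximizer (fun q => ∑ j, a j * Real.log (q j)) (twoSimplex S) a := by
  refine ⟨ha, fun q hq => ?_⟩
  have h : ∀ j, a j * Real.log (q j) - a j * Real.log (a j) ≤ q j - a j := fun j => by
    have h1 := Real.log_le_sub_one_of_pos (div_pos (hq.1 j) (ha.1 j))
    rw [Real.log_div (hq.1 j).ne' (ha.1 j).ne'] at h1
    have h2 := mul_le_mul_of_nonneg_left h1 (ha.1 j).le
    have h3 : a j * (q j / a j - 1) = q j - a j := by
      have := (ha.1 j).ne'
      field_simp
    linarith [mul_sub (a j) (Real.log (q j)) (Real.log (a j))]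
  have h' := Finset.sum_le_sum fun j (_ : j ∈ Finset.univ) => h j
  rw [Finset.sum_sub_distrib, Finset.sum_sub_distrib, sum_eq_two_of_mem_twoSimplex hq,
    sum_eq_two_of_mem_twoSimplex ha] at h'
  show ∑ j, a j * Real.log (q j) ≤ ∑ j, a j * Real.log (a j)
  linarith

/-- A weighted log-likelihood attains its maximum over the mass functions with a prescribed
linear functional as soon as there is one. -/
lemma exists_isMaximizer_of_mem {S : Finset J} {a y : J → ℝ} (ha : ∀ j, 0 < a j) {t : ℝ}
    {q₀ : J → ℝ} (h₀ : q₀ ∈ twoSimplex S) (h₀t : ∑ j, q₀ j * y j = t) :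
    ∃ q, IsMaximizer (fun q => ∑ j, a j * Real.log (q j))
      {q | q ∈ twoSimplex S ∧ ∑ j, q j * y j = t} q := by
  set f : (J → ℝ) → ℝ := fun q => ∑ j, a j * Real.log (q j) with hf
  -- Masses are at most one, so every summand of `f q` is nonpositive. Hence `f q₀ ≤ f q` forces `f
  -- q₀ ≤ a j log (q j)`, which keeps `q j` above `d j`. The competitors to `q₀` thus lie in a
  -- compact set on which the logarithms are continuous.
  set d : J → ℝ := fun j => Real.exp (f q₀ / a j) with hd
  have hdpos : ∀ j, 0 < d j := fun j => Real.exp_pos _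
  have key : ∀ q ∈ twoSimplex S, f q₀ ≤ f q → ∀ j, d j ≤ q j := by
    intro q hq hle j
    have h1 : f q ≤ a j * Real.log (q j) := by
      show ∑ i, a i * Real.log (q i) ≤ _
      rw [← Finset.add_sum_erase _ _ (Finset.mem_univ j)]
      have : ∑ i ∈ Finset.univ.erase j, a i * Real.log (q i) ≤ 0 :=
        Finset.sum_nonpos fun i _ => mul_nonpos_of_nonneg_of_nonpos (ha i).le
          (Real.log_nonpos (hq.1 i).le (le_one_of_mem_twoSimplex hq i))
      linarith
    rw [hd, ← Real.le_log_iff_exp_le (hq.1 j), div_le_iff₀ (ha j), mul_comm]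
    exact hle.trans h1
  let K : Set (J → ℝ) := {q | q ∈ Set.Icc d 1 ∧ ∑ j ∈ S, q j = 1 ∧ ∑ j ∈ Sᶜ, q j = 1 ∧
    ∑ j, q j * y j = t}
  have hK : IsCompact K := by
    refine isCompact_Icc.inter_right ?_
    refine (isClosed_eq (by fun_prop) (by fun_prop)).inter
      ((isClosed_eq (by fun_prop) (by fun_prop)).inter (isClosed_eq (by fun_prop) (by fun_prop)))
  have hsub : ∀ q ∈ twoSimplex S, ∑ j, q j * y j = t → f q₀ ≤ f q → q ∈ K := fun q hq ht hle =>
    ⟨⟨key q hq hle, le_one_of_mem_twoSimplex hq⟩, hq.2.1, hq.2.2, ht⟩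
  have hcont : ContinuousOn f K := by
    refine continuousOn_finsetSum _ fun j _ => continuousOn_const.mul ?_
    refine ContinuousOn.log (by fun_prop) fun q hq => ((hdpos j).trans_le (hq.1.1 j)).ne'
  obtain ⟨q, hqK, hq⟩ := hK.exists_isMaxOn ⟨q₀, hsub q₀ h₀ h₀t le_rfl⟩ hcont
  refine ⟨q, ⟨⟨fun j => (hdpos j).trans_le (hqK.1.1 j), hqK.2.1, hqK.2.2.1⟩, hqK.2.2.2⟩, ?_⟩
  intro q' hq'
  show f q' ≤ f q
  rcases le_total (f q₀) (f q') with h | h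
  · exact hq (hsub q' hq'.1 hq'.2 h)
  · exact h.trans (hq (hsub q₀ h₀ h₀t le_rfl))

/-- The Taylor remainder is at most `|t|³ / (1 − |t|)`. Trading one factor `|t|` for `ε` leaves a
multiple of `t²`, so that sums of the error need second moments only. -/
lemma abs_log_one_add_sub_le {t ε : ℝ} (ht : |t| ≤ ε) (hε : ε ≤ 1 / 2) :
    |Real.log (1 + t) - t + t ^ 2 / 2| ≤ 2 * ε * t ^ 2 := by
  have h := Real.abs_log_sub_add_sum_range_le (x := -t) (by rw [abs_neg]; linarith) 2
  simp only [Finset.sum_range_succ, Finset.sum_range_zero, abs_neg, sub_neg_eq_add] at h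
  have e : Real.log (1 + t) - t + t ^ 2 / 2 = 0 + (-t) ^ (0 + 1) / ((0 : ℕ) + 1)
      + (-t) ^ (1 + 1) / ((1 : ℕ) + 1) + Real.log (1 + t) := by
    push_cast; ring
  rw [e]
  refine h.trans ?_
  rw [div_le_iff₀ (by linarith)]
  have h2 : |t| ^ (2 + 1) = |t| * t ^ 2 := by rw [← sq_abs t]; ring
  rw [h2]
  nlinarith [sq_nonneg t, abs_nonneg t, mul_nonneg (sub_nonneg.2 ht) (sq_nonneg t),
    mul_nonneg ((abs_nonneg t).trans ht) (sq_nonneg t)]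

variable {S : Finset J} {a y : J → ℝ} {β ε t : ℝ}

/-- The tilted weights are feasible for the constraint `∑ q y = -β ∑ a y²`. -/
lemma tilt_mem (ha : a ∈ twoSimplex S) (hy : ∑ j ∈ S, a j * y j = 0)
    (hy' : ∑ j ∈ Sᶜ, a j * y j = 0) (hβ : ∀ j, |β * y j| ≤ ε) (hε : ε ≤ 1 / 2)
    (ht : t = -β * ∑ j, a j * y j ^ 2) :
    (fun j => a j * (1 - β * y j)) ∈ {q | q ∈ twoSimplex S ∧ ∑ j, q j * y j = t} := by
  have h1 : ∀ R : Finset J, ∑ j ∈ R, a j * y j = 0 →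
      ∑ j ∈ R, a j * (1 - β * y j) = ∑ j ∈ R, a j := fun R hR => by
    have : ∑ j ∈ R, a j * (1 - β * y j) = ∑ j ∈ R, a j - β * ∑ j ∈ R, a j * y j := by
      rw [Finset.mul_sum, ← Finset.sum_sub_distrib]
      exact Finset.sum_congr rfl fun j _ => by ring
    rw [this, hR]; ring
  refine ⟨⟨fun j => mul_pos (ha.1 j) ?_, ?_, ?_⟩, ?_⟩
  · have := (abs_le.1 (hβ j)).2; linarith
  · exact (h1 S hy).trans ha.2.1
  · exact (h1 Sᶜ hy').trans ha.2.2
  · have h0 : ∑ j, a j * y j = 0 := by rw [← Finset.sum_add_sum_compl S, hy, hy', add_zero]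
    have : ∑ j, a j * (1 - β * y j) * y j = ∑ j, a j * y j - β * ∑ j, a j * y j ^ 2 := by
      rw [Finset.mul_sum, ← Finset.sum_sub_distrib]
      exact Finset.sum_congr rfl fun j _ => by ring
    rw [this, h0, ht]; ring

/-- Quadratic approximation of the log-likelihood ratio of the restricted maximum. -/
lemma abs_logRatio_sub_le (ha : a ∈ twoSimplex S) (hy : ∑ j ∈ S, a j * y j = 0)
    (hy' : ∑ j ∈ Sᶜ, a j * y j = 0) (hβ : ∀ j, |β * y j| ≤ ε) (hε : ε ≤ 1 / 2)
    (ht : t = -β * ∑ j, a j * y j ^ 2) {q : J → ℝ}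
    (hq : IsMaximizer (fun q => ∑ j, a j * Real.log (q j))
      {q | q ∈ twoSimplex S ∧ ∑ j, q j * y j = t} q) :
    |(∑ j, a j * Real.log (a j) - ∑ j, a j * Real.log (q j)) - β ^ 2 * (∑ j, a j * y j ^ 2) / 2|
      ≤ 2 * ε * (β ^ 2 * ∑ j, a j * y j ^ 2) := by
  have h0 : ∑ j, a j * y j = 0 := by rw [← Finset.sum_add_sum_compl S, hy, hy', add_zero]
  have ha2 := sum_eq_two_of_mem_twoSimplex ha
  rw [abs_le]
  constructor
  -- Weak duality: `log z ≤ z − 1` at `z = (1 + β y_j) q_j / a_j`. The sum of `(1 + β y_j) q_j`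
  -- equals `2 + β t` for every feasible `q`, so the bound does not depend on the maximizer.
  · have h : ∀ j, a j * (β * y j - (β * y j) ^ 2 / 2 - 2 * ε * (β * y j) ^ 2) + a j
        - (1 + β * y j) * q j ≤ a j * Real.log (a j) - a j * Real.log (q j) := fun j => by
      have hv : 0 < 1 + β * y j := by have := (abs_le.1 (hβ j)).1; linarith
      have hqj := hq.1.1.1 j
      have haj := ha.1 j
      have h1 := Real.log_le_sub_one_of_pos (div_pos (mul_pos hv hqj) haj)
      rw [Real.log_div (mul_pos hv hqj).ne' haj.ne', Real.log_mul hv.ne' hqj.ne'] at h1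
      have h2 := (abs_le.1 (abs_log_one_add_sub_le (hβ j) hε)).1
      have h3 := mul_le_mul_of_nonneg_left h1 haj.le
      have h4 : a j * ((1 + β * y j) * q j / a j - 1) = (1 + β * y j) * q j - a j := by
        field_simp
      have h5 := mul_le_mul_of_nonneg_left h2 haj.le
      rw [h4] at h3
      nlinarith
    have hs := Finset.sum_le_sum fun j (_ : j ∈ Finset.univ) => h j
    rw [Finset.sum_sub_distrib (f := fun j => a j * Real.log (a j))] at hs
    have e : ∑ j, (a j * (β * y j - (β * y j) ^ 2 / 2 - 2 * ε * (β * y j) ^ 2) + a j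
        - (1 + β * y j) * q j) = β * ∑ j, a j * y j - (1 / 2 + 2 * ε) * β ^ 2 * ∑ j, a j * y j ^ 2
          + ∑ j, a j - ∑ j, q j - β * ∑ j, q j * y j := by
      simp only [Finset.mul_sum, ← Finset.sum_sub_distrib, ← Finset.sum_add_distrib]
      exact Finset.sum_congr rfl fun j _ => by ring
    rw [e, h0, ha2, sum_eq_two_of_mem_twoSimplex hq.1.1, hq.1.2, ht] at hs
    nlinarith
  -- The tilted weights are a feasible competitor, so their value bounds the maximum from below,
  -- with the same quadratic term as the dual bound.
  · have hm := hq.2 (tilt_mem ha hy hy' hβ hε ht)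
    have hm' : ∑ j, a j * Real.log (a j * (1 - β * y j)) ≤ ∑ j, a j * Real.log (q j) := hm
    have h : ∀ j, a j * Real.log (a j) + a j * (-(β * y j) - (β * y j) ^ 2 / 2
        - 2 * ε * (β * y j) ^ 2) ≤ a j * Real.log (a j * (1 - β * y j)) := fun j => by
      have hv : 0 < 1 - β * y j := by have := (abs_le.1 (hβ j)).2; linarith
      have haj := ha.1 j
      rw [Real.log_mul haj.ne' hv.ne', mul_add]
      have h2 := (abs_le.1 (abs_log_one_add_sub_le (t := -(β * y j))
        (by rw [abs_neg]; exact hβ j) hε)).1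
      rw [← sub_eq_add_neg] at h2
      have := mul_le_mul_of_nonneg_left h2 haj.le
      nlinarith
    have hs := Finset.sum_le_sum fun j (_ : j ∈ Finset.univ) => h j
    have e : ∑ j, (a j * Real.log (a j) + a j * (-(β * y j) - (β * y j) ^ 2 / 2
        - 2 * ε * (β * y j) ^ 2)) = ∑ j, a j * Real.log (a j) - β * ∑ j, a j * y j
          - (1 / 2 + 2 * ε) * β ^ 2 * ∑ j, a j * y j ^ 2 := by
      simp only [Finset.mul_sum, ← Finset.sum_sub_distrib]
      exact Finset.sum_congr rfl fun j _ => by ring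
    rw [e, h0] at hs
    nlinarith

end EmpiricalLikelihood

variable {p : ℕ}

/-! ### The propensity score and sums over the treatment groups -/

lemma ps_pos (x : EuclideanSpace ℝ (Fin p)) (α : Fin (p + 1) → ℝ) : 0 < ps x α := by
  unfold ps; positivity

lemma one_sub_ps (x : EuclideanSpace ℝ (Fin p)) (α : Fin (p + 1) → ℝ) :
    1 - ps x α = (1 + Real.exp (xt x ⬝ᵥ α))⁻¹ := by
  unfold ps
  have := Real.exp_pos (xt x ⬝ᵥ α)
  field_simp
  ring

lemma one_sub_ps_pos (x : EuclideanSpace ℝ (Fin p)) (α : Fin (p + 1) → ℝ) : 0 < 1 - ps x α := by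
  rw [one_sub_ps]; positivity

lemma inv_one_sub_ps (x : EuclideanSpace ℝ (Fin p)) (α : Fin (p + 1) → ℝ) :
    (1 - ps x α)⁻¹ = 1 + Real.exp (xt x ⬝ᵥ α) := by
  rw [one_sub_ps, inv_inv]

lemma inv_ps (x : EuclideanSpace ℝ (Fin p)) (α : Fin (p + 1) → ℝ) :
    (ps x α)⁻¹ = 1 + Real.exp (-(xt x ⬝ᵥ α)) := by
  unfold ps
  rw [Real.exp_neg]
  have := Real.exp_pos (xt x ⬝ᵥ α)
  field_simp
  ring

variable {n : ℕ} {s : Fin n → Rec p} {α : Fin (p + 1) → ℝ}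

lemma sum_S₁ (s : Fin n → Rec p) (f : Fin n → ℝ) : ∑ j ∈ S₁ s, f j = ∑ j, T (s j) * f j := by
  rw [S₁, Finset.sum_filter]
  exact Finset.sum_congr rfl fun j _ => by simp [T]

lemma sum_S₀ (s : Fin n → Rec p) (f : Fin n → ℝ) :
    ∑ j ∈ S₀ s, f j = ∑ j, (1 - T (s j)) * f j := by
  rw [S₀, Finset.sum_filter]
  refine Finset.sum_congr rfl fun j _ => ?_
  unfold T
  cases trt (s j) <;> simp

lemma compl_S₁ (s : Fin n → Rec p) : (S₁ s)ᶜ = S₀ s := by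
  ext j; simp [S₁, S₀]

lemma sum_inv_ps_pos (h : (S₁ s).Nonempty) : 0 < ∑ l ∈ S₁ s, (ps (cov (s l)) α)⁻¹ :=
  Finset.sum_pos (fun _ _ => inv_pos.2 (ps_pos _ _)) h

lemma sum_inv_one_sub_ps_pos (h : (S₀ s).Nonempty) :
    0 < ∑ l ∈ S₀ s, (1 - ps (cov (s l)) α)⁻¹ :=
  Finset.sum_pos (fun _ _ => inv_pos.2 (one_sub_ps_pos _ _)) h

lemma sum_a₁ (h : (S₁ s).Nonempty) : ∑ j ∈ S₁ s, a₁ s α j = 1 := by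
  simp only [a₁]
  rw [← Finset.sum_div, div_self (sum_inv_ps_pos h).ne']

lemma sum_a₀ (h : (S₀ s).Nonempty) : ∑ j ∈ S₀ s, a₀ s α j = 1 := by
  simp only [a₀]
  rw [← Finset.sum_div, div_self (sum_inv_one_sub_ps_pos h).ne']

/-- The weights of all subjects. -/
def wt (s : Fin n → Rec p) (α : Fin (p + 1) → ℝ) (j : Fin n) : ℝ :=
  if trt (s j) = true then a₁ s α j else a₀ s α j

/-- The signed centred outcomes. -/
def dev (s : Fin n → Rec p) (α : Fin (p + 1) → ℝ) (j : Fin n) : ℝ :=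
  if trt (s j) = true then Y₁ (s j) - muHat₁ s α else -(Y₀ (s j) - muHat₀ s α)

/-- The sum of the weighted sample variances of the two groups. -/
def varSum (s : Fin n → Rec p) (α : Fin (p + 1) → ℝ) : ℝ :=
  ∑ j ∈ S₁ s, a₁ s α j * Y₁ (s j) ^ 2 + ∑ j ∈ S₀ s, a₀ s α j * Y₀ (s j) ^ 2
    - muHat₁ s α ^ 2 - muHat₀ s α ^ 2

lemma sum_S₁_wt_dev (f : ℝ → ℝ → ℝ) : ∑ j ∈ S₁ s, f (wt s α j) (dev s α j)
    = ∑ j ∈ S₁ s, f (a₁ s α j) (Y₁ (s j) - muHat₁ s α) := by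
  refine Finset.sum_congr rfl fun j hj => ?_
  have : trt (s j) = true := by simpa [S₁] using hj
  simp [wt, dev, this]

lemma sum_S₀_wt_dev (f : ℝ → ℝ → ℝ) : ∑ j ∈ S₀ s, f (wt s α j) (dev s α j)
    = ∑ j ∈ S₀ s, f (a₀ s α j) (-(Y₀ (s j) - muHat₀ s α)) := by
  refine Finset.sum_congr rfl fun j hj => ?_
  have : trt (s j) = false := by simpa [S₀] using hj
  simp [wt, dev, this]

lemma wt_mem (h₁ : (S₁ s).Nonempty) (h₀ : (S₀ s).Nonempty) : wt s α ∈ twoSimplex (S₁ s) := by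
  refine ⟨fun j => ?_, ?_, ?_⟩
  · unfold wt
    split_ifs
    · exact div_pos (inv_pos.2 (ps_pos _ _)) (sum_inv_ps_pos h₁)
    · exact div_pos (inv_pos.2 (one_sub_ps_pos _ _)) (sum_inv_one_sub_ps_pos h₀)
  · rw [sum_S₁_wt_dev fun a _ => a, sum_a₁ h₁]
  · rw [compl_S₁, sum_S₀_wt_dev fun a _ => a, sum_a₀ h₀]

lemma sum_S₁_wt_mul_dev (h₁ : (S₁ s).Nonempty) : ∑ j ∈ S₁ s, wt s α j * dev s α j = 0 := by
  rw [sum_S₁_wt_dev fun a y => a * y]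
  simp only [mul_sub, Finset.sum_sub_distrib, ← Finset.sum_mul]
  rw [sum_a₁ h₁, one_mul, muHat₁, sub_self]

lemma sum_S₀_wt_mul_dev (h₀ : (S₀ s).Nonempty) : ∑ j ∈ (S₁ s)ᶜ, wt s α j * dev s α j = 0 := by
  rw [compl_S₁, sum_S₀_wt_dev fun a y => a * y]
  simp only [mul_neg, mul_sub, Finset.sum_neg_distrib, Finset.sum_sub_distrib, ← Finset.sum_mul]
  rw [sum_a₀ h₀, one_mul, muHat₀, sub_self, neg_zero]

lemma sum_wt_mul_dev_sq (h₁ : (S₁ s).Nonempty) (h₀ : (S₀ s).Nonempty) :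
    ∑ j, wt s α j * dev s α j ^ 2 = varSum s α := by
  rw [← Finset.sum_add_sum_compl (S₁ s), compl_S₁, sum_S₁_wt_dev fun a y => a * y ^ 2,
    sum_S₀_wt_dev fun a y => a * y ^ 2]
  have e₁ : ∑ j ∈ S₁ s, a₁ s α j * (Y₁ (s j) - muHat₁ s α) ^ 2
      = ∑ j ∈ S₁ s, a₁ s α j * Y₁ (s j) ^ 2 - muHat₁ s α ^ 2 := by
    have : ∀ j, a₁ s α j * (Y₁ (s j) - muHat₁ s α) ^ 2 = a₁ s α j * Y₁ (s j) ^ 2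
        - 2 * muHat₁ s α * (a₁ s α j * Y₁ (s j)) + muHat₁ s α ^ 2 * a₁ s α j := fun j => by ring
    simp only [this, Finset.sum_add_distrib, Finset.sum_sub_distrib, ← Finset.mul_sum]
    rw [sum_a₁ h₁, ← muHat₁]; ring
  have e₀ : ∑ j ∈ S₀ s, a₀ s α j * (-(Y₀ (s j) - muHat₀ s α)) ^ 2
      = ∑ j ∈ S₀ s, a₀ s α j * Y₀ (s j) ^ 2 - muHat₀ s α ^ 2 := by
    have : ∀ j, a₀ s α j * (-(Y₀ (s j) - muHat₀ s α)) ^ 2 = a₀ s α j * Y₀ (s j) ^ 2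
        - 2 * muHat₀ s α * (a₀ s α j * Y₀ (s j)) + muHat₀ s α ^ 2 * a₀ s α j := fun j => by ring
    simp only [this, Finset.sum_add_distrib, Finset.sum_sub_distrib, ← Finset.mul_sum]
    rw [sum_a₀ h₀, ← muHat₀]; ring
  rw [e₁, e₀, varSum]; ring

lemma normSet_eq : normSet s = twoSimplex (S₁ s) := by
  ext q; simp [normSet, twoSimplex, compl_S₁]

/-- Since each group has mass one, centring shifts the two group means by `muHat₁` and `muHat₀`. The
sign in `dev` merges the difference of means into one linear functional with value `θ − θ̂`, the
form required by the two-group lemmas. -/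
lemma ateSet_eq (θ : ℝ) : ateSet s θ =
    {q | q ∈ twoSimplex (S₁ s) ∧ ∑ j, q j * dev s α j = θ - thetaHat s α} := by
  ext q
  simp only [ateSet, normSet_eq, Set.mem_ofPred_eq]
  refine and_congr_right fun hq => ?_
  have e₁ : ∑ j ∈ S₁ s, q j * dev s α j = ∑ j ∈ S₁ s, q j * Y₁ (s j) - muHat₁ s α := by
    rw [← mul_one (muHat₁ s α), ← hq.2.1, Finset.mul_sum, ← Finset.sum_sub_distrib]
    refine Finset.sum_congr rfl fun j hj => ?_
    have : trt (s j) = true := by simpa [S₁] using hj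
    simp only [dev, this, if_true]; ring
  have e₀ : ∑ j ∈ S₀ s, q j * dev s α j = -(∑ j ∈ S₀ s, q j * Y₀ (s j) - muHat₀ s α) := by
    have h := hq.2.2
    rw [compl_S₁] at h
    rw [← mul_one (muHat₀ s α), ← h, Finset.mul_sum, ← Finset.sum_sub_distrib,
      ← Finset.sum_neg_distrib]
    refine Finset.sum_congr rfl fun j hj => ?_
    have : trt (s j) = false := by simpa [S₀] using hj
    simp only [dev, this, Bool.false_eq_true, if_false]; ring
  rw [← Finset.sum_add_sum_compl (S₁ s), compl_S₁, e₁, e₀, thetaHat]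
  constructor <;> intro h <;> linarith

lemma pel_eq (q : Fin n → ℝ) :
    pel s α q = n / 2 * ∑ j, wt s α j * Real.log (q j) := by
  have e₁ : ∑ j ∈ S₁ s, wt s α j * Real.log (q j) = ∑ j ∈ S₁ s, a₁ s α j * Real.log (q j) := by
    refine Finset.sum_congr rfl fun j hj => ?_
    have : trt (s j) = true := by simpa [S₁] using hj
    simp [wt, this]
  have e₀ : ∑ j ∈ S₀ s, wt s α j * Real.log (q j) = ∑ j ∈ S₀ s, a₀ s α j * Real.log (q j) := by
    refine Finset.sum_congr rfl fun j hj => ?_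
    have : trt (s j) = false := by simpa [S₀] using hj
    simp [wt, this]
  rw [← Finset.sum_add_sum_compl (S₁ s), compl_S₁, e₁, e₀, pel]; ring

lemma isMaximizer_pel_iff (hn : 0 < n) {C : Set (Fin n → ℝ)} {q : Fin n → ℝ} :
    IsMaximizer (pel s α) C q ↔ IsMaximizer (fun q => ∑ j, wt s α j * Real.log (q j)) C q := by
  have hn' : (0 : ℝ) < n / 2 := by positivity
  unfold IsMaximizer
  refine and_congr_right fun _ => ?_
  simp only [isMaxOn_iff, pel_eq]
  exact forall₂_congr fun _ _ => mul_le_mul_iff_right₀ hn'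

lemma exists_isMaximizer_normSet (h₁ : (S₁ s).Nonempty) (h₀ : (S₀ s).Nonempty) :
    ∃ q, IsMaximizer (pel s α) (normSet s) q := by
  have hn : 0 < n := Fin.pos h₁.choose
  refine ⟨wt s α, (isMaximizer_pel_iff hn).2 ?_⟩
  rw [normSet_eq]
  exact isMaximizer_weights (wt_mem h₁ h₀)

variable {θ β ε : ℝ}

/-- Feasibility is the only issue. The condition on `β` is exactly the one for which the tilted
weights meet the constraint at `θ`. -/
lemma exists_isMaximizer_ateSet (h₁ : (S₁ s).Nonempty) (h₀ : (S₀ s).Nonempty)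
    (hβ : β * varSum s α = thetaHat s α - θ) (hdev : ∀ j, |β * dev s α j| ≤ 1 / 2) :
    ∃ q, IsMaximizer (pel s α) (ateSet s θ) q := by
  have hn : 0 < n := Fin.pos h₁.choose
  simp only [isMaximizer_pel_iff hn, ateSet_eq (α := α)]
  have hm := tilt_mem (wt_mem (α := α) h₁ h₀) (sum_S₁_wt_mul_dev h₁) (sum_S₀_wt_mul_dev h₀)
    hdev le_rfl (t := θ - thetaHat s α)
    (by rw [sum_wt_mul_dev_sq h₁ h₀]; linarith)
  exact exists_isMaximizer_of_mem (wt_mem h₁ h₀).1 hm.1 hm.2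

/-- Quadratic approximation of the pseudo-empirical likelihood ratio. -/
lemma abs_pelRatio_sub_le (h₁ : (S₁ s).Nonempty) (h₀ : (S₀ s).Nonempty)
    (hβ : β * varSum s α = thetaHat s α - θ) (hdev : ∀ j, |β * dev s α j| ≤ ε)
    (hε : ε ≤ 1 / 2) {qG qR : Fin n → ℝ} (hG : IsMaximizer (pel s α) (normSet s) qG)
    (hR : IsMaximizer (pel s α) (ateSet s θ) qR) :
    |-2 * (pel s α qR - pel s α qG) - n * (β ^ 2 * varSum s α) / 2|
      ≤ 2 * ε * (n * (β ^ 2 * varSum s α)) := by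
  have hn : 0 < n := Fin.pos h₁.choose
  have hw := wt_mem (α := α) h₁ h₀
  -- Only the value at `qG` matters, so uniqueness of the maximizer is not needed.
  have hG' : pel s α qG = pel s α (wt s α) := by
    refine le_antisymm ?_ ?_
    · have h := isMaximizer_weights hw
      rw [← isMaximizer_pel_iff hn, ← normSet_eq] at h
      exact h.2 hG.1
    · exact hG.2 (by rw [normSet_eq]; exact hw)
  rw [isMaximizer_pel_iff hn, ateSet_eq (α := α)] at hR
  have h := abs_logRatio_sub_le hw (sum_S₁_wt_mul_dev h₁) (sum_S₀_wt_mul_dev h₀) hdev hε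
    (t := θ - thetaHat s α) (by rw [sum_wt_mul_dev_sq h₁ h₀]; linarith) hR
  rw [sum_wt_mul_dev_sq h₁ h₀] at h
  rw [hG', pel_eq, pel_eq]
  have e : -2 * (n / 2 * ∑ j, wt s α j * Real.log (qR j)
      - n / 2 * ∑ j, wt s α j * Real.log (wt s α j)) - n * (β ^ 2 * varSum s α) / 2
      = n * ((∑ j, wt s α j * Real.log (wt s α j) - ∑ j, wt s α j * Real.log (qR j))
        - β ^ 2 * varSum s α / 2) := by ring
  rw [e, abs_mul, abs_of_nonneg (Nat.cast_nonneg n)]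
  calc _ ≤ (n : ℝ) * (2 * ε * (β ^ 2 * varSum s α)) :=
        mul_le_mul_of_nonneg_left h (Nat.cast_nonneg n)
    _ = _ := by ring

variable {p : ℕ}

/-! ### The estimating functions and their Jacobian -/

/-- The linear predictor `x̃ᵀα` at the propensity part of `Ψ`. -/
def lin (u : Rec p) (Ψ : Idx p → ℝ) : ℝ := xt (cov u) ⬝ᵥ fun k => Ψ (Sum.inr k)

/-- The logistic function. -/
def logistic (t : ℝ) : ℝ := Real.exp t / (1 + Real.exp t)

lemma hasDerivAt_logistic (t : ℝ) :
    HasDerivAt logistic (logistic t * (1 - logistic t)) t := by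
  have h := (Real.hasDerivAt_exp t).div ((Real.hasDerivAt_exp t).const_add 1)
    (by positivity)
  refine h.congr_deriv ?_
  unfold logistic
  have : (1 + Real.exp t) ≠ 0 := by positivity
  field_simp

lemma contDiff_logistic {m : WithTop ℕ∞} : ContDiff ℝ m logistic :=
  Real.contDiff_exp.div (contDiff_const.add Real.contDiff_exp) fun t => by positivity

lemma U_inl_zero (u : Rec p) (Ψ : Idx p → ℝ) : U u Ψ (Sum.inl 0) =
    T u * (Y₁ u - Ψ (Sum.inl 0)) * (1 + Real.exp (-lin u Ψ)) := by
  simp [U, div_eq_mul_inv, inv_ps, lin]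

lemma U_inl_one (u : Rec p) (Ψ : Idx p → ℝ) : U u Ψ (Sum.inl 1) =
    (1 - T u) * (Y₀ u - (Ψ (Sum.inl 0) - Ψ (Sum.inl 1))) * (1 + Real.exp (lin u Ψ)) := by
  simp [U, div_eq_mul_inv, inv_one_sub_ps, lin]

lemma U_inr (u : Rec p) (Ψ : Idx p → ℝ) (i : Fin (p + 1)) : U u Ψ (Sum.inr i) =
    xt (cov u) i * (T u - logistic (lin u Ψ)) := rfl

/-- The Jacobian of the estimating functions in closed form. -/
def jacMat (u : Rec p) (Ψ : Idx p → ℝ) : Matrix (Idx p) (Idx p) ℝ :=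
  Matrix.fromBlocks
    !![-(T u * (1 + Real.exp (-lin u Ψ))), 0;
      -((1 - T u) * (1 + Real.exp (lin u Ψ))), (1 - T u) * (1 + Real.exp (lin u Ψ))]
    (Matrix.of fun i k => ![-(T u * (Y₁ u - Ψ (Sum.inl 0)) * Real.exp (-lin u Ψ)),
      (1 - T u) * (Y₀ u - (Ψ (Sum.inl 0) - Ψ (Sum.inl 1))) * Real.exp (lin u Ψ)] i
        * xt (cov u) k)
    0
    (Matrix.of fun i k => -(xt (cov u) i * xt (cov u) k
      * (logistic (lin u Ψ) * (1 - logistic (lin u Ψ)))))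

lemma lin_add_smul (u : Rec p) (Ψ v : Idx p → ℝ) (t : ℝ) :
    lin u (Ψ + t • v) = lin u Ψ + t * lin u v := by
  simp only [lin, dotProduct, Finset.mul_sum, ← Finset.sum_add_distrib]
  exact Finset.sum_congr rfl fun k _ => by simp; ring

lemma hasDerivAt_lin (u : Rec p) (Ψ v : Idx p → ℝ) (t : ℝ) :
    HasDerivAt (fun t : ℝ => lin u (Ψ + t • v)) (lin u v) t := by
  simp only [lin_add_smul]
  simpa using ((hasDerivAt_id t).mul_const (lin u v)).const_add (lin u Ψ)

lemma hasDerivAt_coord (Ψ v : Idx p → ℝ) (i : Idx p) (t : ℝ) :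
    HasDerivAt (fun t : ℝ => (Ψ + t • v) i) (v i) t := by
  simpa using ((hasDerivAt_id t).mul_const (v i)).const_add (Ψ i)

/-- Differentiating along arbitrary lines serves twice: coordinate directions identify `jac` in
`jac_eq`, and the direction `Ψ − Ψ₀` gives the mean value expansion. -/
lemma hasDerivAt_U (u : Rec p) (Ψ v : Idx p → ℝ) (i : Idx p) (t : ℝ) :
    HasDerivAt (fun t : ℝ => U u (Ψ + t • v) i) ((jacMat u (Ψ + t • v)).mulVec v i) t := by
  have hl := hasDerivAt_lin u Ψ v t
  have hlv : lin u v = ∑ k, xt (cov u) k * v (Sum.inr k) := rfl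
  rcases i with i | i
  · fin_cases i
    · simp only [Fin.zero_eta, Fin.isValue, U_inl_zero]
      have h := (((hasDerivAt_coord Ψ v (Sum.inl 0) t).const_sub (Y₁ u)).const_mul (T u)).mul
        ((hl.neg.exp).const_add 1)
      refine h.congr_deriv ?_
      simp only [Matrix.mulVec, dotProduct, Fintype.sum_sum_type, Fin.sum_univ_two, jacMat,
        Matrix.fromBlocks_apply₁₁, Matrix.fromBlocks_apply₁₂, Matrix.of_apply, hlv]
      simp only [Fin.isValue, Matrix.cons_val_zero, Matrix.cons_val_one,
        Matrix.cons_val', Matrix.cons_val_fin_one, mul_assoc, ← Finset.mul_sum]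
      simp only [Pi.neg_apply]
      ring
    · simp only [Fin.mk_one, Fin.isValue, U_inl_one]
      have h := ((((hasDerivAt_coord Ψ v (Sum.inl 0) t).sub
        (hasDerivAt_coord Ψ v (Sum.inl 1) t)).const_sub (Y₀ u)).const_mul (1 - T u)).mul
        ((hl.exp).const_add 1)
      refine h.congr_deriv ?_
      simp only [Matrix.mulVec, dotProduct, Fintype.sum_sum_type, Fin.sum_univ_two, jacMat,
        Matrix.fromBlocks_apply₁₁, Matrix.fromBlocks_apply₁₂, Matrix.of_apply, hlv]
      simp only [Fin.isValue, Matrix.cons_val_zero, Matrix.cons_val_one,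
        Matrix.cons_val', Matrix.cons_val_fin_one, mul_assoc, ← Finset.mul_sum]
      simp only [Pi.sub_apply]
      ring
  · simp only [U_inr]
    have h := (((hasDerivAt_logistic _).comp t hl).const_sub (T u)).const_mul (xt (cov u) i)
    refine h.congr_deriv ?_
    simp only [Matrix.mulVec, dotProduct, Fintype.sum_sum_type, jacMat,
      Matrix.fromBlocks_apply₂₁, Matrix.fromBlocks_apply₂₂, Matrix.of_apply, hlv]
    simp only [Matrix.zero_apply, zero_mul, Finset.sum_const_zero, zero_add, Finset.mul_sum,
      ← Finset.sum_neg_distrib]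
    exact Finset.sum_congr rfl fun k _ => by ring

lemma jac_eq (u : Rec p) (Ψ : Idx p → ℝ) : jac u Ψ = jacMat u Ψ := by
  ext i k
  -- Starting from the point whose `k`-th coordinate is 0, the line parameter is itself that
  -- coordinate, as in the definition of `jac`.
  have h := hasDerivAt_U u (Function.update Ψ k 0) (Pi.single k 1) i (Ψ k)
  have e : ∀ t : ℝ, Function.update Ψ k 0 + t • (Pi.single k 1 : Idx p → ℝ)
      = Function.update Ψ k t := fun t => by
    ext l
    rcases eq_or_ne l k with rfl | hl <;> simp [*]
  simp only [e, Function.update_eq_self] at h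
  simp only [jac, Matrix.of_apply]
  rw [h.deriv]
  simp

/-- Mean value form of the expansion of the estimating functions. -/
lemma exists_U_sub_eq (u : Rec p) (Ψ₀ Ψ : Idx p → ℝ) (i : Idx p) :
    ∃ t ∈ Set.Ioo (0 : ℝ) 1, U u Ψ i - U u Ψ₀ i
      = (jacMat u (Ψ₀ + t • (Ψ - Ψ₀))).mulVec (Ψ - Ψ₀) i := by
  have hd := fun t => hasDerivAt_U u Ψ₀ (Ψ - Ψ₀) i t
  obtain ⟨t, ht, h⟩ := exists_hasDerivAt_eq_slope (fun t : ℝ => U u (Ψ₀ + t • (Ψ - Ψ₀)) i) _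
    zero_lt_one (fun t _ => (hd t).continuousAt.continuousWithinAt) fun t _ => hd t
  refine ⟨t, ht, ?_⟩
  rw [h]; simp

/-! ### Local Lipschitz bounds with an envelope -/

/-- The envelope `1 + |Y₁| + |Y₀| + ∑ |x̃ᵢ|`. -/
def env (u : Rec p) : ℝ := 1 + |Y₁ u| + |Y₀ u| + ∑ i, |xt (cov u) i|

lemma sum_abs_xt_nonneg (u : Rec p) : 0 ≤ ∑ i, |xt (cov u) i| :=
  Finset.sum_nonneg fun _ _ => abs_nonneg _

lemma one_le_env (u : Rec p) : 1 ≤ env u := by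
  unfold env; linarith [abs_nonneg (Y₁ u), abs_nonneg (Y₀ u), sum_abs_xt_nonneg u]

lemma abs_Y₁_le_env (u : Rec p) : |Y₁ u| ≤ env u := by
  unfold env; linarith [abs_nonneg (Y₁ u), abs_nonneg (Y₀ u), sum_abs_xt_nonneg u]

lemma abs_Y₀_le_env (u : Rec p) : |Y₀ u| ≤ env u := by
  unfold env; linarith [abs_nonneg (Y₁ u), abs_nonneg (Y₀ u), sum_abs_xt_nonneg u]

lemma sum_abs_xt_le_env (u : Rec p) : ∑ i, |xt (cov u) i| ≤ env u := by
  unfold env; linarith [abs_nonneg (Y₁ u), abs_nonneg (Y₀ u), sum_abs_xt_nonneg u]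

lemma abs_xt_le_env (u : Rec p) (i : Fin (p + 1)) : |xt (cov u) i| ≤ env u :=
  (Finset.single_le_sum (fun _ _ => abs_nonneg _) (Finset.mem_univ i)).trans
    (sum_abs_xt_le_env u)

/-- The parameter `Ψ` is `ε`-close to `Ψ₀` as seen by the unit `u`. -/
structure Near (Ψ₀ Ψ : Idx p → ℝ) (ε : ℝ) (u : Rec p) : Prop where
  lin : |lin u Ψ - lin u Ψ₀| ≤ ε
  inl : ∀ i, |Ψ (Sum.inl i) - Ψ₀ (Sum.inl i)| ≤ ε

lemma Near.nonneg {Ψ₀ Ψ : Idx p → ℝ} {ε : ℝ} {u : Rec p} (h : Near Ψ₀ Ψ ε u) : 0 ≤ ε :=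
  (abs_nonneg _).trans h.lin

lemma Near.segment {Ψ₀ Ψ : Idx p → ℝ} {ε : ℝ} {u : Rec p} (h : Near Ψ₀ Ψ ε u) {t : ℝ}
    (ht : t ∈ Set.Ioo (0 : ℝ) 1) : Near Ψ₀ (Ψ₀ + t • (Ψ - Ψ₀)) ε u := by
  have key : ∀ x : ℝ, |x| ≤ ε → |t * x| ≤ ε := fun x hx => by
    rw [abs_mul, abs_of_pos ht.1]
    exact (mul_le_of_le_one_left (abs_nonneg _) ht.2.le).trans hx
  refine ⟨?_, fun i => ?_⟩
  · rw [lin_add_smul, add_sub_cancel_left]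
    refine key _ ?_
    have e : PELCausal.lin u (Ψ - Ψ₀) = PELCausal.lin u Ψ - PELCausal.lin u Ψ₀ := by
      simp only [PELCausal.lin, dotProduct, ← Finset.sum_sub_distrib]
      exact Finset.sum_congr rfl fun k _ => by simp; ring
    rw [e]; exact h.lin
  · simpa using key _ (h.inl i)

/-- Functions of a unit and the parameter which, for units with bounded linear predictor, are
bounded by a multiple of `env ^ d` at `Ψ₀` and Lipschitz near `Ψ₀` with constant a multiple
of `env ^ d`. -/
def EnvLip (Ψ₀ : Idx p → ℝ) (R : ℝ) (d : ℕ) (k : Rec p → (Idx p → ℝ) → ℝ) : Prop :=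
  ∃ C, 0 ≤ C ∧ ∀ u, |lin u Ψ₀| ≤ R → |k u Ψ₀| ≤ C * env u ^ d ∧
    ∀ ε ≤ 1, ∀ Ψ, Near Ψ₀ Ψ ε u → |k u Ψ - k u Ψ₀| ≤ C * ε * env u ^ d

namespace EnvLip

variable {Ψ₀ : Idx p → ℝ} {R : ℝ} {d d' : ℕ} {k k' : Rec p → (Idx p → ℝ) → ℝ}

lemma mono (h : EnvLip Ψ₀ R d k) (hd : d ≤ d') : EnvLip Ψ₀ R d' k := by
  obtain ⟨C, hC, h⟩ := h
  refine ⟨C, hC, fun u hu => ⟨(h u hu).1.trans ?_, fun ε hε Ψ hΨ => ((h u hu).2 ε hε Ψ hΨ).trans ?_⟩⟩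
  · exact mul_le_mul_of_nonneg_left (pow_le_pow_right₀ (one_le_env u) hd) hC
  · exact mul_le_mul_of_nonneg_left (pow_le_pow_right₀ (one_le_env u) hd)
      (mul_nonneg hC hΨ.nonneg)

lemma add (h : EnvLip Ψ₀ R d k) (h' : EnvLip Ψ₀ R d k') :
    EnvLip Ψ₀ R d fun u Ψ => k u Ψ + k' u Ψ := by
  obtain ⟨C, hC, h⟩ := h
  obtain ⟨C', hC', h'⟩ := h'
  refine ⟨C + C', add_nonneg hC hC', fun u hu => ⟨?_, fun ε hε Ψ hΨ => ?_⟩⟩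
  · refine (abs_add_le _ _).trans ?_
    linarith [(h u hu).1, (h' u hu).1, add_mul C C' (env u ^ d)]
  · have e : k u Ψ + k' u Ψ - (k u Ψ₀ + k' u Ψ₀) = (k u Ψ - k u Ψ₀) + (k' u Ψ - k' u Ψ₀) := by ring
    rw [e]
    refine (abs_add_le _ _).trans ?_
    refine (add_le_add ((h u hu).2 ε hε Ψ hΨ) ((h' u hu).2 ε hε Ψ hΨ)).trans (le_of_eq ?_)
    ring

lemma neg (h : EnvLip Ψ₀ R d k) : EnvLip Ψ₀ R d fun u Ψ => -k u Ψ := by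
  obtain ⟨C, hC, h⟩ := h
  refine ⟨C, hC, fun u hu => ⟨by rw [abs_neg]; exact (h u hu).1, fun ε hε Ψ hΨ => ?_⟩⟩
  rw [← neg_sub', abs_neg]
  exact (h u hu).2 ε hε Ψ hΨ

lemma sub (h : EnvLip Ψ₀ R d k) (h' : EnvLip Ψ₀ R d k') :
    EnvLip Ψ₀ R d fun u Ψ => k u Ψ - k' u Ψ := by
  simpa only [sub_eq_add_neg] using h.add h'.neg

lemma mul (h : EnvLip Ψ₀ R d k) (h' : EnvLip Ψ₀ R d' k') :
    EnvLip Ψ₀ R (d + d') fun u Ψ => k u Ψ * k' u Ψ := by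
  obtain ⟨C, hC, h⟩ := h
  obtain ⟨C', hC', h'⟩ := h'
  -- The difference of products splits into three terms. The one with both increments carries `ε²`,
  -- which `ε ≤ 1` reduces to `ε`.
  refine ⟨3 * (C * C'), by positivity, fun u hu => ?_⟩
  have hE : 0 ≤ env u ^ d := pow_nonneg (zero_le_one.trans (one_le_env u)) _
  have hE' : 0 ≤ env u ^ d' := pow_nonneg (zero_le_one.trans (one_le_env u)) _
  obtain ⟨b, l⟩ := h u hu
  obtain ⟨b', l'⟩ := h' u hu
  rw [pow_add]
  refine ⟨?_, fun ε hε Ψ hΨ => ?_⟩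
  · rw [abs_mul]
    refine (mul_le_mul b b' (abs_nonneg _) (by positivity)).trans ?_
    have : 0 ≤ C * C' * (env u ^ d * env u ^ d') := by positivity
    nlinarith
  · have hε0 := hΨ.nonneg
    have e : k u Ψ * k' u Ψ - k u Ψ₀ * k' u Ψ₀ = (k u Ψ - k u Ψ₀) * (k' u Ψ - k' u Ψ₀)
        + (k u Ψ - k u Ψ₀) * k' u Ψ₀ + k u Ψ₀ * (k' u Ψ - k' u Ψ₀) := by ring
    rw [e]
    refine (abs_add_le _ _).trans ((add_le_add_left (abs_add_le _ _) _).trans ?_)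
    rw [abs_mul, abs_mul, abs_mul]
    have L := l ε hε Ψ hΨ
    have L' := l' ε hε Ψ hΨ
    have h1 := mul_le_mul L L' (abs_nonneg _) (by positivity)
    have h2 := mul_le_mul L b' (abs_nonneg _) (by positivity)
    have h3 := mul_le_mul b L' (abs_nonneg _) (by positivity)
    have h4 : C * ε * env u ^ d * (C' * ε * env u ^ d')
        ≤ C * C' * ε * (env u ^ d * env u ^ d') := by
      have : C * ε * env u ^ d * (C' * ε * env u ^ d')
        = ε * (C * C' * ε * (env u ^ d * env u ^ d')) := by ring
      rw [this]
      exact mul_le_of_le_one_left (by positivity) hε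
    linarith

lemma of_data {g : Rec p → ℝ} (hg : ∀ u, |g u| ≤ env u ^ d) : EnvLip Ψ₀ R d fun u _ => g u :=
  ⟨1, zero_le_one, fun u _ => ⟨by simpa using hg u, fun ε _ Ψ hΨ => by
    rw [sub_self, abs_zero]
    exact mul_nonneg (mul_nonneg zero_le_one hΨ.nonneg)
      (pow_nonneg (zero_le_one.trans (one_le_env u)) _)⟩⟩

lemma Y₁ : EnvLip Ψ₀ R 1 fun u _ => Y₁ u := of_data fun u => by simpa using abs_Y₁_le_env u

lemma Y₀ : EnvLip Ψ₀ R 1 fun u _ => Y₀ u := of_data fun u => by simpa using abs_Y₀_le_env u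

lemma xt (i : Fin (p + 1)) : EnvLip Ψ₀ R 1 fun u _ => xt (cov u) i :=
  of_data fun u => by simpa using abs_xt_le_env u i

lemma one : EnvLip Ψ₀ R 0 fun _ _ => (1 : ℝ) := of_data fun u => by simp

lemma T : EnvLip Ψ₀ R 0 fun u _ => T u := of_data fun u => by
  unfold PELCausal.T; split_ifs <;> simp

lemma zero : EnvLip Ψ₀ R 0 fun _ _ => (0 : ℝ) := of_data fun u => by simp

lemma inl (i : Fin 2) : EnvLip Ψ₀ R 0 fun _ Ψ => Ψ (Sum.inl i) := by
  refine ⟨|Ψ₀ (Sum.inl i)| + 1, by positivity, fun u _ => ⟨by simp, fun ε _ Ψ hΨ => ?_⟩⟩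
  rw [pow_zero, mul_one]
  refine (hΨ.inl i).trans (le_mul_of_one_le_left hΨ.nonneg ?_)
  linarith [abs_nonneg (Ψ₀ (Sum.inl i))]

/-- For `ε ≤ 1` the predictor stays in `[−R − 1, R + 1]`, where `f` and its derivative are bounded
by compactness. Exponentials therefore cost no power of the envelope. -/
lemma comp_lin {f : ℝ → ℝ} (hf : ContDiff ℝ 1 f) : EnvLip Ψ₀ R 0 fun u Ψ => f (lin u Ψ) := by
  obtain ⟨C, hC⟩ := (isCompact_Icc (a := -(R + 1)) (b := R + 1)).exists_bound_of_continuousOn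
    hf.continuous.continuousOn
  obtain ⟨C', hC'⟩ := (isCompact_Icc (a := -(R + 1)) (b := R + 1)).exists_bound_of_continuousOn
    (hf.continuous_deriv le_rfl).continuousOn
  refine ⟨max 0 (max C C'), le_max_left _ _, fun u hu => ?_⟩
  simp only [pow_zero, mul_one]
  have hu' := abs_le.1 hu
  have m₀ : lin u Ψ₀ ∈ Set.Icc (-(R + 1)) (R + 1) := ⟨by linarith, by linarith⟩
  refine ⟨(hC _ m₀).trans ((le_max_left _ _).trans (le_max_right _ _)), fun ε hε Ψ hΨ => ?_⟩
  have hl := abs_le.1 hΨ.lin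
  have m : lin u Ψ ∈ Set.Icc (-(R + 1)) (R + 1) := ⟨by linarith, by linarith⟩
  have h := (convex_Icc (-(R + 1)) (R + 1)).norm_image_sub_le_of_norm_deriv_le
    (fun x _ => (hf.differentiable one_ne_zero).differentiableAt) hC' m₀ m
  refine h.trans ?_
  have h1 : C' ≤ max 0 (max C C') := (le_max_right _ _).trans (le_max_right _ _)
  exact mul_le_mul h1 hΨ.lin (norm_nonneg _) (le_max_left _ _)

lemma invPs₁ : EnvLip Ψ₀ R 0 fun u Ψ => 1 + Real.exp (-lin u Ψ) :=
  comp_lin (f := fun t => 1 + Real.exp (-t)) (by fun_prop)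

lemma invPs₀ : EnvLip Ψ₀ R 0 fun u Ψ => 1 + Real.exp (lin u Ψ) :=
  comp_lin (f := fun t => 1 + Real.exp t) (by fun_prop)

lemma U (i : Idx p) : EnvLip Ψ₀ R 1 fun u Ψ => U u Ψ i := by
  rcases i with i | i
  · fin_cases i
    · simp only [Fin.zero_eta, U_inl_zero]
      exact (T.mul (Y₁.sub ((inl 0).mono zero_le_one))).mul invPs₁
    · simp only [Fin.mk_one, U_inl_one]
      exact ((one.sub T).mul (Y₀.sub (((inl 0).sub (inl 1)).mono zero_le_one))).mul invPs₀
  · simp only [U_inr]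
    exact (xt i).mul (T.sub (comp_lin contDiff_logistic))

/-- Degree two, reached by products such as `Y x̃` and `x̃ x̃`, is just what finite second moments
can integrate. -/
lemma jacMat (i k : Idx p) : EnvLip Ψ₀ R 2 fun u Ψ => jacMat u Ψ i k := by
  rcases i with i | i <;> rcases k with k | k
  · refine EnvLip.mono (d := 0) ?_ (by norm_num)
    fin_cases i <;> fin_cases k
    · exact (T.mul invPs₁).neg
    · exact zero
    · exact ((one.sub T).mul invPs₀).neg
    · exact (one.sub T).mul invPs₀
  · fin_cases i
    · exact (((T.mul (Y₁.sub ((inl 0).mono zero_le_one))).mul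
        (comp_lin (f := fun t => Real.exp (-t)) (by fun_prop))).neg).mul (xt k)
    · exact ((((one.sub T).mul (Y₀.sub (((inl 0).sub (inl 1)).mono zero_le_one))).mul
        (comp_lin (f := fun t => Real.exp t) (by fun_prop)))).mul (xt k)
  · exact zero.mono (by norm_num)
  · exact (((xt i).mul (xt k)).mul ((comp_lin contDiff_logistic).mul
      (one.sub (comp_lin contDiff_logistic)))).neg

end EnvLip

variable {p : ℕ}

/-! ### The logistic likelihood -/

/-- The function `log (1 + exp t)`. -/
def softplus (t : ℝ) : ℝ := Real.log (1 + Real.exp t)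

lemma hasDerivAt_softplus (t : ℝ) : HasDerivAt softplus (logistic t) t :=
  ((Real.hasDerivAt_exp t).const_add 1).log (by positivity)

lemma logistic_pos (t : ℝ) : 0 < logistic t := by unfold logistic; positivity

lemma logistic_lt_one (t : ℝ) : logistic t < 1 := by
  unfold logistic
  rw [div_lt_one (by positivity)]; linarith

/-- The second derivative is `logistic (1 − logistic) − 2κ`. The case `κ = 0` gives global concavity
of the log-likelihood, a positive `κ` its local curvature. -/
lemma convexOn_softplus_sub {D : Set ℝ} (hD : Convex ℝ D) {κ : ℝ}
    (h : ∀ t ∈ D, 2 * κ ≤ logistic t * (1 - logistic t)) :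
    ConvexOn ℝ D fun t => softplus t - κ * t ^ 2 := by
  have h1 : ∀ t, HasDerivAt (fun t => softplus t - κ * t ^ 2) (logistic t - 2 * κ * t) t :=
    fun t => ((hasDerivAt_softplus t).sub (((hasDerivAt_pow 2 t)).const_mul κ)).congr_deriv
      (by norm_num; ring)
  have h2 : ∀ t, HasDerivAt (fun t => logistic t - 2 * κ * t)
      (logistic t * (1 - logistic t) - 2 * κ) t :=
    fun t => ((hasDerivAt_logistic t).sub ((hasDerivAt_id t).const_mul (2 * κ))).congr_deriv
      (by ring)
  exact convexOn_of_hasDerivWithinAt2_nonneg hD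
    (fun t _ => (h1 t).continuousAt.continuousWithinAt)
    (fun t _ => (h1 t).hasDerivWithinAt) (fun t _ => (h2 t).hasDerivWithinAt)
    fun t ht => sub_nonneg.2 (h t (interior_subset ht))

lemma convexOn_softplus : ConvexOn ℝ Set.univ softplus := by
  have h := convexOn_softplus_sub convex_univ (κ := 0) fun t _ => by
    rw [mul_zero]
    exact mul_nonneg (logistic_pos t).le (sub_nonneg.2 (logistic_lt_one t).le)
  simpa using h

/-- Strong convexity of `log (1 + exp t)` on bounded sets. -/
lemma exists_softplus_lower (R : ℝ) : ∃ κ > 0, ∀ t d, |t| ≤ R → |d| ≤ 1 →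
    softplus t + logistic t * d + κ * d ^ 2 ≤ softplus (t + d) := by
  rcases lt_or_ge R 0 with hR | hR
  · exact ⟨1, one_pos, fun t d ht _ => absurd ((abs_nonneg t).trans ht) (not_le.2 hR)⟩
  obtain ⟨t₀, -, h₀⟩ := (isCompact_Icc (a := -(R + 1)) (b := R + 1)).exists_isMinOn
    ⟨0, by constructor <;> linarith⟩
    (f := fun t => logistic t * (1 - logistic t))
    ((contDiff_logistic (m := 0)).continuous.mul
      (continuous_const.sub (contDiff_logistic (m := 0)).continuous)).continuousOn
  -- Half the minimal second derivative over the interval, which is widened by one so as to contain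
  -- `t + d`.
  set κ := logistic t₀ * (1 - logistic t₀) / 2 with hκ
  have hκ0 : 0 < κ := by
    have := mul_pos (logistic_pos t₀) (sub_pos.2 (logistic_lt_one t₀))
    positivity
  refine ⟨κ, hκ0, fun t d ht hd => ?_⟩
  have hc := convexOn_softplus_sub (convex_Icc (-(R + 1)) (R + 1)) (κ := κ) fun t ht => by
    have : logistic t₀ * (1 - logistic t₀) ≤ logistic t * (1 - logistic t) := h₀ ht
    rw [hκ]; linarith
  have hd' : HasDerivAt (fun t => softplus t - κ * t ^ 2) (logistic t - 2 * κ * t) t :=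
    ((hasDerivAt_softplus t).sub (((hasDerivAt_pow 2 t)).const_mul κ)).congr_deriv
      (by norm_num; ring)
  have ht' := abs_le.1 ht
  have hdd := abs_le.1 hd
  have m₀ : t ∈ Set.Icc (-(R + 1)) (R + 1) := ⟨by linarith, by linarith⟩
  have m : t + d ∈ Set.Icc (-(R + 1)) (R + 1) := ⟨by linarith, by linarith⟩
  -- The tangent inequality at `t` for the convex function `softplus t − κ t²`. Expanding the
  -- squares leaves exactly `κ d²`.
  rcases lt_trichotomy d 0 with h | rfl | h
  · have := hc.slope_le_of_hasDerivAt m m₀ (by linarith) hd'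
    rw [slope_def_field, div_le_iff₀ (by linarith)] at this
    nlinarith
  · simp
  · have := hc.le_slope_of_hasDerivAt m₀ m (by linarith) hd'
    rw [slope_def_field, le_div_iff₀ (by linarith)] at this
    nlinarith

variable {n : ℕ} {s : Fin n → Rec p}

/-- The log-likelihood of the propensity score model. -/
def logLik (s : Fin n → Rec p) (α : Fin (p + 1) → ℝ) : ℝ :=
  ∑ j, (T (s j) * (xt (cov (s j)) ⬝ᵥ α) - softplus (xt (cov (s j)) ⬝ᵥ α))

lemma lik_eq (α : Fin (p + 1) → ℝ) : lik s α = Real.exp (logLik s α) := by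
  rw [logLik, Real.exp_sum, lik]
  refine Finset.prod_congr rfl fun j _ => ?_
  rw [Real.exp_sub, softplus, Real.exp_log (by positivity)]
  unfold T
  split_ifs
  · simp [ps]
  · simp [one_sub_ps]

lemma isMLE_iff {α : Fin (p + 1) → ℝ} : IsMLE s α ↔ ∀ α', logLik s α' ≤ logLik s α := by
  simp [IsMLE, IsMaximizer, isMaxOn_iff, lik_eq]

lemma continuous_softplus : Continuous softplus :=
  continuous_iff_continuousAt.2 fun t => (hasDerivAt_softplus t).continuousAt

lemma continuous_logLik : Continuous (logLik s) := by
  have : ∀ j, Continuous fun α : Fin (p + 1) → ℝ => xt (cov (s j)) ⬝ᵥ α := fun j =>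
    continuous_finsetSum _ fun i _ => by fun_prop
  exact continuous_finsetSum _ fun j _ => ((this j).const_mul _).sub
    (continuous_softplus.comp (this j))

/-- Concavity of the log-likelihood. -/
lemma le_logLik_segment (α α' : Fin (p + 1) → ℝ) {t : ℝ} (ht : t ∈ Set.Icc (0 : ℝ) 1) :
    (1 - t) * logLik s α + t * logLik s α' ≤ logLik s (α + t • (α' - α)) := by
  unfold logLik
  rw [Finset.mul_sum, Finset.mul_sum, ← Finset.sum_add_distrib]
  refine Finset.sum_le_sum fun j _ => ?_
  have e : xt (cov (s j)) ⬝ᵥ (α + t • (α' - α))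
      = (1 - t) * (xt (cov (s j)) ⬝ᵥ α) + t * (xt (cov (s j)) ⬝ᵥ α') := by
    rw [dotProduct_add, dotProduct_smul, dotProduct_sub, smul_eq_mul]; ring
  have h := convexOn_softplus.2 (Set.mem_univ (xt (cov (s j)) ⬝ᵥ α))
    (Set.mem_univ (xt (cov (s j)) ⬝ᵥ α')) (sub_nonneg.2 ht.2) ht.1 (by ring)
  simp only [smul_eq_mul] at h
  rw [e]
  linarith

/-- If the log-likelihood is smaller on a sphere than at its centre, then it has a maximizer and
all maximizers lie in the ball. -/
lemma exists_isMLE_of_sphere {α₀ : Fin (p + 1) → ℝ} {r : ℝ} (hr : 0 < r)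
    (h : ∀ v : Fin (p + 1) → ℝ, ‖v‖ = r → logLik s (α₀ + v) < logLik s α₀) :
    (∃ α, IsMLE s α) ∧ ∀ α, IsMLE s α → ‖α - α₀‖ ≤ r := by
  -- By concavity, a point outside the ball at least as good as the centre would make the point
  -- where its segment crosses the sphere at least as good as the centre too.
  have key : ∀ α, r < ‖α - α₀‖ → logLik s α < logLik s α₀ := by
    intro α hα
    by_contra! hle
    have hpos : 0 < ‖α - α₀‖ := hr.trans hα
    have ht : r / ‖α - α₀‖ ∈ Set.Icc (0 : ℝ) 1 :=
      ⟨by positivity, (div_le_one hpos).2 hα.le⟩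
    have h1 := le_logLik_segment (s := s) α₀ α ht
    have h2 := h ((r / ‖α - α₀‖) • (α - α₀)) (by
      rw [norm_smul, Real.norm_of_nonneg ht.1, div_mul_cancel₀ _ hpos.ne'])
    nlinarith [ht.1, ht.2]
  constructor
  · obtain ⟨α, hα, hmax⟩ := (isCompact_closedBall α₀ r).exists_isMaxOn
      ⟨α₀, Metric.mem_closedBall_self hr.le⟩ (continuous_logLik (s := s)).continuousOn
    refine ⟨α, isMLE_iff.2 fun α' => ?_⟩
    rcases le_or_gt ‖α' - α₀‖ r with h' | h'
    · exact hmax (by rwa [Metric.mem_closedBall, dist_eq_norm])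
    · exact (key α' h').le.trans (hmax (Metric.mem_closedBall_self hr.le))
  · intro α hα
    by_contra! h'
    exact absurd (isMLE_iff.1 hα α₀) (not_le.2 (key α h'))

/-- The likelihood equations. -/
lemma IsMLE.sum_score_eq_zero {α : Fin (p + 1) → ℝ} (h : IsMLE s α) (i : Fin (p + 1)) :
    ∑ j, xt (cov (s j)) i * (T (s j) - logistic (xt (cov (s j)) ⬝ᵥ α)) = 0 := by
  have hd : HasDerivAt (fun t : ℝ => logLik s (α + t • Pi.single i 1))
      (∑ j, (T (s j) * xt (cov (s j)) i
        - logistic (xt (cov (s j)) ⬝ᵥ (α + (0 : ℝ) • Pi.single i 1)) * xt (cov (s j)) i)) 0 := by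
    unfold logLik
    refine HasDerivAt.fun_sum fun j _ => ?_
    have hl : HasDerivAt (fun t : ℝ => xt (cov (s j)) ⬝ᵥ (α + t • Pi.single i 1))
        (xt (cov (s j)) i) 0 := by
      simp only [dotProduct_add, dotProduct_smul, dotProduct_single, mul_one, smul_eq_mul]
      simpa using ((hasDerivAt_id (0 : ℝ)).mul_const (xt (cov (s j)) i)).const_add
        (xt (cov (s j)) ⬝ᵥ α)
    exact (hl.const_mul _).sub ((hasDerivAt_softplus _).comp 0 hl)
  have hmax : IsLocalMax (fun t : ℝ => logLik s (α + t • Pi.single i 1)) 0 :=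
    Eventually.of_forall fun t => by
      simpa using isMLE_iff.1 h (α + t • Pi.single i 1)
  have h0 := hmax.hasDerivAt_eq_zero hd
  rw [← h0]
  refine Finset.sum_congr rfl fun j _ => ?_
  simp only [zero_smul, add_zero]; ring

/-- A lower bound for quadratic forms that is uniform near a positive definite matrix. -/
lemma exists_quadForm_lower {m : ℕ} {D : Matrix (Fin m) (Fin m) ℝ} (hD : D.PosDef) :
    ∃ c > 0, ∀ M : Matrix (Fin m) (Fin m) ℝ, (∀ i k, |M i k - D i k| ≤ c) →
      ∀ g : Fin m → ℝ, c * ‖g‖ ^ 2 ≤ ∑ i, ∑ k, M i k * (g i * g k) := by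
  set Q : Matrix (Fin m) (Fin m) ℝ → (Fin m → ℝ) → ℝ :=
    fun M g => ∑ i, ∑ k, M i k * (g i * g k) with hQ
  have hQD : ∀ g, g ≠ 0 → 0 < Q D g := fun g hg => by
    have h := hD.dotProduct_mulVec_pos hg
    simp only [star_trivial, dotProduct, Matrix.mulVec, Finset.mul_sum] at h
    refine h.trans_eq ?_
    exact Finset.sum_congr rfl fun i _ => Finset.sum_congr rfl fun k _ => by ring
  obtain ⟨b, hb, hbQ⟩ : ∃ b > 0, ∀ g, ‖g‖ = 1 → b ≤ Q D g := by
    -- The unit sphere is empty when `m = 0`.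
    rcases (Metric.sphere (0 : Fin m → ℝ) 1).eq_empty_or_nonempty with he | hne
    · refine ⟨1, one_pos, fun g hg => ?_⟩
      have : g ∈ Metric.sphere (0 : Fin m → ℝ) 1 := by simpa using hg
      rw [he] at this
      exact absurd this (Set.notMem_empty g)
    · obtain ⟨g₀, hg₀, hmin⟩ := (isCompact_sphere (0 : Fin m → ℝ) 1).exists_isMinOn hne
        (f := Q D) (by fun_prop)
      refine ⟨Q D g₀, hQD g₀ ?_, fun g hg => hmin (by simpa using hg)⟩
      rintro rfl
      simp at hg₀
  have hbQ' : ∀ g, b * ‖g‖ ^ 2 ≤ Q D g := fun g => by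
    rcases eq_or_ne g 0 with rfl | hg
    · simp [hQ]
    · have hn : 0 < ‖g‖ := norm_pos_iff.2 hg
      have h := hbQ (‖g‖⁻¹ • g) (by rw [norm_smul, norm_inv, norm_norm, inv_mul_cancel₀ hn.ne'])
      have e : Q D (‖g‖⁻¹ • g) = (‖g‖ ^ 2)⁻¹ * Q D g := by
        simp only [hQ, Finset.mul_sum, Pi.smul_apply, smul_eq_mul]
        refine Finset.sum_congr rfl fun i _ => Finset.sum_congr rfl fun k _ => ?_
        field_simp
      rw [e, inv_mul_eq_div, le_div_iff₀ (by positivity)] at h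
      exact h
  -- Entrywise perturbations by `c` change the form by at most `m² c ‖g‖²`, and this `c` solves `b −
  -- m² c = c`.
  refine ⟨b / ((m : ℝ) ^ 2 + 1), by positivity, fun M hM g => ?_⟩
  set c := b / ((m : ℝ) ^ 2 + 1) with hc
  have hdiff : |Q M g - Q D g| ≤ (m : ℝ) ^ 2 * (c * ‖g‖ ^ 2) := by
    have e : Q M g - Q D g = ∑ i, ∑ k, (M i k - D i k) * (g i * g k) := by
      simp only [hQ, ← Finset.sum_sub_distrib, sub_mul]
    rw [e]
    refine (Finset.abs_sum_le_sum_abs _ _).trans ?_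
    have : ∀ i ∈ Finset.univ, |∑ k, (M i k - D i k) * (g i * g k)| ≤ m * (c * ‖g‖ ^ 2) := by
      intro i _
      refine (Finset.abs_sum_le_sum_abs _ _).trans ?_
      have : ∀ k ∈ Finset.univ, |(M i k - D i k) * (g i * g k)| ≤ c * ‖g‖ ^ 2 := by
        intro k _
        rw [abs_mul, abs_mul]
        have h1 : |g i| ≤ ‖g‖ := norm_le_pi_norm g i
        have h2 : |g k| ≤ ‖g‖ := norm_le_pi_norm g k
        refine mul_le_mul (hM i k) ?_ (by positivity) (by positivity)
        rw [sq]
        exact mul_le_mul h1 h2 (abs_nonneg _) (norm_nonneg _)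
      simpa using Finset.sum_le_card_nsmul _ _ _ this
    refine (Finset.sum_le_card_nsmul _ _ _ this).trans (le_of_eq ?_)
    simp; ring
  have h1 := (abs_le.1 hdiff).1
  have h2 := hbQ' g
  have h3 : b = (m : ℝ) ^ 2 * c + c := by rw [hc]; field_simp
  show c * ‖g‖ ^ 2 ≤ Q M g
  nlinarith

variable {p : ℕ}

/-! ### Measurability -/

lemma measurable_Y₁ : Measurable (Y₁ : Rec p → ℝ) := by unfold Y₁; fun_prop

lemma measurable_Y₀ : Measurable (Y₀ : Rec p → ℝ) := by unfold Y₀; fun_prop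

lemma measurable_trt : Measurable (trt : Rec p → Bool) := by unfold trt; fun_prop

lemma measurable_T : Measurable (T : Rec p → ℝ) :=
  Measurable.ite (measurable_trt (measurableSet_singleton true)) measurable_const measurable_const

lemma measurable_xt (i : Fin (p + 1)) : Measurable fun u : Rec p => xt (cov u) i := by
  unfold xt cov
  refine Fin.cases ?_ (fun i => ?_) i
  · simp
  · simp only [Fin.cons_succ]; fun_prop

lemma measurable_lin_uncurry : Measurable fun x : Rec p × (Idx p → ℝ) => lin x.1 x.2 := by
  unfold lin dotProduct
  exact Finset.measurable_fun_sum _ fun i _ => ((measurable_xt i).comp measurable_fst).mul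
    ((measurable_pi_apply _).comp measurable_snd)

lemma measurable_lin (Ψ : Idx p → ℝ) : Measurable fun u : Rec p => lin u Ψ :=
  measurable_lin_uncurry.comp (measurable_id.prodMk measurable_const)

lemma measurable_logistic : Measurable logistic :=
  (contDiff_logistic (m := 0)).continuous.measurable

lemma measurable_env : Measurable (env : Rec p → ℝ) :=
  ((measurable_const.add measurable_Y₁.abs).add measurable_Y₀.abs).add
    (Finset.measurable_fun_sum _ fun i _ => (measurable_xt i).abs)

lemma measurable_U_uncurry (i : Idx p) :
    Measurable fun x : Rec p × (Idx p → ℝ) => U x.1 x.2 i := by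
  have hT : Measurable fun x : Rec p × (Idx p → ℝ) => T x.1 :=
    measurable_T.comp measurable_fst
  have h1 : Measurable fun x : Rec p × (Idx p → ℝ) => Y₁ x.1 :=
    measurable_Y₁.comp measurable_fst
  have h0 : Measurable fun x : Rec p × (Idx p → ℝ) => Y₀ x.1 :=
    measurable_Y₀.comp measurable_fst
  have hl := measurable_lin_uncurry (p := p)
  rcases i with i | i
  · fin_cases i
    · simp only [Fin.zero_eta, U_inl_zero]; fun_prop
    · simp only [Fin.mk_one, U_inl_one]; fun_prop
  · simp only [U_inr]
    exact ((measurable_xt i).comp measurable_fst).mul (hT.sub (measurable_logistic.comp hl))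

lemma measurable_U (Ψ : Idx p → ℝ) (i : Idx p) : Measurable fun u : Rec p => U u Ψ i :=
  (measurable_U_uncurry i).comp (measurable_id.prodMk measurable_const)

lemma measurable_jacMat_uncurry (i k : Idx p) :
    Measurable fun x : Rec p × (Idx p → ℝ) => jacMat x.1 x.2 i k := by
  have hT : Measurable fun x : Rec p × (Idx p → ℝ) => T x.1 :=
    measurable_T.comp measurable_fst
  have h1 : Measurable fun x : Rec p × (Idx p → ℝ) => Y₁ x.1 :=
    measurable_Y₁.comp measurable_fst
  have h0 : Measurable fun x : Rec p × (Idx p → ℝ) => Y₀ x.1 :=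
    measurable_Y₀.comp measurable_fst
  have hx : ∀ k, Measurable fun x : Rec p × (Idx p → ℝ) => xt (cov x.1) k :=
    fun k => (measurable_xt k).comp measurable_fst
  have hl := measurable_lin_uncurry (p := p)
  have hg : Measurable fun x : Rec p × (Idx p → ℝ) => logistic (lin x.1 x.2) :=
    measurable_logistic.comp hl
  rcases i with i | i <;> rcases k with k | k
  · fin_cases i <;> fin_cases k <;> simp [jacMat] <;> fun_prop
  · have hx := hx k
    fin_cases i <;> simp [jacMat] <;> fun_prop
  · simp [jacMat]
  · have hxk := hx k
    have hxi := hx i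
    simp [jacMat]; fun_prop

lemma measurable_jacMat (Ψ : Idx p → ℝ) (i k : Idx p) :
    Measurable fun u : Rec p => jacMat u Ψ i k :=
  Measurable.of_uncurry_right (f := fun u Ψ => jacMat u Ψ i k) (measurable_jacMat_uncurry i k)

/-! ### Population facts and deterministic asymptotics -/

/-- The facts about the law `P` on which the asymptotics rest. -/
structure Model (P : Measure (Rec p)) (α₀ : Fin (p + 1) → ℝ) (R : ℝ) : Prop where
  isProb : IsProbabilityMeasure P
  bdd : ∀ᵐ u ∂P, |lin u (psi0 P α₀)| ≤ R
  env_sq : Integrable (fun u => env u ^ 2) P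
  isUnit_det : IsUnit (popH P α₀).det
  posDef : (design P).PosDef
  ipw₁ : ∀ g : ℝ → ℝ, Measurable g → Integrable (fun u => g (Y₁ u)) P →
    ∫ u, T u * g (Y₁ u) * (1 + Real.exp (-lin u (psi0 P α₀))) ∂P = ∫ u, g (Y₁ u) ∂P
  ipw₀ : ∀ g : ℝ → ℝ, Measurable g → Integrable (fun u => g (Y₀ u)) P →
    ∫ u, (1 - T u) * g (Y₀ u) * (1 + Real.exp (lin u (psi0 P α₀))) ∂P = ∫ u, g (Y₀ u) ∂P
  var_pos : 0 < ∫ u, (Y₁ u ^ 2 + Y₀ u ^ 2) ∂P - mu₁ P ^ 2 - mu₀ P ^ 2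

section

variable {P : Measure (Rec p)} {α₀ : Fin (p + 1) → ℝ} {R : ℝ} {k : Rec p → (Idx p → ℝ) → ℝ}
  {d : ℕ}

lemma EnvLip.integrable {Ψ₀ : Idx p → ℝ} (hk : EnvLip Ψ₀ R d k) (hd : d ≤ 2)
    (hm : Measurable fun u => k u Ψ₀) (hb : ∀ᵐ u ∂P, |lin u Ψ₀| ≤ R)
    (hsq : Integrable (fun u => env u ^ 2) P) : Integrable (fun u => k u Ψ₀) P := by
  obtain ⟨C, hC, h⟩ := hk.mono hd
  refine (hsq.const_mul C).mono' hm.aestronglyMeasurable ?_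
  filter_upwards [hb] with u hu using (h u hu).1

lemma Model.integrable (hP : Model P α₀ R) (hk : EnvLip (psi0 P α₀) R d k) (hd : d ≤ 2)
    (hm : Measurable fun u => k u (psi0 P α₀)) : Integrable (fun u => k u (psi0 P α₀)) P :=
  hk.integrable hd hm hP.bdd hP.env_sq

lemma Model.integrable_of_abs_le (hP : Model P α₀ R) {g : Rec p → ℝ} (hm : Measurable g)
    (hg : ∀ u, |g u| ≤ env u ^ d) (hd : d ≤ 2) : Integrable g P :=
  hP.integrable (k := fun u _ => g u) (EnvLip.of_data hg) hd hm

end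

/-- The sample average of a function. -/
def avg {n : ℕ} (f : Fin n → ℝ) : ℝ := (n : ℝ)⁻¹ * ∑ j, f j

variable {ι : Type*}

/-- Samples behaving like random samples from `P`: laws of large numbers hold, the envelope
is uniformly negligible compared with the square root of the sample size, and the normalized
estimating function converges. -/
structure Regime (P : Measure (Rec p)) (α₀ : Fin (p + 1) → ℝ) (R : ℝ) (F : Filter ι) (N : ι → ℕ)
    (s : ∀ i, Fin (N i) → Rec p) (z : Idx p → ℝ) : Prop where
  tendsto_N : Tendsto N F atTop
  bdd : ∀ᶠ i in F, ∀ j, |lin (s i j) (psi0 P α₀)| ≤ R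
  lln : ∀ g : Rec p → ℝ, Measurable g → Integrable g P →
    Tendsto (fun i => avg fun j => g (s i j)) F (𝓝 (∫ u, g u ∂P))
  env : ∀ ε > 0, ∀ᶠ i in F, ∀ j, env (s i j) ≤ ε * √(N i)
  score : ∀ l, Tendsto (fun i => (√(N i))⁻¹ * ∑ j, U (s i j) (psi0 P α₀) l) F (𝓝 (z l))

namespace Regime

variable {P : Measure (Rec p)} {α₀ : Fin (p + 1) → ℝ} {R : ℝ} {F : Filter ι} {N : ι → ℕ}
  {s : ∀ i, Fin (N i) → Rec p} {z : Idx p → ℝ} {k : Rec p → (Idx p → ℝ) → ℝ} {d : ℕ}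

lemma eventually_pos (h : Regime P α₀ R F N s z) : ∀ᶠ i in F, (0 : ℝ) < N i := by
  filter_upwards [h.tendsto_N.eventually_ge_atTop 1] with i hi
  exact_mod_cast hi

/-- Uniform law of large numbers at nearby, possibly varying, parameters. -/
lemma tendsto_avg (h : Regime P α₀ R F N s z) (hP : Model P α₀ R)
    (hk : EnvLip (psi0 P α₀) R d k) (hd : d ≤ 2) (hm : Measurable fun u => k u (psi0 P α₀))
    {Ψ : ∀ i, Fin (N i) → Idx p → ℝ}
    (hΨ : ∀ ε > 0, ∀ᶠ i in F, ∀ j, Near (psi0 P α₀) (Ψ i j) ε (s i j)) :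
    Tendsto (fun i => avg fun j => k (s i j) (Ψ i j)) F (𝓝 (∫ u, k u (psi0 P α₀) ∂P)) := by
  have h1 := h.lln _ hm (hP.integrable hk hd hm)
  have h2 := h.lln _ (measurable_env.pow_const 2) hP.env_sq
  obtain ⟨C, hC, hk⟩ := hk.mono hd
  set A := ∫ u, PELCausal.env u ^ 2 ∂P with hA
  have hA0 : 0 ≤ A := integral_nonneg fun u => by positivity
  have h3 : Tendsto (fun i => (avg fun j => k (s i j) (Ψ i j))
      - avg fun j => k (s i j) (psi0 P α₀)) F (𝓝 0) := by
    rw [Metric.tendsto_nhds]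
    intro δ hδ
    -- The average of `env²` is eventually below `A + 1`, so the total error is at most `C ε (A +
    -- 1)`, which this choice keeps below `δ`.
    set ε := min 1 (δ / (C * (A + 1) + 1)) with hε
    have hden : 0 < C * (A + 1) + 1 := by positivity
    have hε0 : 0 < ε := lt_min one_pos (by positivity)
    filter_upwards [hΨ ε hε0, h.bdd, h2.eventually_lt_const (lt_add_one A), h.eventually_pos]
      with i hi hb hA hN
    rw [Real.dist_eq, sub_zero]
    have e : (avg fun j => k (s i j) (Ψ i j)) - (avg fun j => k (s i j) (psi0 P α₀))
        = (N i : ℝ)⁻¹ * ∑ j, (k (s i j) (Ψ i j) - k (s i j) (psi0 P α₀)) := by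
      rw [Finset.sum_sub_distrib, avg, avg]; ring
    rw [e, abs_mul, abs_of_pos (inv_pos.2 hN)]
    have h4 : |∑ j, (k (s i j) (Ψ i j) - k (s i j) (psi0 P α₀))|
        ≤ C * ε * ∑ j, PELCausal.env (s i j) ^ 2 := by
      rw [Finset.mul_sum]
      refine (Finset.abs_sum_le_sum_abs _ _).trans (Finset.sum_le_sum fun j _ => ?_)
      exact (hk _ (hb j)).2 ε (min_le_left _ _) _ (hi j)
    calc _ ≤ (N i : ℝ)⁻¹ * (C * ε * ∑ j, PELCausal.env (s i j) ^ 2) :=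
          mul_le_mul_of_nonneg_left h4 (inv_pos.2 hN).le
      _ = C * ε * avg fun j => PELCausal.env (s i j) ^ 2 := by rw [avg]; ring
      _ ≤ C * ε * (A + 1) := mul_le_mul_of_nonneg_left hA.le (by positivity)
      _ = ε * (C * (A + 1)) := by ring
      _ ≤ δ / (C * (A + 1) + 1) * (C * (A + 1)) :=
          mul_le_mul_of_nonneg_right (min_le_right _ _) (by positivity)
      _ < δ := by
          rw [div_mul_eq_mul_div, div_lt_iff₀ hden]
          nlinarith
  have h4 := h3.add h1
  simpa using h4

/-- Root-`n` consistency of the maximum likelihood estimator. -/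
lemma exists_mle (h : Regime P α₀ R F N s z) (hP : Model P α₀ R) :
    ∃ K, ∀ᶠ i in F, (∃ α, IsMLE (s i) α) ∧ ∀ α, IsMLE (s i) α → √(N i) * ‖α - α₀‖ ≤ K := by
  obtain ⟨κ, hκ, hsoft⟩ := exists_softplus_lower R
  obtain ⟨c, hc, hquad⟩ := exists_quadForm_lower hP.posDef
  set Z : ℝ := ∑ l : Fin (p + 1), (|z (Sum.inr l)| + 1) with hZ
  have hZ0 : 0 ≤ Z := Finset.sum_nonneg fun _ _ => by positivity
  -- On the sphere of radius `K / √N` the linear term of the log-likelihood gains at most `K Z`,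
  -- while the curvature costs at least `κ c K²`. This `K` makes the cost larger.
  set K : ℝ := Z / (κ * c) + 1 with hK
  have hK0 : 0 < K := by positivity
  have hZK : Z < κ * c * K := by
    have : κ * c * K = Z + κ * c := by rw [hK]; field_simp
    rw [this]; have := mul_pos hκ hc; linarith
  refine ⟨K, ?_⟩
  have hM : ∀ᶠ i in F, ∀ l m, |(avg fun j => xt (cov (s i j)) l * xt (cov (s i j)) m)
      - design P l m| ≤ c := by
    rw [eventually_all]; intro l; rw [eventually_all]; intro m
    have hb : ∀ u : Rec p, |xt (cov u) l * xt (cov u) m| ≤ PELCausal.env u ^ 2 := fun u => by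
      rw [abs_mul, sq]
      exact mul_le_mul (abs_xt_le_env u l) (abs_xt_le_env u m) (abs_nonneg _)
        (zero_le_one.trans (one_le_env u))
    have hmeas := (measurable_xt (p := p) l).mul (measurable_xt m)
    have := h.lln _ hmeas (hP.integrable_of_abs_le hmeas hb le_rfl)
    have := this.eventually (Metric.closedBall_mem_nhds _ hc)
    filter_upwards [this] with i hi
    rwa [Real.dist_eq] at hi
  have hS : ∀ᶠ i in F, ∀ l : Fin (p + 1),
      |(√(N i))⁻¹ * ∑ j, U (s i j) (psi0 P α₀) (Sum.inr l)| ≤ |z (Sum.inr l)| + 1 := by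
    rw [eventually_all]; intro l
    have := (h.score (Sum.inr l)).abs.eventually_lt_const (lt_add_one |z (Sum.inr l)|)
    filter_upwards [this] with i hi using hi.le
  filter_upwards [hM, hS, h.bdd, h.env K⁻¹ (by positivity), h.eventually_pos] with i hM hS hb he hN
  have hsq : 0 < √(N i : ℝ) := Real.sqrt_pos.2 hN
  have hsph : ∀ v : Fin (p + 1) → ℝ, ‖v‖ = K / √(N i) →
      logLik (s i) (α₀ + v) < logLik (s i) α₀ := by
    intro v hv
    have hlin : ∀ j, xt (cov (s i j)) ⬝ᵥ α₀ = lin (s i j) (psi0 P α₀) := fun j => rfl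
    -- The envelope is at most `√N / K`, so increments of the predictor on this sphere stay in the
    -- range where the curvature bound holds.
    have hd : ∀ j, |xt (cov (s i j)) ⬝ᵥ v| ≤ 1 := fun j => by
      calc |xt (cov (s i j)) ⬝ᵥ v| ≤ ∑ l, |xt (cov (s i j)) l * v l| :=
            Finset.abs_sum_le_sum_abs _ _
        _ ≤ ∑ l, |xt (cov (s i j)) l| * ‖v‖ := Finset.sum_le_sum fun l _ => by
            rw [abs_mul]
            exact mul_le_mul_of_nonneg_left (norm_le_pi_norm v l) (abs_nonneg _)
        _ = (∑ l, |xt (cov (s i j)) l|) * ‖v‖ := by rw [Finset.sum_mul]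
        _ ≤ K⁻¹ * √(N i) * ‖v‖ := mul_le_mul_of_nonneg_right
            ((sum_abs_xt_le_env _).trans (he j)) (norm_nonneg _)
        _ = 1 := by rw [hv]; field_simp
    have h1 : logLik (s i) (α₀ + v) - logLik (s i) α₀
        ≤ ∑ j, (T (s i j) - logistic (lin (s i j) (psi0 P α₀))) * (xt (cov (s i j)) ⬝ᵥ v)
          - κ * ∑ j, (xt (cov (s i j)) ⬝ᵥ v) ^ 2 := by
      rw [logLik, logLik, ← Finset.sum_sub_distrib, Finset.mul_sum, ← Finset.sum_sub_distrib]
      refine Finset.sum_le_sum fun j _ => ?_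
      have := hsoft _ _ (hb j) (hd j)
      rw [dotProduct_add, hlin]
      linarith
    have h2 : ∑ j, (T (s i j) - logistic (lin (s i j) (psi0 P α₀))) * (xt (cov (s i j)) ⬝ᵥ v)
        = √(N i) * ∑ l, v l * ((√(N i))⁻¹ * ∑ j, U (s i j) (psi0 P α₀) (Sum.inr l)) := by
      simp only [U_inr, dotProduct, Finset.mul_sum]
      rw [Finset.sum_comm]
      refine Finset.sum_congr rfl fun l _ => Finset.sum_congr rfl fun j _ => ?_
      field_simp
    have h3 : ∑ j, (xt (cov (s i j)) ⬝ᵥ v) ^ 2 = N i * ∑ l, ∑ m,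
        (avg fun j => xt (cov (s i j)) l * xt (cov (s i j)) m) * (v l * v m) := by
      simp only [avg, dotProduct, sq, Finset.mul_sum, Finset.sum_mul]
      rw [Finset.sum_comm]
      refine Finset.sum_congr rfl fun l _ => ?_
      rw [Finset.sum_comm]
      refine Finset.sum_congr rfl fun m _ => Finset.sum_congr rfl fun j _ => ?_
      field_simp
    have h4 : ∑ l, v l * ((√(N i))⁻¹ * ∑ j, U (s i j) (psi0 P α₀) (Sum.inr l)) ≤ ‖v‖ * Z := by
      rw [hZ, Finset.mul_sum]
      refine Finset.sum_le_sum fun l _ => (le_abs_self _).trans ?_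
      rw [abs_mul]
      exact mul_le_mul (norm_le_pi_norm v l) (hS l) (abs_nonneg _) (norm_nonneg _)
    have h5 := hquad (Matrix.of fun l m => avg fun j => xt (cov (s i j)) l * xt (cov (s i j)) m)
      hM v
    simp only [Matrix.of_apply] at h5
    rw [h2, h3] at h1
    have h6 := mul_le_mul_of_nonneg_left h4 hsq.le
    have h7 := mul_le_mul_of_nonneg_left (mul_le_mul_of_nonneg_left h5 hN.le) hκ.le
    have h8 : √(N i) * (‖v‖ * Z) = K * Z := by rw [hv]; field_simp
    have h9 : κ * (N i * (c * ‖v‖ ^ 2)) = K * (κ * c * K) := by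
      rw [hv, div_pow, Real.sq_sqrt hN.le]; field_simp
    have h10 := mul_lt_mul_of_pos_left hZK hK0
    linarith
  obtain ⟨hex, hle⟩ := exists_isMLE_of_sphere (by positivity) hsph
  refine ⟨hex, fun α hα => ?_⟩
  have := hle α hα
  rwa [le_div_iff₀ hsq, mul_comm] at this

end Regime

variable {p : ℕ} {ι : Type*}

/-! ### Consistency -/

/-- Writes a Hájek mean as a ratio of sample averages, to which laws of large numbers apply. `psi0 P
α` merely carries `α` here, since `lin` ignores the other coordinates. -/
lemma sum_a₁_mul {n : ℕ} (s : Fin n → Rec p) (P : Measure (Rec p)) (α : Fin (p + 1) → ℝ)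
    (g : ℝ → ℝ) : ∑ j ∈ S₁ s, a₁ s α j * g (Y₁ (s j)) =
      (avg fun j => T (s j) * g (Y₁ (s j)) * (1 + Real.exp (-lin (s j) (psi0 P α))))
        / avg fun j => T (s j) * (1 + Real.exp (-lin (s j) (psi0 P α))) := by
  have hps : ∀ j, (ps (cov (s j)) α)⁻¹ = 1 + Real.exp (-lin (s j) (psi0 P α)) :=
    fun j => inv_ps _ _
  simp only [a₁, hps, avg]
  rw [sum_S₁ s (fun l => 1 + Real.exp (-lin (s l) (psi0 P α)))]
  rcases Nat.eq_zero_or_pos n with rfl | hn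
  · simp
  rw [mul_div_mul_left _ _ (by positivity), sum_S₁, Finset.sum_div]
  exact Finset.sum_congr rfl fun j _ => by ring

lemma sum_a₀_mul {n : ℕ} (s : Fin n → Rec p) (P : Measure (Rec p)) (α : Fin (p + 1) → ℝ)
    (g : ℝ → ℝ) : ∑ j ∈ S₀ s, a₀ s α j * g (Y₀ (s j)) =
      (avg fun j => (1 - T (s j)) * g (Y₀ (s j)) * (1 + Real.exp (lin (s j) (psi0 P α))))
        / avg fun j => (1 - T (s j)) * (1 + Real.exp (lin (s j) (psi0 P α))) := by
  have hps : ∀ j, (1 - ps (cov (s j)) α)⁻¹ = 1 + Real.exp (lin (s j) (psi0 P α)) :=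
    fun j => inv_one_sub_ps _ _
  simp only [a₀, hps, avg]
  rw [sum_S₀ s (fun l => 1 + Real.exp (lin (s l) (psi0 P α)))]
  rcases Nat.eq_zero_or_pos n with rfl | hn
  · simp
  rw [mul_div_mul_left _ _ (by positivity), sum_S₀, Finset.sum_div]
  exact Finset.sum_congr rfl fun j _ => by ring

namespace Regime

variable {P : Measure (Rec p)} {α₀ : Fin (p + 1) → ℝ} {R : ℝ}
  {F : Filter ι} {N : ι → ℕ} {s : ∀ i, Fin (N i) → Rec p} {z : Idx p → ℝ}
  {αs : ι → Fin (p + 1) → ℝ} {K : ℝ}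

/-- The covariates are unbounded, but `env` is uniformly `o(√N)` and `αs − α₀` is of order `1/√N`,
so the predictors move by a uniformly vanishing amount. -/
lemma near_mkPsi (h : Regime P α₀ R F N s z) (hα : ∀ᶠ i in F, √(N i) * ‖αs i - α₀‖ ≤ K)
    {m t : ι → ℝ} (hm : Tendsto m F (𝓝 (mu₁ P))) (ht : Tendsto t F (𝓝 (ate P))) :
    ∀ ε > 0, ∀ᶠ i in F, ∀ j, Near (psi0 P α₀) (mkPsi (m i) (t i) (αs i)) ε (s i j) := by
  intro ε hε
  have hK : 0 < |K| + 1 := by positivity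
  filter_upwards [hα, hm.eventually (Metric.closedBall_mem_nhds _ hε),
    ht.eventually (Metric.closedBall_mem_nhds _ hε), h.env (ε / (|K| + 1)) (by positivity)]
    with i hα hm ht he j
  refine ⟨?_, fun l => ?_⟩
  · have e : lin (s i j) (mkPsi (m i) (t i) (αs i)) - lin (s i j) (psi0 P α₀)
        = ∑ l, xt (cov (s i j)) l * (αs i - α₀) l := by
      simp only [lin, dotProduct, ← Finset.sum_sub_distrib]
      exact Finset.sum_congr rfl fun l _ => by simp [mkPsi, psi0]; ring
    rw [e]
    calc |∑ l, xt (cov (s i j)) l * (αs i - α₀) l|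
        ≤ ∑ l, |xt (cov (s i j)) l * (αs i - α₀) l| := Finset.abs_sum_le_sum_abs _ _
      _ ≤ ∑ l, |xt (cov (s i j)) l| * ‖αs i - α₀‖ := Finset.sum_le_sum fun l _ => by
          rw [abs_mul]
          exact mul_le_mul_of_nonneg_left (norm_le_pi_norm (αs i - α₀) l) (abs_nonneg _)
      _ = (∑ l, |xt (cov (s i j)) l|) * ‖αs i - α₀‖ := by rw [Finset.sum_mul]
      _ ≤ ε / (|K| + 1) * √(N i) * ‖αs i - α₀‖ := mul_le_mul_of_nonneg_right
          ((sum_abs_xt_le_env _).trans (he j)) (norm_nonneg _)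
      _ = ε / (|K| + 1) * (√(N i) * ‖αs i - α₀‖) := by ring
      _ ≤ ε / (|K| + 1) * (|K| + 1) := mul_le_mul_of_nonneg_left
          (hα.trans ((le_abs_self K).trans (by linarith))) (by positivity)
      _ = ε := by field_simp
  · fin_cases l
    · simpa [mkPsi, psi0, Real.dist_eq] using hm
    · simpa [mkPsi, psi0, Real.dist_eq] using ht

lemma tendsto_denom₁ (h : Regime P α₀ R F N s z) (hP : Model P α₀ R)
    (hα : ∀ᶠ i in F, √(N i) * ‖αs i - α₀‖ ≤ K) :
    Tendsto (fun i => avg fun j => T (s i j) * (1 + Real.exp (-lin (s i j) (psi0 P (αs i)))))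
      F (𝓝 1) := by
  have hl := measurable_lin (psi0 P α₀)
  have hT := measurable_T (p := p)
  have hlim := h.tendsto_avg hP (k := fun u Ψ => T u * (1 + Real.exp (-lin u Ψ)))
    (EnvLip.T.mul EnvLip.invPs₁) (by norm_num) (by fun_prop)
    (h.near_mkPsi hα tendsto_const_nhds tendsto_const_nhds)
  have := hP.isProb
  have e := hP.ipw₁ (fun _ => 1) measurable_const (integrable_const _)
  simp only [mul_one, integral_const, probReal_univ, one_smul] at e
  rwa [e] at hlim

lemma tendsto_denom₀ (h : Regime P α₀ R F N s z) (hP : Model P α₀ R)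
    (hα : ∀ᶠ i in F, √(N i) * ‖αs i - α₀‖ ≤ K) :
    Tendsto (fun i => avg fun j => (1 - T (s i j)) * (1 + Real.exp (lin (s i j) (psi0 P (αs i)))))
      F (𝓝 1) := by
  have hl := measurable_lin (psi0 P α₀)
  have hT := measurable_T (p := p)
  have hlim := h.tendsto_avg hP (k := fun u Ψ => (1 - T u) * (1 + Real.exp (lin u Ψ)))
    ((EnvLip.one.sub EnvLip.T).mul EnvLip.invPs₀) (by norm_num) (by fun_prop)
    (h.near_mkPsi hα tendsto_const_nhds tendsto_const_nhds)
  have := hP.isProb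
  have e := hP.ipw₀ (fun _ => 1) measurable_const (integrable_const _)
  simp only [mul_one, integral_const, probReal_univ, one_smul] at e
  rwa [e] at hlim

/-- An empty group would make its Hájek denominator zero, whereas both averaged denominators tend to
one. -/
lemma eventually_nonempty (h : Regime P α₀ R F N s z) (hP : Model P α₀ R)
    (hα : ∀ᶠ i in F, √(N i) * ‖αs i - α₀‖ ≤ K) :
    ∀ᶠ i in F, (S₁ (s i)).Nonempty ∧ (S₀ (s i)).Nonempty := by
  filter_upwards [(h.tendsto_denom₁ hP hα).eventually_const_lt one_half_lt_one,
    (h.tendsto_denom₀ hP hα).eventually_const_lt one_half_lt_one] with i h₁ h₀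
  rw [avg, ← sum_S₁ (s i) fun j => 1 + Real.exp (-lin (s i j) (psi0 P (αs i)))] at h₁
  rw [avg, ← sum_S₀ (s i) fun j => 1 + Real.exp (lin (s i j) (psi0 P (αs i)))] at h₀
  constructor <;> rw [Finset.nonempty_iff_ne_empty] <;> intro he
  · rw [he] at h₁; norm_num at h₁
  · rw [he] at h₀; norm_num at h₀

lemma tendsto_sum_a₁ (h : Regime P α₀ R F N s z) (hP : Model P α₀ R)
    (hα : ∀ᶠ i in F, √(N i) * ‖αs i - α₀‖ ≤ K) {g : ℝ → ℝ} (hg : Measurable g) {d : ℕ}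
    (hd : d ≤ 2) (hb : ∀ u : Rec p, |g (Y₁ u)| ≤ PELCausal.env u ^ d) :
    Tendsto (fun i => ∑ j ∈ S₁ (s i), a₁ (s i) (αs i) j * g (Y₁ (s i j))) F
      (𝓝 (∫ u, g (Y₁ u) ∂P)) := by
  have hl := measurable_lin (psi0 P α₀)
  have hT := measurable_T (p := p)
  have hY := hg.comp (measurable_Y₁ (p := p))
  have := h.tendsto_avg hP (k := fun u Ψ => T u * g (Y₁ u) * (1 + Real.exp (-lin u Ψ)))
    ((EnvLip.T.mul (EnvLip.of_data hb)).mul EnvLip.invPs₁) (by simpa using hd)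
    ((hT.mul hY).mul (by fun_prop)) (h.near_mkPsi hα tendsto_const_nhds tendsto_const_nhds)
  have h2 := this.div (h.tendsto_denom₁ hP hα) one_ne_zero
  rw [hP.ipw₁ g hg (hP.integrable_of_abs_le hY hb hd), div_one] at h2
  exact h2.congr fun i => (sum_a₁_mul (s i) P (αs i) g).symm

lemma tendsto_sum_a₀ (h : Regime P α₀ R F N s z) (hP : Model P α₀ R)
    (hα : ∀ᶠ i in F, √(N i) * ‖αs i - α₀‖ ≤ K) {g : ℝ → ℝ} (hg : Measurable g) {d : ℕ}
    (hd : d ≤ 2) (hb : ∀ u : Rec p, |g (Y₀ u)| ≤ PELCausal.env u ^ d) :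
    Tendsto (fun i => ∑ j ∈ S₀ (s i), a₀ (s i) (αs i) j * g (Y₀ (s i j))) F
      (𝓝 (∫ u, g (Y₀ u) ∂P)) := by
  have hl := measurable_lin (psi0 P α₀)
  have hT := measurable_T (p := p)
  have hY := hg.comp (measurable_Y₀ (p := p))
  have := h.tendsto_avg hP (k := fun u Ψ => (1 - T u) * g (Y₀ u) * (1 + Real.exp (lin u Ψ)))
    (((EnvLip.one.sub EnvLip.T).mul (EnvLip.of_data hb)).mul EnvLip.invPs₀) (by simpa using hd)
    (((hT.const_sub 1).mul hY).mul (by fun_prop))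
    (h.near_mkPsi hα tendsto_const_nhds tendsto_const_nhds)
  have h2 := this.div (h.tendsto_denom₀ hP hα) one_ne_zero
  rw [hP.ipw₀ g hg (hP.integrable_of_abs_le hY hb hd), div_one] at h2
  exact h2.congr fun i => (sum_a₀_mul (s i) P (αs i) g).symm

lemma tendsto_muHat₁ (h : Regime P α₀ R F N s z) (hP : Model P α₀ R)
    (hα : ∀ᶠ i in F, √(N i) * ‖αs i - α₀‖ ≤ K) :
    Tendsto (fun i => muHat₁ (s i) (αs i)) F (𝓝 (mu₁ P)) :=
  h.tendsto_sum_a₁ hP hα measurable_id (d := 1) one_le_two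
    fun u => by simpa using abs_Y₁_le_env u

lemma tendsto_muHat₀ (h : Regime P α₀ R F N s z) (hP : Model P α₀ R)
    (hα : ∀ᶠ i in F, √(N i) * ‖αs i - α₀‖ ≤ K) :
    Tendsto (fun i => muHat₀ (s i) (αs i)) F (𝓝 (mu₀ P)) :=
  h.tendsto_sum_a₀ hP hα measurable_id (d := 1) one_le_two
    fun u => by simpa using abs_Y₀_le_env u

lemma tendsto_varSum (h : Regime P α₀ R F N s z) (hP : Model P α₀ R)
    (hα : ∀ᶠ i in F, √(N i) * ‖αs i - α₀‖ ≤ K) :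
    Tendsto (fun i => varSum (s i) (αs i)) F
      (𝓝 (∫ u, (Y₁ u ^ 2 + Y₀ u ^ 2) ∂P - mu₁ P ^ 2 - mu₀ P ^ 2)) := by
  have hb₁ : ∀ u : Rec p, |Y₁ u ^ 2| ≤ PELCausal.env u ^ 2 := fun u => by
    rw [abs_pow]; exact pow_le_pow_left₀ (abs_nonneg _) (abs_Y₁_le_env u) 2
  have hb₀ : ∀ u : Rec p, |Y₀ u ^ 2| ≤ PELCausal.env u ^ 2 := fun u => by
    rw [abs_pow]; exact pow_le_pow_left₀ (abs_nonneg _) (abs_Y₀_le_env u) 2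
  rw [integral_add (hP.integrable_of_abs_le (measurable_Y₁.pow_const 2) hb₁ le_rfl)
    (hP.integrable_of_abs_le (measurable_Y₀.pow_const 2) hb₀ le_rfl)]
  exact (((h.tendsto_sum_a₁ hP hα (measurable_id.pow_const 2) le_rfl hb₁).add
    (h.tendsto_sum_a₀ hP hα (measurable_id.pow_const 2) le_rfl hb₀)).sub
    ((h.tendsto_muHat₁ hP hα).pow 2)).sub ((h.tendsto_muHat₀ hP hα).pow 2)

lemma near_psiHat (h : Regime P α₀ R F N s z) (hP : Model P α₀ R)
    (hα : ∀ᶠ i in F, √(N i) * ‖αs i - α₀‖ ≤ K) :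
    ∀ ε > 0, ∀ᶠ i in F, ∀ j, Near (psi0 P α₀)
      (mkPsi (muHat₁ (s i) (αs i)) (thetaHat (s i) (αs i)) (αs i)) ε (s i j) :=
  h.near_mkPsi hα (h.tendsto_muHat₁ hP hα)
    ((h.tendsto_muHat₁ hP hα).sub (h.tendsto_muHat₀ hP hα))

end Regime

/-! ### The sandwich estimator -/

/-- The inverse is the adjugate divided by the determinant, both continuous in the entries. -/
lemma tendsto_matrix_inv {F : Filter ι} {κ : Type*} [Fintype κ] [DecidableEq κ]
    {M : ι → Matrix κ κ ℝ} {D : Matrix κ κ ℝ} (hM : Tendsto M F (𝓝 D)) (hD : IsUnit D.det) :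
    Tendsto (fun i => (M i)⁻¹) F (𝓝 D⁻¹) := by
  simp only [Matrix.inv_def, Ring.inverse_eq_inv']
  have hdet : Tendsto (fun i => (M i).det) F (𝓝 D.det) :=
    (Continuous.matrix_det continuous_id).continuousAt.tendsto.comp hM
  have hadj : Tendsto (fun i => (M i).adjugate) F (𝓝 D.adjugate) :=
    (Continuous.matrix_adjugate continuous_id).continuousAt.tendsto.comp hM
  exact (hdet.inv₀ hD.ne_zero).smul hadj

namespace Regime

variable {P : Measure (Rec p)} {α₀ : Fin (p + 1) → ℝ} {R : ℝ}
  {F : Filter ι} {N : ι → ℕ} {s : ∀ i, Fin (N i) → Rec p} {z : Idx p → ℝ}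
  {αs : ι → Fin (p + 1) → ℝ} {K : ℝ}

/-- The evaluation point may vary with the row and with the unit. This freedom is needed because the
mean value theorem is applied to each scalar component separately. -/
lemma tendsto_avg_jacMat (h : Regime P α₀ R F N s z) (hP : Model P α₀ R)
    {Ψ : Idx p → ∀ i, Fin (N i) → Idx p → ℝ}
    (hΨ : ∀ l, ∀ ε > 0, ∀ᶠ i in F, ∀ j, Near (psi0 P α₀) (Ψ l i j) ε (s i j)) :
    Tendsto (fun i => (Matrix.of fun l m => avg fun j => jacMat (s i j) (Ψ l i j) l m)) F
      (𝓝 (popH P α₀)) := by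
  refine tendsto_pi_nhds.2 fun l => tendsto_pi_nhds.2 fun m => ?_
  have := h.tendsto_avg hP (EnvLip.jacMat l m) le_rfl (measurable_jacMat _ l m) (hΨ l)
  simpa only [popH, Matrix.of_apply, jac_eq] using this

lemma tendsto_H (h : Regime P α₀ R F N s z) (hP : Model P α₀ R)
    (hα : ∀ᶠ i in F, √(N i) * ‖αs i - α₀‖ ≤ K) :
    Tendsto (fun i => H (s i) (mkPsi (muHat₁ (s i) (αs i)) (thetaHat (s i) (αs i)) (αs i))) F
      (𝓝 (popH P α₀)) := by
  have := h.tendsto_avg_jacMat hP (Ψ := fun _ i _ =>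
    mkPsi (muHat₁ (s i) (αs i)) (thetaHat (s i) (αs i)) (αs i)) fun _ => h.near_psiHat hP hα
  refine this.congr fun i => ?_
  ext l m
  simp [H, avg, jac_eq, Matrix.sum_apply]

lemma tendsto_meat (h : Regime P α₀ R F N s z) (hP : Model P α₀ R)
    (hα : ∀ᶠ i in F, √(N i) * ‖αs i - α₀‖ ≤ K) :
    Tendsto (fun i => (N i : ℝ) •
      meat (s i) (mkPsi (muHat₁ (s i) (αs i)) (thetaHat (s i) (αs i)) (αs i))) F
      (𝓝 (popMeat P α₀)) := by
  refine tendsto_pi_nhds.2 fun l => tendsto_pi_nhds.2 fun m => ?_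
  have := h.tendsto_avg hP ((EnvLip.U l).mul (EnvLip.U m)) le_rfl
    ((measurable_U _ l).mul (measurable_U _ m)) (h.near_psiHat hP hα)
  refine this.congr' ?_
  filter_upwards [h.eventually_pos] with i hi
  simp only [avg, meat, Matrix.smul_apply, Matrix.sum_apply, Matrix.vecMulVec_apply, smul_eq_mul]
  rw [← mul_assoc]
  congr 1
  field_simp

lemma tendsto_cHat (h : Regime P α₀ R F N s z) (hP : Model P α₀ R)
    (hα : ∀ᶠ i in F, √(N i) * ‖αs i - α₀‖ ≤ K) :
    Tendsto (fun i => cHat (s i) (αs i)) F (𝓝 (cPop P α₀)) := by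
  have hH := h.tendsto_H hP hα
  have hHinv := tendsto_matrix_inv hH hP.isUnit_det
  have hHT : Tendsto (fun i => (H (s i) (mkPsi (muHat₁ (s i) (αs i)) (thetaHat (s i) (αs i))
      (αs i))).transpose) F (𝓝 (popH P α₀).transpose) :=
    (Continuous.matrix_transpose continuous_id).continuousAt.tendsto.comp hH
  have hHTinv := tendsto_matrix_inv hHT (by rw [Matrix.det_transpose]; exact hP.isUnit_det)
  have hprod := (hHinv.mul (h.tendsto_meat hP hα)).mul hHTinv
  have hentry := tendsto_pi_nhds.1 (tendsto_pi_nhds.1 hprod (Sum.inl 1)) (Sum.inl 1)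
  have hs := ((h.tendsto_varSum hP hα).const_mul 2).inv₀ (mul_pos two_pos hP.var_pos).ne'
  refine (hs.mul hentry).congr fun i => ?_
  simp only [cHat, varHat, varSum, Matrix.mul_smul, Matrix.smul_mul, Matrix.smul_apply,
    smul_eq_mul]
  ring

end Regime

variable {p : ℕ} {ι : Type*}

/-! ### Expansion of the estimators and of the likelihood ratio -/

/-- The estimators solve the estimating equations. -/
lemma sum_U_psiHat_eq_zero {n : ℕ} {s : Fin n → Rec p} {α : Fin (p + 1) → ℝ}
    (h₁ : (S₁ s).Nonempty) (h₀ : (S₀ s).Nonempty) (hα : IsMLE s α) (l : Idx p) :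
    ∑ j, U (s j) (mkPsi (muHat₁ s α) (thetaHat s α) α) l = 0 := by
  rcases l with l | l
  · fin_cases l
    · have hD := (sum_inv_ps_pos (α := α) h₁).ne'
      -- Multiplying the weight by its denominator recovers `1 / τ̂`: this estimating equation is
      -- the definition of the Hájek mean, scaled.
      have e : ∀ j, U (s j) (mkPsi (muHat₁ s α) (thetaHat s α) α) (Sum.inl 0)
          = T (s j) * ((∑ l ∈ S₁ s, (ps (cov (s l)) α)⁻¹)
            * (a₁ s α j * Y₁ (s j) - muHat₁ s α * a₁ s α j)) := fun j => by
        have : (∑ l ∈ S₁ s, (ps (cov (s l)) α)⁻¹) * a₁ s α j = (ps (cov (s j)) α)⁻¹ := by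
          rw [a₁, mul_div_assoc', mul_div_cancel_left₀ _ hD]
        rw [show ∀ D a Y m : ℝ, D * (a * Y - m * a) = (D * a) * (Y - m) by intros; ring, this]
        simp only [U, mkPsi, Sum.elim_inl, Sum.elim_inr, Matrix.cons_val_zero]
        ring
      simp only [Fin.zero_eta, e]
      rw [← sum_S₁ s (fun j => (∑ l ∈ S₁ s, (ps (cov (s l)) α)⁻¹)
        * (a₁ s α j * Y₁ (s j) - muHat₁ s α * a₁ s α j)), ← Finset.mul_sum,
        Finset.sum_sub_distrib, ← Finset.mul_sum, sum_a₁ h₁, ← muHat₁]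
      ring
    · have hD := (sum_inv_one_sub_ps_pos (α := α) h₀).ne'
      have e : ∀ j, U (s j) (mkPsi (muHat₁ s α) (thetaHat s α) α) (Sum.inl 1)
          = (1 - T (s j)) * ((∑ l ∈ S₀ s, (1 - ps (cov (s l)) α)⁻¹)
            * (a₀ s α j * Y₀ (s j) - muHat₀ s α * a₀ s α j)) := fun j => by
        have : (∑ l ∈ S₀ s, (1 - ps (cov (s l)) α)⁻¹) * a₀ s α j
            = (1 - ps (cov (s j)) α)⁻¹ := by
          rw [a₀, mul_div_assoc', mul_div_cancel_left₀ _ hD]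
        rw [show ∀ D a Y m : ℝ, D * (a * Y - m * a) = (D * a) * (Y - m) by intros; ring, this]
        simp only [U, mkPsi, Sum.elim_inl, Sum.elim_inr, Matrix.cons_val_zero,
          Matrix.cons_val_one, thetaHat]
        ring
      simp only [Fin.mk_one, e]
      rw [← sum_S₀ s (fun j => (∑ l ∈ S₀ s, (1 - ps (cov (s l)) α)⁻¹)
        * (a₀ s α j * Y₀ (s j) - muHat₀ s α * a₀ s α j)), ← Finset.mul_sum,
        Finset.sum_sub_distrib, ← Finset.mul_sum, sum_a₀ h₀, ← muHat₀]
      ring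
  · exact hα.sum_score_eq_zero l

/-- Transfers the `o(√n)` bound of the envelope to the deviations, so that `β dev` is uniformly
small. -/
lemma abs_dev_le {n : ℕ} (s : Fin n → Rec p) (α : Fin (p + 1) → ℝ) (j : Fin n) :
    |dev s α j| ≤ (1 + |muHat₁ s α| + |muHat₀ s α|) * env (s j) := by
  have he := one_le_env (s j)
  have h1 := abs_nonneg (muHat₁ s α)
  have h0 := abs_nonneg (muHat₀ s α)
  unfold dev
  split_ifs
  · refine (abs_sub _ _).trans ?_
    nlinarith [abs_Y₁_le_env (s j)]
  · rw [abs_neg]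
    refine (abs_sub _ _).trans ?_
    nlinarith [abs_Y₀_le_env (s j)]

namespace Regime

variable {P : Measure (Rec p)} {α₀ : Fin (p + 1) → ℝ} {R : ℝ}
  {F : Filter ι} {N : ι → ℕ} {s : ∀ i, Fin (N i) → Rec p} {z : Idx p → ℝ}
  {αs : ι → Fin (p + 1) → ℝ} {K : ℝ}

/-- Asymptotic linearity of the estimators. -/
lemma tendsto_sqrt_smul_psiHat_sub (h : Regime P α₀ R F N s z) (hP : Model P α₀ R)
    (hα : ∀ᶠ i in F, √(N i) * ‖αs i - α₀‖ ≤ K) (hmle : ∀ᶠ i in F, IsMLE (s i) (αs i)) :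
    Tendsto (fun i => √(N i) •
      (mkPsi (muHat₁ (s i) (αs i)) (thetaHat (s i) (αs i)) (αs i) - psi0 P α₀)) F
      (𝓝 ((popH P α₀)⁻¹.mulVec (-z))) := by
  set Ψ : ι → Idx p → ℝ :=
    fun i => mkPsi (muHat₁ (s i) (αs i)) (thetaHat (s i) (αs i)) (αs i) with hΨ
  -- Each component and unit has its own intermediate point on the segment. `Near.segment` keeps all
  -- of them near `Ψ⁰`, so the averaged Jacobian `G` assembled from them still tends to `popH`.
  choose t ht hU using fun (l : Idx p) (i : ι) (j : Fin (N i)) =>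
    exists_U_sub_eq (s i j) (psi0 P α₀) (Ψ i) l
  have hG := h.tendsto_avg_jacMat hP
    (Ψ := fun l i j => psi0 P α₀ + t l i j • (Ψ i - psi0 P α₀)) fun l ε hε => by
      filter_upwards [h.near_psiHat hP hα ε hε] with i hi j using (hi j).segment (ht l i j)
  set G : ι → Matrix (Idx p) (Idx p) ℝ := fun i => Matrix.of fun l m => avg fun j =>
    jacMat (s i j) (psi0 P α₀ + t l i j • (Ψ i - psi0 P α₀)) l m with hGdef
  have hdet : ∀ᶠ i in F, (G i).det ≠ 0 :=
    ((Continuous.matrix_det continuous_id).continuousAt.tendsto.comp hG).eventually_ne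
      hP.isUnit_det.ne_zero
  have hinv := tendsto_matrix_inv hG hP.isUnit_det
  have hz : Tendsto (fun i l => -((√(N i))⁻¹ * ∑ j, U (s i j) (psi0 P α₀) l)) F (𝓝 (-z)) :=
    tendsto_pi_nhds.2 fun l => (h.score l).neg
  have hlim : Tendsto (fun i => (G i)⁻¹.mulVec
      fun l => -((√(N i))⁻¹ * ∑ j, U (s i j) (psi0 P α₀) l)) F
      (𝓝 ((popH P α₀)⁻¹.mulVec (-z))) := by
    refine tendsto_pi_nhds.2 fun l => ?_
    simp only [Matrix.mulVec, dotProduct]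
    refine tendsto_finsetSum _ fun m _ => ?_
    exact (tendsto_pi_nhds.1 (tendsto_pi_nhds.1 hinv l) m).mul (tendsto_pi_nhds.1 hz m)
  refine hlim.congr' ?_
  filter_upwards [hdet, hmle, h.eventually_nonempty hP hα, h.eventually_pos] with i hd hm hne hN
  have hsq : 0 < √(N i : ℝ) := Real.sqrt_pos.2 hN
  -- The estimating functions sum to zero at `Ψ̂`, so their increments from `Ψ⁰` sum to minus the
  -- score at `Ψ⁰`.
  have key : (G i).mulVec (√(N i) • (Ψ i - psi0 P α₀))
      = fun l => -((√(N i))⁻¹ * ∑ j, U (s i j) (psi0 P α₀) l) := by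
    ext l
    have h1 : ∑ j, (U (s i j) (Ψ i) l - U (s i j) (psi0 P α₀) l)
        = -∑ j, U (s i j) (psi0 P α₀) l := by
      rw [Finset.sum_sub_distrib, sum_U_psiHat_eq_zero hne.1 hne.2 hm, zero_sub]
    have h2 : (G i).mulVec (√(N i) • (Ψ i - psi0 P α₀)) l
        = (N i : ℝ)⁻¹ * √(N i) * ∑ j, (U (s i j) (Ψ i) l - U (s i j) (psi0 P α₀) l) := by
      simp only [hU, hGdef, Matrix.mulVec, dotProduct, Matrix.of_apply, avg, Pi.smul_apply,
        smul_eq_mul, Finset.mul_sum, Finset.sum_mul]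
      rw [Finset.sum_comm]
      exact Finset.sum_congr rfl fun j _ => Finset.sum_congr rfl fun m _ => by ring
    rw [h2, h1]
    have h3 : (N i : ℝ)⁻¹ * √(N i) = (√(N i))⁻¹ := by
      rw [inv_mul_eq_div, Real.sqrt_div_self', one_div]
    rw [h3, mul_neg]
  rw [← key, Matrix.mulVec_mulVec, Matrix.nonsing_inv_mul _ (isUnit_iff_ne_zero.2 hd),
    Matrix.one_mulVec]

/-- The deterministic core: attainment of the maxima, consistency of `ĉ`, and the limit of
the pseudo-empirical likelihood ratio in terms of the limit `z` of the estimating function. -/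
theorem tendsto_pelRatio (h : Regime P α₀ R F N s z) (hP : Model P α₀ R)
    (hV : 0 < asympVar P α₀)
    (hα : ∀ᶠ i in F, (∃ α, IsMLE (s i) α) → IsMLE (s i) (αs i))
    {qG qR : ∀ i, Fin (N i) → ℝ}
    (hG : ∀ᶠ i in F, (∃ q, IsMaximizer (pel (s i) (αs i)) (normSet (s i)) q) →
      IsMaximizer (pel (s i) (αs i)) (normSet (s i)) (qG i))
    (hR : ∀ᶠ i in F, (∃ q, IsMaximizer (pel (s i) (αs i)) (ateSet (s i) (ate P)) q) →
      IsMaximizer (pel (s i) (αs i)) (ateSet (s i) (ate P)) (qR i)) :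
    (∀ᶠ i in F, (∃ α, IsMLE (s i) α) ∧
      (∃ q, IsMaximizer (pel (s i) (αs i)) (normSet (s i)) q) ∧
      (∃ q, IsMaximizer (pel (s i) (αs i)) (ateSet (s i) (ate P)) q)) ∧
    Tendsto (fun i => cHat (s i) (αs i)) F (𝓝 (cPop P α₀)) ∧
    Tendsto (fun i => -2 * (pel (s i) (αs i) (qR i) - pel (s i) (αs i) (qG i))
      / cHat (s i) (αs i)) F
      (𝓝 (((popH P α₀)⁻¹.mulVec z (Sum.inl 1)) ^ 2 / asympVar P α₀)) := by
  obtain ⟨K, hK⟩ := h.exists_mle hP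
  have hmle : ∀ᶠ i in F, IsMLE (s i) (αs i) := by
    filter_upwards [hK, hα] with i hi hα using hα hi.1
  have hroot : ∀ᶠ i in F, √(N i) * ‖αs i - α₀‖ ≤ K := by
    filter_upwards [hK, hmle] with i hi hm using hi.2 _ hm
  have hne := h.eventually_nonempty hP hroot
  set w := (popH P α₀)⁻¹.mulVec z (Sum.inl 1) with hw
  set σ2 := ∫ u, (Y₁ u ^ 2 + Y₀ u ^ 2) ∂P - mu₁ P ^ 2 - mu₀ P ^ 2 with hσ
  have hσ0 : 0 < σ2 := hP.var_pos
  have hvar : Tendsto (fun i => varSum (s i) (αs i)) F (𝓝 σ2) := h.tendsto_varSum hP hroot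
  have hD : Tendsto (fun i => √(N i) * (thetaHat (s i) (αs i) - ate P)) F (𝓝 (-w)) := by
    have := tendsto_pi_nhds.1 (h.tendsto_sqrt_smul_psiHat_sub hP hroot hmle) (Sum.inl 1)
    rw [Matrix.mulVec_neg] at this
    simpa [mkPsi, psi0] using this
  -- The tilt that meets the constraint exactly. It is of order `1/√N`, since `√N (θ̂ − θ⁰)`
  -- converges and `varSum` has a positive limit.
  set β : ι → ℝ := fun i => (thetaHat (s i) (αs i) - ate P) / varSum (s i) (αs i) with hβ
  have hvar0 : ∀ᶠ i in F, 0 < varSum (s i) (αs i) := hvar.eventually_const_lt hσ0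
  have hβv : ∀ᶠ i in F, β i * varSum (s i) (αs i) = thetaHat (s i) (αs i) - ate P := by
    filter_upwards [hvar0] with i hi using div_mul_cancel₀ _ hi.ne'
  have hQ : Tendsto (fun i => (N i : ℝ) * (β i ^ 2 * varSum (s i) (αs i))) F
      (𝓝 (w ^ 2 / σ2)) := by
    have := (hD.pow 2).div hvar hσ0.ne'
    rw [neg_sq] at this
    refine this.congr' ?_
    filter_upwards [hvar0] with i hi
    simp only [Pi.div_apply, hβ]
    rw [mul_pow, Real.sq_sqrt (Nat.cast_nonneg _)]
    field_simp
  -- `√N |β|` times the constant from `abs_dev_le` is eventually below `C`, and the envelope is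
  -- eventually at most `(ε / C) √N`.
  have hdev : ∀ ε > 0, ∀ᶠ i in F, ∀ j, |β i * dev (s i) (αs i) j| ≤ ε := by
    intro ε hε
    have hb : Tendsto (fun i => |√(N i) * (thetaHat (s i) (αs i) - ate P) / varSum (s i) (αs i)|
        * (1 + |muHat₁ (s i) (αs i)| + |muHat₀ (s i) (αs i)|)) F
        (𝓝 (|-w / σ2| * (1 + |mu₁ P| + |mu₀ P|))) :=
      (hD.div hvar hσ0.ne').abs.mul ((tendsto_const_nhds.add (h.tendsto_muHat₁ hP hroot).abs).add
        (h.tendsto_muHat₀ hP hroot).abs)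
    set C := |-w / σ2| * (1 + |mu₁ P| + |mu₀ P|) + 1 with hC
    have hC0 : 0 < C := by positivity
    filter_upwards [hb.eventually_lt_const (lt_add_one _),
      h.env (ε / C) (by positivity)] with i hi he j
    have e : √(N i) * (thetaHat (s i) (αs i) - ate P) / varSum (s i) (αs i) = √(N i) * β i :=
      mul_div_assoc _ _ _
    rw [e, abs_mul, abs_of_nonneg (Real.sqrt_nonneg _)] at hi
    rw [abs_mul]
    calc |β i| * |dev (s i) (αs i) j|
        ≤ |β i| * ((1 + |muHat₁ (s i) (αs i)| + |muHat₀ (s i) (αs i)|)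
          * (ε / C * √(N i))) := by
          refine mul_le_mul_of_nonneg_left ((abs_dev_le _ _ _).trans ?_) (abs_nonneg _)
          exact mul_le_mul_of_nonneg_left (he j) (by positivity)
      _ = √(N i) * |β i| * (1 + |muHat₁ (s i) (αs i)| + |muHat₀ (s i) (αs i)|) * (ε / C) := by
          ring
      _ ≤ C * (ε / C) := mul_le_mul_of_nonneg_right hi.le (by positivity)
      _ = ε := by field_simp
  have hex : ∀ᶠ i in F, (∃ q, IsMaximizer (pel (s i) (αs i)) (normSet (s i)) q) ∧
      (∃ q, IsMaximizer (pel (s i) (αs i)) (ateSet (s i) (ate P)) q) := by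
    filter_upwards [hne, hβv, hdev (1 / 2) (by norm_num)] with i hne hβ hd
    exact ⟨exists_isMaximizer_normSet hne.1 hne.2, exists_isMaximizer_ateSet hne.1 hne.2 hβ hd⟩
  have hc := h.tendsto_cHat hP hroot
  refine ⟨?_, hc, ?_⟩
  · filter_upwards [hK, hex] with i hi he using ⟨hi.1, he⟩
  have hratio : Tendsto (fun i => -2 * (pel (s i) (αs i) (qR i) - pel (s i) (αs i) (qG i))
      - (N i : ℝ) * (β i ^ 2 * varSum (s i) (αs i)) / 2) F (𝓝 0) := by
    rw [Metric.tendsto_nhds]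
    intro δ hδ
    set C := w ^ 2 / σ2 + 1 with hC
    have hC0 : 0 < C := by positivity
    -- The bound 1/2 is required by the logarithm expansion. The other one turns the error `2 ε C`
    -- into at most `δ / 2`.
    set ε := min (1 / 2) (δ / (4 * C)) with hε
    have hε0 : 0 < ε := lt_min (by norm_num) (by positivity)
    filter_upwards [hne, hβv, hdev ε hε0, hex, hG, hR,
      hQ.eventually_lt_const (lt_add_one _)] with i hne hβ hd hex hG hR hQ
    have hle := abs_pelRatio_sub_le hne.1 hne.2 hβ hd (min_le_left _ _) (hG hex.1) (hR hex.2)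
    rw [Real.dist_eq, sub_zero]
    refine hle.trans_lt ?_
    calc 2 * ε * (N i * (β i ^ 2 * varSum (s i) (αs i))) ≤ 2 * ε * C :=
          mul_le_mul_of_nonneg_left hQ.le (by positivity)
      _ ≤ 2 * (δ / (4 * C)) * C := by
          have := min_le_right (1 / 2) (δ / (4 * C))
          gcongr
      _ = δ / 2 := by field_simp; norm_num
      _ < δ := half_lt_self hδ
  have hc0 : cPop P α₀ ≠ 0 :=
    (mul_pos (inv_pos.2 (mul_pos two_pos hP.var_pos)) hV).ne'
  have hfin := (hratio.add (hQ.div_const 2)).div hc hc0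
  -- Here `cPop = V / (2σ²)`, so the outcome variances cancel and only the variance `V` of the limit
  -- remains: this is what the scaling by `ĉ` achieves.
  have e : (0 + w ^ 2 / σ2 / 2) / cPop P α₀ = w ^ 2 / asympVar P α₀ := by
    rw [cPop, ← hσ]
    field_simp
    ring
  rw [e] at hfin
  refine hfin.congr fun i => ?_
  simp only [Pi.div_apply]
  ring

end Regime

/-! ### Events of probability tending to one -/

section ProbFilter

variable {Ω : Type*} [MeasurableSpace Ω]

/-- The filter of those sequences of events whose probability tends to one. Convergence along
this filter is convergence in probability. -/
def probFilter (μ : Measure Ω) : Filter (ℕ × Ω) where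
  sets := {A | Tendsto (fun n => μ {ω | (n, ω) ∉ A}) atTop (𝓝 0)}
  univ_sets := by simp
  sets_of_superset {A B} hA hAB := by
    refine tendsto_of_tendsto_of_tendsto_of_le_of_le tendsto_const_nhds hA
      (fun n => zero_le) fun n => measure_mono fun ω hω h => hω (hAB h)
  inter_sets {A B} hA hB := by
    have h : Tendsto (fun n => μ {ω | (n, ω) ∉ A} + μ {ω | (n, ω) ∉ B}) atTop (𝓝 0) := by
      simpa using Tendsto.add hA hB
    refine tendsto_of_tendsto_of_tendsto_of_le_of_le tendsto_const_nhds h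
      (fun n => zero_le) fun n => ?_
    refine (measure_mono fun ω hω => ?_).trans (measure_union_le _ _)
    exact not_and_or.1 hω

variable {μ : Measure Ω}

lemma eventually_probFilter {q : ℕ × Ω → Prop} :
    (∀ᶠ x in probFilter μ, q x) ↔ Tendsto (fun n => μ {ω | ¬ q (n, ω)}) atTop (𝓝 0) := Iff.rfl

lemma tendsto_fst_probFilter : Tendsto Prod.fst (probFilter μ) atTop := by
  refine tendsto_atTop.2 fun m => eventually_probFilter.2 ?_
  refine tendsto_const_nhds.congr' ?_
  filter_upwards [eventually_ge_atTop m] with n hn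
  simp [hn]

lemma eventually_probFilter_of_forall_ae {q : ℕ × Ω → Prop} (h : ∀ n, ∀ᵐ ω ∂μ, q (n, ω)) :
    ∀ᶠ x in probFilter μ, q x := by
  refine eventually_probFilter.2 ?_
  have : ∀ n, μ {ω | ¬ q (n, ω)} = 0 := fun n => h n
  simp [this]

/-- The events that `q` fails at some `n ≥ m` decrease in `m` to the null set where it fails
infinitely often. Continuity from above concludes. -/
lemma eventually_probFilter_of_ae_eventually [IsFiniteMeasure μ] {q : ℕ × Ω → Prop}
    (hm : ∀ n, NullMeasurableSet {ω | q (n, ω)} μ) (h : ∀ᵐ ω ∂μ, ∀ᶠ n in atTop, q (n, ω)) :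
    ∀ᶠ x in probFilter μ, q x := by
  refine eventually_probFilter.2 ?_
  set B : ℕ → Set Ω := fun m => ⋃ n ≥ m, {ω | q (n, ω)}ᶜ with hB
  have hBm : ∀ m, NullMeasurableSet (B m) μ := fun m =>
    NullMeasurableSet.iUnion fun n => NullMeasurableSet.iUnion fun _ => (hm n).compl
  have hanti : Antitone B := fun m m' hmm' =>
    Set.iUnion_mono fun n => Set.iUnion_mono' fun hn => ⟨le_trans hmm' hn, le_rfl⟩
  have hlim := tendsto_measure_iInter_atTop hBm hanti ⟨0, measure_ne_top _ _⟩
  have h0 : μ (⋂ m, B m) = 0 := by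
    have hnull : μ {ω | ¬ ∀ᶠ n in atTop, q (n, ω)} = 0 := h
    refine measure_mono_null (fun ω hω => ?_) hnull
    intro hev
    obtain ⟨m, hm⟩ := eventually_atTop.1 hev
    have := Set.mem_iInter.1 hω m
    simp only [hB, Set.mem_iUnion] at this
    obtain ⟨n, hn, hq⟩ := this
    exact hq (hm n hn)
  rw [h0] at hlim
  exact tendsto_of_tendsto_of_tendsto_of_le_of_le tendsto_const_nhds hlim
    (fun n => zero_le) fun n => measure_mono fun ω hω =>
      Set.mem_iUnion.2 ⟨n, Set.mem_iUnion.2 ⟨le_rfl, hω⟩⟩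

lemma tendsto_probFilter_of_ae_tendsto [IsFiniteMeasure μ] {f : ℕ → Ω → ℝ} {c : ℝ}
    (hm : ∀ n, AEMeasurable (f n) μ) (h : ∀ᵐ ω ∂μ, Tendsto (fun n => f n ω) atTop (𝓝 c)) :
    Tendsto (fun x : ℕ × Ω => f x.1 x.2) (probFilter μ) (𝓝 c) := by
  rw [Metric.tendsto_nhds]
  intro ε hε
  refine eventually_probFilter_of_ae_eventually (q := fun x => dist (f x.1 x.2) c < ε)
    (fun n => ?_) ?_
  · exact nullMeasurableSet_lt ((hm n).dist aemeasurable_const) aemeasurable_const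
  · filter_upwards [h] with ω hω using Metric.tendsto_nhds.1 hω ε hε

lemma tendstoInMeasure_of_tendsto_probFilter {f : ℕ → Ω → ℝ} {c : ℝ}
    (h : Tendsto (fun x : ℕ × Ω => f x.1 x.2) (probFilter μ) (𝓝 c)) :
    TendstoInMeasure μ f atTop fun _ => c := by
  rw [tendstoInMeasure_iff_dist]
  intro ε hε
  have := eventually_probFilter.1 (Metric.tendsto_nhds.1 h ε hε)
  simpa only [not_lt] using this

/-- To prove that an event has probability tending to one, one may assume that a tight
sequence converges. -/
lemma eventually_probFilter_of_tight {E : Type*} [NormedAddCommGroup E] [ProperSpace E]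
    {Z : ℕ × Ω → E}
    (hZ : ∀ η > 0, ∃ M, ∀ᶠ n in atTop, μ {ω | M < ‖Z (n, ω)‖} ≤ η) {q : ℕ × Ω → Prop}
    (h : ∀ z, ∀ G ≤ probFilter μ, Tendsto Z G (𝓝 z) → ∀ᶠ x in G, q x) :
    ∀ᶠ x in probFilter μ, q x := by
  -- Otherwise some ultrafilter finer than `probFilter` lives on the failures with `‖Z‖ ≤ M`. Closed
  -- balls are compact, so `Z` converges along it and `h` is contradicted. Tightness then removes
  -- the restriction to `‖Z‖ ≤ M`.
  have hM : ∀ M : ℝ, ∀ᶠ x in probFilter μ, ‖Z x‖ ≤ M → q x := by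
    intro M
    by_contra hcon
    rw [not_eventually] at hcon
    simp only [Classical.not_imp] at hcon
    have := frequently_iff_neBot.1 hcon
    obtain ⟨G, hGle⟩ := Ultrafilter.exists_le (probFilter μ ⊓ 𝓟 {x | ‖Z x‖ ≤ M ∧ ¬ q x})
    have hGL : (G : Filter (ℕ × Ω)) ≤ probFilter μ := hGle.trans inf_le_left
    have hG : {x | ‖Z x‖ ≤ M ∧ ¬ q x} ∈ (G : Filter (ℕ × Ω)) :=
      le_principal_iff.1 (hGle.trans inf_le_right)
    have hball : Metric.closedBall (0 : E) M ∈ G.map Z := by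
      rw [Ultrafilter.mem_map]
      filter_upwards [hG] with x hx
      simpa using hx.1
    obtain ⟨z, -, hz⟩ := (isCompact_closedBall (0 : E) M).ultrafilter_le_nhds (G.map Z)
      (le_principal_iff.2 hball)
    have h1 := h z G hGL hz
    obtain ⟨x, hx, hx'⟩ := (h1.and hG).exists
    exact hx'.2 hx
  refine eventually_probFilter.2 ?_
  rw [ENNReal.tendsto_nhds_zero]
  intro η hη
  obtain ⟨M, hMZ⟩ := hZ (η / 2) (ENNReal.half_pos hη.ne')
  have h1 := ENNReal.tendsto_nhds_zero.1 (eventually_probFilter.1 (hM M)) (η / 2)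
    (ENNReal.half_pos hη.ne')
  filter_upwards [hMZ, h1] with n hn hn'
  calc μ {ω | ¬ q (n, ω)}
      ≤ μ ({ω | M < ‖Z (n, ω)‖} ∪ {ω | ¬ (‖Z (n, ω)‖ ≤ M → q (n, ω))}) := by
        refine measure_mono fun ω hω => ?_
        rcases lt_or_ge M ‖Z (n, ω)‖ with hlt | hge
        · exact Or.inl hlt
        · exact Or.inr fun hcon => hω (hcon hge)
    _ ≤ η / 2 + η / 2 := (measure_union_le _ _).trans (add_le_add hn hn')
    _ = η := ENNReal.add_halves η

end ProbFilter

/-! ### Random samples -/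

/-- Late terms satisfy `b j ≤ ε j ≤ ε n`. The finitely many early ones are bounded by a constant,
which `ε n` eventually exceeds. -/
lemma eventually_forall_lt_le_of_tendsto_div {b : ℕ → ℝ}
    (h : Tendsto (fun n : ℕ => b n / n) atTop (𝓝 0)) {ε : ℝ} (hε : 0 < ε) :
    ∀ᶠ n : ℕ in atTop, ∀ j < n, b j ≤ ε * n := by
  obtain ⟨m, hm⟩ := eventually_atTop.1 (h.eventually_lt_const hε)
  obtain ⟨C, hC⟩ := ((Finset.range (m + 1)).image b).bddAbove
  have hlim : Tendsto (fun n : ℕ => ε * (n : ℝ)) atTop atTop :=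
    tendsto_natCast_atTop_atTop.const_mul_atTop hε
  filter_upwards [hlim.eventually_ge_atTop C] with n hn j hj
  rcases Nat.lt_or_ge j (m + 1) with hjm | hjm
  · exact (hC (by simpa using ⟨j, by omega, rfl⟩)).trans hn
  · have hj0 : (0 : ℝ) < j := by exact_mod_cast (by omega : 0 < j)
    have := hm j (by omega)
    rw [div_lt_iff₀ hj0] at this
    have hjn : (j : ℝ) ≤ n := by exact_mod_cast hj.le
    nlinarith

/-- A term is the difference of consecutive partial sums, so `b n / n` is the difference of two
averages with the same limit, the later one multiplied by `(n + 1) / n`. -/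
lemma tendsto_div_of_tendsto_avg {b : ℕ → ℝ} {A : ℝ}
    (h : Tendsto (fun n : ℕ => (∑ i ∈ Finset.range n, b i) / n) atTop (𝓝 A)) :
    Tendsto (fun n : ℕ => b n / n) atTop (𝓝 0) := by
  have h1 := (tendsto_add_atTop_iff_nat 1).2 h
  have h2 : Tendsto (fun n : ℕ => 1 + 1 / (n : ℝ)) atTop (𝓝 (1 + 0)) :=
    tendsto_const_nhds.add tendsto_one_div_atTop_nhds_zero_nat
  have h3 := (h1.mul h2).sub h
  rw [add_zero, mul_one, sub_self] at h3
  refine h3.congr' ?_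
  filter_upwards [eventually_gt_atTop 0] with n hn
  have : (n : ℝ) ≠ 0 := by positivity
  rw [Finset.sum_range_succ]
  push_cast
  field_simp
  ring

section Sample

variable {p : ℕ} {P : Measure (Rec p)} {Ω : Type*} [MeasurableSpace Ω] {μ : Measure Ω}
  {W : ℕ → Ω → Rec p}

lemma identDistrib_comp (hLaw : ∀ j, HasLaw (W j) P μ) {g : Rec p → ℝ} (hg : Measurable g)
    (i : ℕ) : IdentDistrib (fun ω => g (W i ω)) (fun ω => g (W 0 ω)) μ μ :=
  (IdentDistrib.mk (hLaw i).aemeasurable (hLaw 0).aemeasurable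
    ((hLaw i).map_eq.trans (hLaw 0).map_eq.symm)).comp hg

lemma ae_tendsto_avg (hInd : iIndepFun W μ) (hLaw : ∀ j, HasLaw (W j) P μ) {g : Rec p → ℝ}
    (hg : Measurable g) (hint : Integrable g P) :
    ∀ᵐ ω ∂μ, Tendsto (fun n : ℕ => (∑ i ∈ Finset.range n, g (W i ω)) / n) atTop
      (𝓝 (∫ u, g u ∂P)) := by
  have h0 : Integrable (fun ω => g (W 0 ω)) μ := by
    have := hint
    rw [← (hLaw 0).map_eq] at this
    exact this.comp_aemeasurable (hLaw 0).aemeasurable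
  have h := strong_law_ae_real (fun i ω => g (W i ω)) h0
    (fun i j hij => (hInd.indepFun hij).comp hg hg) (identDistrib_comp hLaw hg)
  have e : ∫ ω, g (W 0 ω) ∂μ = ∫ u, g u ∂P :=
    (hLaw 0).integral_comp hg.aestronglyMeasurable
  rwa [e] at h

variable [IsProbabilityMeasure μ]

/-- Chebyshev's inequality for the normalized sum. The bound does not depend on `n`, which gives
tightness. -/
lemma measure_lt_abs_sum_le (hInd : iIndepFun W μ) (hLaw : ∀ j, HasLaw (W j) P μ)
    {g : Rec p → ℝ} (hg : Measurable g) (h2 : MemLp g 2 P) (h0 : ∫ u, g u ∂P = 0) (n : ℕ)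
    {M : ℝ} (hM : 0 < M) :
    μ {ω | M < |(√n)⁻¹ * ∑ j : Fin n, g (sample W n ω j)|}
      ≤ ENNReal.ofReal ((∫ u, g u ^ 2 ∂P) / M ^ 2) := by
  have hL : ∀ i, MemLp (fun ω => g (W i ω)) 2 μ := fun i => by
    have := h2
    rw [← (hLaw i).map_eq] at this
    exact this.comp_of_map (hLaw i).aemeasurable
  have hmean : ∀ i, ∫ ω, g (W i ω) ∂μ = 0 := fun i =>
    ((hLaw i).integral_comp hg.aestronglyMeasurable).trans h0
  have hvar : ∀ i, Var[fun ω => g (W i ω); μ] = ∫ u, g u ^ 2 ∂P := fun i => by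
    rw [variance_eq_integral (hL i).aemeasurable, hmean i]
    simp only [sub_zero]
    exact (hLaw i).integral_comp (f := fun u => g u ^ 2) (hg.pow_const 2).aestronglyMeasurable
  set S : Ω → ℝ := fun ω => (√n)⁻¹ * ∑ j : Fin n, g (W j ω) with hS
  have hsum : MemLp (fun ω => ∑ j : Fin n, g (W j ω)) 2 μ := memLp_finsetSum _ fun j _ => hL j
  have hSL : MemLp S 2 μ := hsum.const_mul _
  have hSmean : ∫ ω, S ω ∂μ = 0 := by
    rw [hS, integral_const_mul, integral_finsetSum Finset.univ
      fun (j : Fin n) _ => (hL j).integrable one_le_two]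
    simp [hmean]
  -- Only an inequality, because at `n = 0` the sum is empty.
  have hSvar : Var[S; μ] ≤ ∫ u, g u ^ 2 ∂P := by
    have e : Var[fun ω => ∑ j : Fin n, g (W j ω); μ] = n * ∫ u, g u ^ 2 ∂P := by
      have := IndepFun.variance_sum (μ := μ) (s := Finset.univ)
        (X := fun (j : Fin n) ω => g (W j ω)) (fun j _ => hL j)
        (fun i _ j _ hij => (hInd.indepFun (fun h => hij (Fin.ext h))).comp hg hg)
      simp only [hvar, Finset.sum_const, Finset.card_univ, Fintype.card_fin, nsmul_eq_mul] at this
      rw [← this]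
      congr 1
      ext ω; simp
    rw [hS, variance_const_mul, e, inv_pow, Real.sq_sqrt (Nat.cast_nonneg n)]
    rcases Nat.eq_zero_or_pos n with rfl | hn
    · simpa using integral_nonneg fun u => sq_nonneg (g u)
    · have : (n : ℝ) ≠ 0 := by positivity
      rw [inv_mul_cancel_left₀ this]
  have hch := meas_ge_le_variance_div_sq hSL hM
  rw [hSmean] at hch
  simp only [sub_zero] at hch
  refine (measure_mono fun ω (hω : M < |S ω|) => hω.le).trans (hch.trans ?_)
  exact ENNReal.ofReal_le_ofReal (div_le_div_of_nonneg_right hSvar (by positivity))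

end Sample

/-! ### Inverse probability weighting -/

/-- Inverse probability weighting by the conditional probability `e = 1 / w` of an event `D` that
is conditionally independent of `Y` recovers the mean of functions of `Y`. -/
lemma integral_indicator_mul_weight {E β : Type*} {m mE : MeasurableSpace E}
    [MeasurableSpace β] (hm : m ≤ mE) {P : Measure E} [IsProbabilityMeasure P] {D : Set E}
    (hD : MeasurableSet D) {Y : E → β} (hY : Measurable Y) {e w : E → ℝ}
    (he : P[D.indicator (fun _ => (1 : ℝ)) | m] =ᵐ[P] e)
    (hci : ∀ B, MeasurableSet B → P[(D ∩ Y ⁻¹' B).indicator (fun _ => (1 : ℝ)) | m] =ᵐ[P]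
      fun x => (P[D.indicator (fun _ => (1 : ℝ)) | m]) x
        * (P[(Y ⁻¹' B).indicator (fun _ => (1 : ℝ)) | m]) x)
    (hw : StronglyMeasurable[m] w) (hw0 : ∀ x, 0 ≤ w x) (hwe : ∀ x, w x * e x = 1) {C : ℝ}
    (hwC : ∀ᵐ x ∂P, w x ≤ C) {g : β → ℝ} (hg : Measurable g) :
    ∫ x, D.indicator (fun _ => (1 : ℝ)) x * w x * g (Y x) ∂P = ∫ x, g (Y x) ∂P := by
  have hwm : Measurable w := (hw.mono hm).measurable
  have hDm : Measurable (D.indicator fun _ => (1 : ℝ)) := measurable_const.indicator hD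
  have hdens : Measurable fun x => ENNReal.ofReal (D.indicator (fun _ => (1 : ℝ)) x * w x) :=
    (hDm.mul hwm).ennreal_ofReal
  have hnn : ∀ x, 0 ≤ D.indicator (fun _ => (1 : ℝ)) x * w x := fun x =>
    mul_nonneg (Set.indicator_nonneg (fun _ _ => zero_le_one) x) (hw0 x)
  have hind : ∀ A : Set E, MeasurableSet A → Integrable (A.indicator fun _ => (1 : ℝ)) P :=
    fun A hA => (integrable_const 1).indicator hA
  have hwint : ∀ A : Set E, MeasurableSet A →
      Integrable (w * A.indicator fun _ => (1 : ℝ)) P := fun A hA => by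
    refine (hind A hA).bdd_mul (c := C) hwm.aestronglyMeasurable ?_
    filter_upwards [hwC] with x hx
    rwa [Real.norm_of_nonneg (hw0 x)]
  -- Reweighting `P` by `1_D w` leaves the law of `Y` unchanged. Checking this on events is enough,
  -- and it transfers to every measurable `g` without integrability.
  have key : (P.withDensity fun x =>
      ENNReal.ofReal (D.indicator (fun _ => (1 : ℝ)) x * w x)).map Y = P.map Y := by
    ext B hB
    have hB' := hY hB
    rw [Measure.map_apply hY hB, Measure.map_apply hY hB, withDensity_apply _ hB',
      ← lintegral_indicator hB']
    have e1 : ∀ x, (Y ⁻¹' B).indicator (fun x =>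
        ENNReal.ofReal (D.indicator (fun _ => (1 : ℝ)) x * w x)) x
        = ENNReal.ofReal ((w * (D ∩ Y ⁻¹' B).indicator fun _ => (1 : ℝ)) x) := fun x => by
      by_cases hx : x ∈ Y ⁻¹' B <;> by_cases hxD : x ∈ D <;>
        simp [Set.indicator, hx, hxD]
    simp only [e1]
    rw [← ofReal_integral_eq_lintegral_ofReal (hwint _ (hD.inter hB'))
      (Eventually.of_forall fun x => mul_nonneg (hw0 x)
        (Set.indicator_nonneg (fun _ _ => zero_le_one) x))]
    -- Given `m`, the integrand has conditional mean `w e P(Y ∈ B | m)`, and `w e = 1`.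
    have e2 : ∫ x, (w * (D ∩ Y ⁻¹' B).indicator fun _ => (1 : ℝ)) x ∂P
        = ∫ x, (Y ⁻¹' B).indicator (fun _ => (1 : ℝ)) x ∂P := by
      rw [← integral_condExp hm, ← integral_condExp hm (f := (Y ⁻¹' B).indicator _)]
      refine integral_congr_ae ?_
      filter_upwards [condExp_mul_of_stronglyMeasurable_left hw (hwint _ (hD.inter hB'))
        (hind _ (hD.inter hB')), hci B hB, he] with x h1 h2 h3
      rw [h1, Pi.mul_apply, h2, h3, ← mul_assoc, hwe, one_mul]
    rw [e2, integral_indicator hB', setIntegral_const, smul_eq_mul, mul_one,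
      Measure.real, ENNReal.ofReal_toReal (measure_ne_top _ _)]
  have h1 : ∫ y, g y ∂(P.map Y) = ∫ x, g (Y x) ∂P :=
    integral_map hY.aemeasurable hg.aestronglyMeasurable
  rw [← h1, ← key, integral_map hY.aemeasurable hg.aestronglyMeasurable,
    integral_withDensity_eq_integral_toReal_smul hdens
      (Eventually.of_forall fun _ => ENNReal.ofReal_lt_top)]
  simp only [ENNReal.toReal_ofReal (hnn _), smul_eq_mul]

/-! ### The population -/

variable {p : ℕ}

lemma stronglyMeasurable_comap_lin {P : Measure (Rec p)} {α₀ : Fin (p + 1) → ℝ}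
    (f : ℝ → ℝ) (hf : Measurable f) :
    StronglyMeasurable[MeasurableSpace.comap (cov : Rec p → _) inferInstance]
      fun u : Rec p => f (lin u (psi0 P α₀)) := by
  have h : Measurable fun x : EuclideanSpace ℝ (Fin p) => f (xt x ⬝ᵥ α₀) := by
    refine hf.comp (Finset.measurable_fun_sum _ fun i _ => Measurable.mul_const ?_ _)
    refine Fin.cases ?_ (fun i => ?_) i
    · simp [xt]
    · simp only [xt, Fin.cons_succ]; fun_prop
  exact (h.comp (comap_measurable cov)).stronglyMeasurable

/-- The hypotheses on the law `P` of a unit. -/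
structure Assumptions (P : Measure (Rec p)) [IsProbabilityMeasure P] (α₀ : Fin (p + 1) → ℝ) :
    Prop where
  sita : CondIndepFun (MeasurableSpace.comap cov inferInstance) measurable_cov.comap_le trt
    (fun u => (Y₁ u, Y₀ u)) P
  ps : P[T | MeasurableSpace.comap cov inferInstance] =ᵐ[P] fun u => ps (cov u) α₀
  memLp_Y₁ : MemLp Y₁ 2 P
  memLp_Y₀ : MemLp Y₀ 2 P
  memLp_cov : MemLp cov 2 P
  overlap : ∃ c₁ c₂ : ℝ, 0 < c₁ ∧ c₂ < 1 ∧
    ∀ᵐ u ∂P, c₁ ≤ PELCausal.ps (cov u) α₀ ∧ PELCausal.ps (cov u) α₀ ≤ c₂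
  posDef : (design P).PosDef
  asympVar_pos : 0 < asympVar P α₀

namespace Assumptions

variable {P : Measure (Rec p)} [IsProbabilityMeasure P] {α₀ : Fin (p + 1) → ℝ}

/-- The inverse scores are `1 + exp (∓ lin)`, so overlap bounds the linear predictor on both sides.
-/
lemma exists_bdd (hA : Assumptions P α₀) : ∃ R, ∀ᵐ u ∂P, |lin u (psi0 P α₀)| ≤ R := by
  obtain ⟨c₁, c₂, h1, h2, h⟩ := hA.overlap
  refine ⟨Real.log (max c₁⁻¹ (1 - c₂)⁻¹), ?_⟩
  filter_upwards [h] with u hu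
  have hpos : 0 < max c₁⁻¹ (1 - c₂)⁻¹ := lt_max_of_lt_left (inv_pos.2 h1)
  have e1 : 1 + Real.exp (-lin u (psi0 P α₀)) ≤ c₁⁻¹ := by
    rw [show 1 + Real.exp (-lin u (psi0 P α₀)) = _ from (inv_ps (cov u) α₀).symm]
    exact inv_anti₀ h1 hu.1
  have e2 : 1 + Real.exp (lin u (psi0 P α₀)) ≤ (1 - c₂)⁻¹ := by
    rw [show 1 + Real.exp (lin u (psi0 P α₀)) = _ from (inv_one_sub_ps (cov u) α₀).symm]
    exact inv_anti₀ (by linarith) (by linarith [hu.2])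
  rw [abs_le']
  constructor
  · rw [Real.le_log_iff_exp_le hpos]
    exact le_max_of_le_right (by linarith)
  · rw [Real.le_log_iff_exp_le hpos]
    exact le_max_of_le_left (by linarith)

lemma memLp_xt (hA : Assumptions P α₀) (i : Fin (p + 1)) :
    MemLp (fun u => xt (cov u) i) 2 P := by
  refine Fin.cases ?_ (fun i => ?_) i
  · simpa [xt] using memLp_const (1 : ℝ)
  · refine hA.memLp_cov.mono (measurable_xt _).aestronglyMeasurable (ae_of_all _ fun u => ?_)
    simpa [xt] using PiLp.norm_apply_le (cov u) i

lemma memLp_env (hA : Assumptions P α₀) : MemLp env 2 P := by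
  have h1 : MemLp (fun u => |Y₁ u|) 2 P := hA.memLp_Y₁.abs
  have h0 : MemLp (fun u => |Y₀ u|) 2 P := hA.memLp_Y₀.abs
  have hx : MemLp (fun u => ∑ i, |xt (cov u) i|) 2 P :=
    memLp_finsetSum _ fun i _ => (hA.memLp_xt i).abs
  have hc : MemLp (fun _ : Rec p => (1 : ℝ)) 2 P := memLp_const 1
  exact ((hc.add h1).add h0).add hx

lemma integrable_env_sq (hA : Assumptions P α₀) : Integrable (fun u => env u ^ 2) P :=
  hA.memLp_env.integrable_sq

lemma integrable_T : Integrable (T : Rec p → ℝ) P := by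
  refine (integrable_const (1 : ℝ)).mono' measurable_T.aestronglyMeasurable (ae_of_all _ fun u => ?_)
  unfold T; split_ifs <;> simp

lemma T_eq_indicator : (T : Rec p → ℝ) = (trt ⁻¹' {true}).indicator fun _ => (1 : ℝ) := by
  ext u; simp [T, Set.indicator]

lemma one_sub_T_eq_indicator :
    (fun u : Rec p => 1 - T u) = (trt ⁻¹' {false}).indicator fun _ => (1 : ℝ) := by
  ext u
  unfold T
  cases h : trt u <;> simp [Set.indicator, h]

lemma ipw₁ (hA : Assumptions P α₀) {g : ℝ → ℝ} (hg : Measurable g) :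
    ∫ u, T u * g (Y₁ u) * (1 + Real.exp (-lin u (psi0 P α₀))) ∂P = ∫ u, g (Y₁ u) ∂P := by
  obtain ⟨R, hR⟩ := hA.exists_bdd
  have hYm : Measurable fun u : Rec p => (Y₁ u, Y₀ u) := measurable_Y₁.prodMk measurable_Y₀
  have hci := (condIndepFun_iff_condExp_inter_preimage_eq_mul measurable_trt hYm).1 hA.sita
  have hps := hA.ps
  rw [T_eq_indicator] at hps
  have h := integral_indicator_mul_weight measurable_cov.comap_le
    (measurable_trt (measurableSet_singleton true)) hYm
    (w := fun u => 1 + Real.exp (-lin u (psi0 P α₀)))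
    hps
    (fun B hB => hci {true} B (measurableSet_singleton true) hB)
    (stronglyMeasurable_comap_lin (fun t => 1 + Real.exp (-t)) (by fun_prop))
    (fun u => by positivity)
    (fun u => by
      rw [show 1 + Real.exp (-lin u (psi0 P α₀)) = _ from (inv_ps (cov u) α₀).symm]
      exact inv_mul_cancel₀ (ps_pos _ _).ne')
    (C := 1 + Real.exp R)
    (by filter_upwards [hR] with u hu
        gcongr
        exact (neg_le_abs _).trans hu)
    (g := fun y => g y.1) (hg.comp measurable_fst)
  rw [← T_eq_indicator] at h
  rw [← h]
  exact integral_congr_ae (ae_of_all _ fun u => by ring)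

lemma condExp_one_sub_T (hA : Assumptions P α₀) :
    P[fun u => 1 - T u | MeasurableSpace.comap cov inferInstance]
      =ᵐ[P] fun u => 1 - PELCausal.ps (cov u) α₀ := by
  have h := condExp_sub (integrable_const (1 : ℝ)) (integrable_T (P := P))
    (MeasurableSpace.comap cov inferInstance)
  rw [condExp_const measurable_cov.comap_le] at h
  filter_upwards [h, hA.ps] with u h1 h2
  have h1' : (P[fun u => 1 - T u | MeasurableSpace.comap cov inferInstance]) u
    = 1 - (P[T | MeasurableSpace.comap cov inferInstance]) u := h1
  rw [h1', h2]

lemma ipw₀ (hA : Assumptions P α₀) {g : ℝ → ℝ} (hg : Measurable g) :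
    ∫ u, (1 - T u) * g (Y₀ u) * (1 + Real.exp (lin u (psi0 P α₀))) ∂P = ∫ u, g (Y₀ u) ∂P := by
  obtain ⟨R, hR⟩ := hA.exists_bdd
  have hYm : Measurable fun u : Rec p => (Y₁ u, Y₀ u) := measurable_Y₁.prodMk measurable_Y₀
  have hci := (condIndepFun_iff_condExp_inter_preimage_eq_mul measurable_trt hYm).1 hA.sita
  have hps := hA.condExp_one_sub_T
  rw [one_sub_T_eq_indicator] at hps
  have h := integral_indicator_mul_weight measurable_cov.comap_le
    (measurable_trt (measurableSet_singleton false)) hYm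
    (w := fun u => 1 + Real.exp (lin u (psi0 P α₀)))
    hps
    (fun B hB => hci {false} B (measurableSet_singleton false) hB)
    (stronglyMeasurable_comap_lin (fun t => 1 + Real.exp t) (by fun_prop))
    (fun u => by positivity)
    (fun u => by
      rw [show 1 + Real.exp (lin u (psi0 P α₀)) = _ from (inv_one_sub_ps (cov u) α₀).symm]
      exact inv_mul_cancel₀ (one_sub_ps_pos _ _).ne')
    (C := 1 + Real.exp R)
    (by filter_upwards [hR] with u hu
        gcongr
        exact (le_abs_self _).trans hu)
    (g := fun y => g y.2) (hg.comp measurable_snd)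
  rw [← one_sub_T_eq_indicator] at h
  rw [← h]
  exact integral_congr_ae (ae_of_all _ fun u => by ring)

lemma integral_xt_mul_T (hA : Assumptions P α₀) (i : Fin (p + 1)) :
    ∫ u, xt (cov u) i * T u ∂P = ∫ u, xt (cov u) i * logistic (lin u (psi0 P α₀)) ∂P := by
  have hx := (hA.memLp_xt i).integrable one_le_two
  have hm : StronglyMeasurable[MeasurableSpace.comap (cov : Rec p → _) inferInstance]
      fun u : Rec p => xt (cov u) i := by
    have h : Measurable fun x : EuclideanSpace ℝ (Fin p) => xt x i := by
      refine Fin.cases ?_ (fun i => ?_) i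
      · simp [xt]
      · simp only [xt, Fin.cons_succ]; fun_prop
    exact (h.comp (comap_measurable cov)).stronglyMeasurable
  have hxT : Integrable ((fun u : Rec p => xt (cov u) i) * (T : Rec p → ℝ)) P := by
    refine hx.mul_bdd (c := 1) measurable_T.aestronglyMeasurable (ae_of_all _ fun u => ?_)
    unfold T; split_ifs <;> simp
  have h := condExp_mul_of_stronglyMeasurable_left hm hxT integrable_T
  have e : ∫ u, xt (cov u) i * T u ∂P = ∫ u, ((fun u : Rec p => xt (cov u) i) * (T : Rec p → ℝ)) u ∂P := rfl
  rw [e, ← integral_condExp measurable_cov.comap_le]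
  refine integral_congr_ae ?_
  filter_upwards [h, hA.ps] with u h1 h2
  rw [h1, Pi.mul_apply, h2]
  rfl

lemma integrable_U (hA : Assumptions P α₀) (l : Idx p) :
    Integrable (fun u => U u (psi0 P α₀) l) P := by
  obtain ⟨R, hR⟩ := hA.exists_bdd
  exact (EnvLip.U l).integrable one_le_two (measurable_U _ l) hR hA.integrable_env_sq

lemma integrable_U_mul (hA : Assumptions P α₀) (l m : Idx p) :
    Integrable (fun u => U u (psi0 P α₀) l * U u (psi0 P α₀) m) P := by
  obtain ⟨R, hR⟩ := hA.exists_bdd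
  exact ((EnvLip.U l).mul (EnvLip.U m)).integrable le_rfl
    ((measurable_U _ l).mul (measurable_U _ m)) hR hA.integrable_env_sq

lemma memLp_U (hA : Assumptions P α₀) (l : Idx p) :
    MemLp (fun u => U u (psi0 P α₀) l) 2 P := by
  rw [memLp_two_iff_integrable_sq (measurable_U _ l).aestronglyMeasurable]
  simpa only [sq] using hA.integrable_U_mul l l

/-- The estimating functions are unbiased. -/
lemma integral_U (hA : Assumptions P α₀) (l : Idx p) : ∫ u, U u (psi0 P α₀) l ∂P = 0 := by
  have h1 : Integrable (Y₁ : Rec p → ℝ) P := hA.memLp_Y₁.integrable one_le_two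
  have h0 : Integrable (Y₀ : Rec p → ℝ) P := hA.memLp_Y₀.integrable one_le_two
  rcases l with l | l
  · fin_cases l
    · simp only [Fin.zero_eta, U_inl_zero]
      rw [hA.ipw₁ (g := fun y => y - psi0 P α₀ (Sum.inl 0)) (by fun_prop),
        integral_sub h1 (integrable_const _)]
      simp [psi0, mkPsi, mu₁]
    · simp only [Fin.mk_one, U_inl_one]
      rw [hA.ipw₀ (g := fun y => y - (psi0 P α₀ (Sum.inl 0) - psi0 P α₀ (Sum.inl 1)))
        (by fun_prop), integral_sub h0 (integrable_const _)]
      simp [psi0, mkPsi, ate, mu₀]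
  · simp only [U_inr, mul_sub]
    have hx := (hA.memLp_xt l).integrable one_le_two
    rw [integral_sub, hA.integral_xt_mul_T, sub_self]
    · refine hx.mul_bdd (c := 1) measurable_T.aestronglyMeasurable (ae_of_all _ fun u => ?_)
      unfold T; split_ifs <;> simp
    · refine hx.mul_bdd (c := 1)
        (measurable_logistic.comp (measurable_lin _)).aestronglyMeasurable (ae_of_all _ fun u => ?_)
      rw [Real.norm_of_nonneg (logistic_pos _).le]
      exact (logistic_lt_one _).le

end Assumptions

variable {p : ℕ}

namespace Assumptions

variable {P : Measure (Rec p)} [IsProbabilityMeasure P] {α₀ : Fin (p + 1) → ℝ}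

/-! ### The population Jacobian and the asymptotic variance -/

lemma integral_ipw_one (hA : Assumptions P α₀) :
    ∫ u, T u * (1 + Real.exp (-lin u (psi0 P α₀))) ∂P = 1 := by
  simpa using hA.ipw₁ (g := fun _ => 1) measurable_const

lemma integral_ipw_zero (hA : Assumptions P α₀) :
    ∫ u, (1 - T u) * (1 + Real.exp (lin u (psi0 P α₀))) ∂P = 1 := by
  simpa using hA.ipw₀ (g := fun _ => 1) measurable_const

/-- Inverse weighting of the constant 1 makes the upper left block explicit, and the logistic score
does not involve the means. Invertibility thus reduces to that of the Fisher block. -/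
lemma popH_eq (hA : Assumptions P α₀) : popH P α₀ = Matrix.fromBlocks !![-1, 0; -1, 1]
    (popH P α₀).toBlocks₁₂ 0 (popH P α₀).toBlocks₂₂ := by
  conv_lhs => rw [← Matrix.fromBlocks_toBlocks (popH P α₀)]
  congr 1
  · have h1 := hA.integral_ipw_one
    have h0 := hA.integral_ipw_zero
    ext l m
    fin_cases l <;> fin_cases m <;>
      simp [Matrix.toBlocks₁₁, popH, jac_eq, jacMat, integral_neg, h1, h0]
  · ext l m
    simp [Matrix.toBlocks₂₁, popH, jac_eq, jacMat]

lemma integrable_jacMat (hA : Assumptions P α₀) (l m : Idx p) :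
    Integrable (fun u => jacMat u (psi0 P α₀) l m) P := by
  obtain ⟨R, hR⟩ := hA.exists_bdd
  exact (EnvLip.jacMat l m).integrable le_rfl (measurable_jacMat _ l m) hR hA.integrable_env_sq

/-- The Fisher information of the propensity score model is nonsingular. -/
lemma det_toBlocks₂₂_ne_zero (hA : Assumptions P α₀) : (popH P α₀).toBlocks₂₂.det ≠ 0 := by
  intro hdet
  obtain ⟨v, hv0, hv⟩ := Matrix.exists_mulVec_eq_zero_iff.2 hdet
  obtain ⟨c₁, c₂, h1, h2, hov⟩ := hA.overlap
  have hx : ∀ i k, Integrable (fun u => xt (cov u) i * xt (cov u) k) P := fun i k =>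
    (hA.memLp_xt i).integrable_mul (hA.memLp_xt k)
  have hsq : ∀ u : Rec p, (xt (cov u) ⬝ᵥ v) ^ 2
      = ∑ i, ∑ k, v i * v k * (xt (cov u) i * xt (cov u) k) := fun u => by
    rw [sq, dotProduct, Finset.sum_mul_sum]
    exact Finset.sum_congr rfl fun i _ => Finset.sum_congr rfl fun k _ => by ring
  have hsqint : Integrable (fun u => (xt (cov u) ⬝ᵥ v) ^ 2) P := by
    simp only [hsq]
    exact integrable_finsetSum _ fun i _ => integrable_finsetSum _ fun k _ => (hx i k).const_mul _
  have e1 : ∫ u, (xt (cov u) ⬝ᵥ v) ^ 2 ∂P = v ⬝ᵥ (design P).mulVec v := by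
    simp only [hsq]
    rw [integral_finsetSum _ fun i _ => integrable_finsetSum _ fun k _ => (hx i k).const_mul _]
    simp only [dotProduct, Matrix.mulVec, Finset.mul_sum]
    refine Finset.sum_congr rfl fun i _ => ?_
    rw [integral_finsetSum _ fun k _ => (hx i k).const_mul _]
    refine Finset.sum_congr rfl fun k _ => ?_
    rw [integral_const_mul, design, Matrix.of_apply]; ring
  have hpos : 0 < v ⬝ᵥ (design P).mulVec v := by
    simpa using hA.posDef.dotProduct_mulVec_pos hv0
  -- For a null vector `v` the Fisher form `E f (x̃ᵀv)²` vanishes. By overlap `f ≥ c₁(1 − c₂)`, so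
  -- `E (x̃ᵀv)² ≤ 0`, against positive definiteness of the design.
  set f : Rec p → ℝ := fun u =>
    logistic (lin u (psi0 P α₀)) * (1 - logistic (lin u (psi0 P α₀))) with hf
  have hjac : ∀ (u : Rec p) i k, jacMat u (psi0 P α₀) (Sum.inr i) (Sum.inr k)
      = -(xt (cov u) i * xt (cov u) k * f u) := fun u i k => rfl
  have hfx : ∀ u : Rec p, f u * (xt (cov u) ⬝ᵥ v) ^ 2 = -∑ i, ∑ k, v i * v k *
      jacMat u (psi0 P α₀) (Sum.inr i) (Sum.inr k) := fun u => by
    rw [hsq, Finset.mul_sum, ← Finset.sum_neg_distrib]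
    refine Finset.sum_congr rfl fun i _ => ?_
    rw [Finset.mul_sum, ← Finset.sum_neg_distrib]
    refine Finset.sum_congr rfl fun k _ => ?_
    rw [hjac]; ring
  have hint : ∀ i k, Integrable (fun u => v i * v k *
      jacMat u (psi0 P α₀) (Sum.inr i) (Sum.inr k)) P :=
    fun i k => (hA.integrable_jacMat _ _).const_mul _
  have e2 : ∫ u, f u * (xt (cov u) ⬝ᵥ v) ^ 2 ∂P = 0 := by
    have e3 : v ⬝ᵥ (popH P α₀).toBlocks₂₂.mulVec v = 0 := by rw [hv, dotProduct_zero]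
    simp only [hfx]
    rw [integral_neg, integral_finsetSum _ fun i _ => integrable_finsetSum _ fun k _ => hint i k,
      neg_eq_zero, ← e3]
    simp only [dotProduct, Matrix.mulVec, Finset.mul_sum]
    refine Finset.sum_congr rfl fun i _ => ?_
    rw [integral_finsetSum _ fun k _ => hint i k]
    refine Finset.sum_congr rfl fun k _ => ?_
    rw [integral_const_mul]
    simp only [Matrix.toBlocks₂₂, Matrix.of_apply, popH, jac_eq]; ring
  have hfint : Integrable (fun u => f u * (xt (cov u) ⬝ᵥ v) ^ 2) P := by
    simp only [hfx]
    exact (integrable_finsetSum _ fun i _ => integrable_finsetSum _ fun k _ => hint i k).neg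
  have hle : ∫ u, c₁ * (1 - c₂) * (xt (cov u) ⬝ᵥ v) ^ 2 ∂P
      ≤ ∫ u, f u * (xt (cov u) ⬝ᵥ v) ^ 2 ∂P := by
    refine integral_mono_ae (hsqint.const_mul _) hfint ?_
    filter_upwards [hov] with u hu
    refine mul_le_mul_of_nonneg_right ?_ (sq_nonneg _)
    have hu' : c₁ ≤ logistic (lin u (psi0 P α₀)) ∧ logistic (lin u (psi0 P α₀)) ≤ c₂ := hu
    exact mul_le_mul hu'.1 (by linarith [hu'.2]) (by linarith) (h1.le.trans hu'.1)
  rw [e2, integral_const_mul, e1] at hle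
  have : 0 < c₁ * (1 - c₂) := mul_pos h1 (by linarith)
  exact absurd hle (not_le.2 (mul_pos this hpos))

lemma isUnit_det_popH (hA : Assumptions P α₀) : IsUnit (popH P α₀).det := by
  rw [hA.popH_eq, Matrix.det_fromBlocks_zero₂₁, isUnit_iff_ne_zero]
  refine mul_ne_zero ?_ hA.det_toBlocks₂₂_ne_zero
  simp [Matrix.det_fin_two]

/-- The asymptotic variance is the variance of the influence function. -/
lemma asympVar_eq (hA : Assumptions P α₀) : asympVar P α₀ =
    ∫ u, ((popH P α₀)⁻¹.mulVec (U u (psi0 P α₀)) (Sum.inl 1)) ^ 2 ∂P := by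
  have hi := fun l m => (hA.integrable_U_mul l m).const_mul
    ((popH P α₀)⁻¹ (Sum.inl 1) l * (popH P α₀)⁻¹ (Sum.inl 1) m)
  have e : ∀ u, ((popH P α₀)⁻¹.mulVec (U u (psi0 P α₀)) (Sum.inl 1)) ^ 2
      = ∑ l, ∑ m, (popH P α₀)⁻¹ (Sum.inl 1) l * (popH P α₀)⁻¹ (Sum.inl 1) m
        * (U u (psi0 P α₀) l * U u (psi0 P α₀) m) := fun u => by
    rw [sq, Matrix.mulVec, dotProduct, Finset.sum_mul_sum]
    exact Finset.sum_congr rfl fun i _ => Finset.sum_congr rfl fun k _ => by ring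
  simp only [e]
  rw [integral_finsetSum _ fun l _ => integrable_finsetSum _ fun m _ => hi l m, asympVar,
    ← Matrix.transpose_nonsing_inv, Matrix.mul_apply]
  simp only [Matrix.mul_apply, Finset.sum_mul, Matrix.transpose_apply]
  rw [Finset.sum_comm]
  refine Finset.sum_congr rfl fun l _ => ?_
  rw [integral_finsetSum _ fun m _ => hi l m]
  refine Finset.sum_congr rfl fun m _ => ?_
  rw [integral_const_mul, popMeat, Matrix.of_apply]; ring

/-- A positive asymptotic variance excludes that both outcomes are degenerate. -/
lemma var_pos (hA : Assumptions P α₀) :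
    0 < ∫ u, (Y₁ u ^ 2 + Y₀ u ^ 2) ∂P - mu₁ P ^ 2 - mu₀ P ^ 2 := by
  have e : ∫ u, (Y₁ u ^ 2 + Y₀ u ^ 2) ∂P - mu₁ P ^ 2 - mu₀ P ^ 2 = Var[Y₁; P] + Var[Y₀; P] := by
    rw [integral_add hA.memLp_Y₁.integrable_sq hA.memLp_Y₀.integrable_sq,
      variance_eq_sub hA.memLp_Y₁, variance_eq_sub hA.memLp_Y₀]
    simp only [mu₁, mu₀, Pi.pow_apply]; ring
  rw [e]
  -- If both outcomes are a.s. constant, the derivatives of the mean equations in `α` average to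
  -- zero, so the `θ` row of `popH⁻¹` ignores the logistic score. The mean components of `U` vanish
  -- as well, so the influence function and hence `V` are zero.
  by_contra hcon
  have n1 := variance_nonneg Y₁ P
  have n0 := variance_nonneg Y₀ P
  have h1 := ae_eq_integral_of_variance_eq_zero hA.memLp_Y₁ (by linarith)
  have h0 := ae_eq_integral_of_variance_eq_zero hA.memLp_Y₀ (by linarith)
  have hB : (popH P α₀).toBlocks₁₂ = 0 := by
    ext l m
    simp only [Matrix.toBlocks₁₂, Matrix.of_apply, popH, jac_eq, Matrix.zero_apply]
    refine integral_eq_zero_of_ae ?_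
    filter_upwards [h1, h0] with u h1 h0
    fin_cases l <;> simp [jacMat, psi0, mkPsi, mu₁, mu₀, ate, h1, h0]
  set D := (popH P α₀).toBlocks₂₂ with hD
  have hDu : IsUnit D.det := isUnit_iff_ne_zero.2 hA.det_toBlocks₂₂_ne_zero
  have hrow : ∀ k, (popH P α₀)⁻¹ (Sum.inl 1) (Sum.inr k) = 0 := by
    have hmul := Matrix.nonsing_inv_mul _ hA.isUnit_det_popH
    have hv : Matrix.vecMul (fun k => (popH P α₀)⁻¹ (Sum.inl 1) (Sum.inr k)) D = 0 := by
      ext k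
      have := congrFun (congrFun hmul (Sum.inl 1)) (Sum.inr k)
      rw [Matrix.mul_apply, Fintype.sum_sum_type] at this
      have hz : ∀ l, popH P α₀ (Sum.inl l) (Sum.inr k) = 0 := fun l =>
        congrFun (congrFun hB l) k
      simp [hz] at this
      exact this
    have := congrArg (fun w => Matrix.vecMul w D⁻¹) hv
    simp only [Matrix.vecMul_vecMul, Matrix.mul_nonsing_inv _ hDu, Matrix.vecMul_one,
      Matrix.zero_vecMul] at this
    exact fun k => congrFun this k
  have hV : asympVar P α₀ = 0 := by
    rw [hA.asympVar_eq]
    refine integral_eq_zero_of_ae ?_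
    filter_upwards [h1, h0] with u h1 h0
    have hU : ∀ l, U u (psi0 P α₀) (Sum.inl l) = 0 := fun l => by
      fin_cases l
      · simp [U_inl_zero, psi0, mkPsi, mu₁, h1]
      · simp [U_inl_one, psi0, mkPsi, mu₁, mu₀, ate, h0]
    simp [Matrix.mulVec, dotProduct, hrow, hU]
  exact hA.asympVar_pos.ne' hV

lemma model (hA : Assumptions P α₀) {R : ℝ} (hR : ∀ᵐ u ∂P, |lin u (psi0 P α₀)| ≤ R) :
    Model P α₀ R where
  isProb := inferInstance
  bdd := hR
  env_sq := hA.integrable_env_sq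
  isUnit_det := hA.isUnit_det_popH
  posDef := hA.posDef
  ipw₁ _ hg _ := hA.ipw₁ hg
  ipw₀ _ hg _ := hA.ipw₀ hg
  var_pos := hA.var_pos

end Assumptions

variable {p : ℕ}

/-! ### Measurability of the statistics -/

/-- Cramer's rule, valid also at singular matrices, where the inverse is zero by convention. -/
lemma measurable_matrix_inv_apply {X κ : Type*} [MeasurableSpace X] [Fintype κ] [DecidableEq κ]
    {M : X → Matrix κ κ ℝ} (hM : ∀ i k, Measurable fun x => M x i k) (i k : κ) :
    Measurable fun x => (M x)⁻¹ i k := by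
  have hdet : ∀ {A : X → Matrix κ κ ℝ}, (∀ i k, Measurable fun x => A x i k) →
      Measurable fun x => (A x).det := fun {A} hA => by
    simp only [Matrix.det_apply']
    exact Finset.measurable_fun_sum _ fun σ _ =>
      (Finset.measurable_fun_prod _ fun j _ => hA (σ j) j).const_mul _
  simp only [Matrix.inv_def, Matrix.smul_apply, Matrix.adjugate_apply, smul_eq_mul,
    Ring.inverse_eq_inv']
  refine (hdet hM).inv.mul (hdet fun a b => ?_)
  simp only [Matrix.updateRow_apply]
  split_ifs
  · exact measurable_const
  · exact hM a b

lemma measurable_matrix_mul_apply {X κ : Type*} [MeasurableSpace X] [Fintype κ]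
    {M M' : X → Matrix κ κ ℝ} (hM : ∀ i k, Measurable fun x => M x i k)
    (hM' : ∀ i k, Measurable fun x => M' x i k) (i k : κ) :
    Measurable fun x => (M x * M' x) i k := by
  simp only [Matrix.mul_apply]
  exact Finset.measurable_fun_sum _ fun j _ => (hM i j).mul (hM' j k)

section Statistics

variable {n : ℕ}

/-- Data and estimated propensity parameter. -/
abbrev Data (p n : ℕ) : Type := (Fin n → Rec p) × (Fin (p + 1) → ℝ)

lemma measurable_data_T (j : Fin n) : Measurable fun x : Data p n => T (x.1 j) :=
  measurable_T.comp ((measurable_pi_apply j).comp measurable_fst)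

lemma measurable_data_lin (j : Fin n) :
    Measurable fun x : Data p n => xt (cov (x.1 j)) ⬝ᵥ x.2 := by
  unfold dotProduct
  exact Finset.measurable_fun_sum _ fun i _ =>
    ((measurable_xt i).comp ((measurable_pi_apply j).comp measurable_fst)).mul
      ((measurable_pi_apply i).comp measurable_snd)

lemma measurable_data_a₁ (j : Fin n) : Measurable fun x : Data p n => a₁ x.1 x.2 j := by
  simp only [a₁, sum_S₁, inv_ps]
  exact ((measurable_data_lin j).neg.exp.const_add 1).div
    (Finset.measurable_fun_sum _ fun l _ =>
      (measurable_data_T l).mul ((measurable_data_lin l).neg.exp.const_add 1))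

lemma measurable_data_a₀ (j : Fin n) : Measurable fun x : Data p n => a₀ x.1 x.2 j := by
  simp only [a₀, sum_S₀, inv_one_sub_ps]
  exact ((measurable_data_lin j).exp.const_add 1).div
    (Finset.measurable_fun_sum _ fun l _ =>
      ((measurable_data_T l).const_sub 1).mul ((measurable_data_lin l).exp.const_add 1))

lemma measurable_data_Y₁ (j : Fin n) : Measurable fun x : Data p n => Y₁ (x.1 j) :=
  measurable_Y₁.comp ((measurable_pi_apply j).comp measurable_fst)

lemma measurable_data_Y₀ (j : Fin n) : Measurable fun x : Data p n => Y₀ (x.1 j) :=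
  measurable_Y₀.comp ((measurable_pi_apply j).comp measurable_fst)

lemma measurable_data_sum_a₁ {f : Data p n → Fin n → ℝ} (hf : ∀ j, Measurable fun x => f x j) :
    Measurable fun x : Data p n => ∑ j ∈ S₁ x.1, a₁ x.1 x.2 j * f x j := by
  simp only [sum_S₁]
  exact Finset.measurable_fun_sum _ fun j _ =>
    (measurable_data_T j).mul ((measurable_data_a₁ j).mul (hf j))

lemma measurable_data_sum_a₀ {f : Data p n → Fin n → ℝ} (hf : ∀ j, Measurable fun x => f x j) :
    Measurable fun x : Data p n => ∑ j ∈ S₀ x.1, a₀ x.1 x.2 j * f x j := by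
  simp only [sum_S₀]
  exact Finset.measurable_fun_sum _ fun j _ =>
    ((measurable_data_T j).const_sub 1).mul ((measurable_data_a₀ j).mul (hf j))

lemma measurable_muHat₁ : Measurable fun x : Data p n => muHat₁ x.1 x.2 :=
  measurable_data_sum_a₁ measurable_data_Y₁

lemma measurable_muHat₀ : Measurable fun x : Data p n => muHat₀ x.1 x.2 :=
  measurable_data_sum_a₀ measurable_data_Y₀

lemma measurable_psiHat :
    Measurable fun x : Data p n => mkPsi (muHat₁ x.1 x.2) (thetaHat x.1 x.2) x.2 := by
  refine measurable_pi_iff.2 fun l => ?_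
  rcases l with l | l
  · fin_cases l
    · exact measurable_muHat₁
    · exact measurable_muHat₁.sub measurable_muHat₀
  · exact (measurable_pi_apply l).comp measurable_snd

lemma measurable_varHat : Measurable fun x : Data p n => varHat x.1 x.2 := by
  have hpair : ∀ j : Fin n, Measurable fun x : Data p n =>
      (x.1 j, mkPsi (muHat₁ x.1 x.2) (thetaHat x.1 x.2) x.2) := fun j =>
    ((measurable_pi_apply j).comp measurable_fst).prodMk measurable_psiHat
  have hH : ∀ i k, Measurable fun x : Data p n =>
      H x.1 (mkPsi (muHat₁ x.1 x.2) (thetaHat x.1 x.2) x.2) i k := fun i k => by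
    simp only [H, jac_eq, Matrix.smul_apply, Matrix.sum_apply, smul_eq_mul]
    exact (Finset.measurable_fun_sum _ fun j _ =>
      (measurable_jacMat_uncurry i k).comp (hpair j)).const_mul _
  have hM : ∀ i k, Measurable fun x : Data p n =>
      meat x.1 (mkPsi (muHat₁ x.1 x.2) (thetaHat x.1 x.2) x.2) i k := fun i k => by
    simp only [meat, Matrix.smul_apply, Matrix.sum_apply, smul_eq_mul, Matrix.vecMulVec_apply]
    exact (Finset.measurable_fun_sum _ fun j _ =>
      ((measurable_U_uncurry i).comp (hpair j)).mul
        ((measurable_U_uncurry k).comp (hpair j))).const_mul _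
  exact measurable_matrix_mul_apply
    (measurable_matrix_mul_apply (measurable_matrix_inv_apply hH) hM)
    (measurable_matrix_inv_apply fun i k => hH k i) _ _

/-- Joint measurability in the data and in `α` allows substituting a measurable estimator, as
convergence in distribution requires. -/
lemma measurable_cHat : Measurable fun x : Data p n => cHat x.1 x.2 := by
  unfold cHat
  exact ((((((measurable_data_sum_a₁ fun j => (measurable_data_Y₁ j).pow_const 2).add
    (measurable_data_sum_a₀ fun j => (measurable_data_Y₀ j).pow_const 2)).sub
    (measurable_muHat₁.pow_const 2)).sub (measurable_muHat₀.pow_const 2)).const_mul 2).inv.const_mul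
    _).mul measurable_varHat

lemma measurable_pel : Measurable fun x : Data p n × (Fin n → ℝ) => pel x.1.1 x.1.2 x.2 := by
  have hlog : ∀ j, Measurable fun x : Data p n × (Fin n → ℝ) => Real.log (x.2 j) :=
    fun j => ((measurable_pi_apply j).comp measurable_snd).log
  have hT : ∀ j, Measurable fun x : Data p n × (Fin n → ℝ) => T (x.1.1 j) :=
    fun j => (measurable_data_T j).comp measurable_fst
  unfold pel
  simp only [sum_S₁, sum_S₀]
  exact (((Finset.measurable_fun_sum _ fun j _ =>
      (hT j).mul (((measurable_data_a₁ j).comp measurable_fst).mul (hlog j))).const_mul _).add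
    ((Finset.measurable_fun_sum _ fun j _ => ((hT j).const_sub 1).mul
      (((measurable_data_a₀ j).comp measurable_fst).mul (hlog j))).const_mul _)).const_mul _

end Statistics

/-! ### Random samples are regular -/

section Sample

variable {P : Measure (Rec p)} {α₀ : Fin (p + 1) → ℝ} {R : ℝ}
  {Ω : Type*} [MeasurableSpace Ω] {μ : Measure Ω} {W : ℕ → Ω → Rec p}

/-- The normalized sum of the estimating functions at the truth. -/
def scoreSum (P : Measure (Rec p)) (α₀ : Fin (p + 1) → ℝ) (W : ℕ → Ω → Rec p) (x : ℕ × Ω) :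
    Idx p → ℝ :=
  fun l => (√x.1)⁻¹ * ∑ j, U (sample W x.1 x.2 j) (psi0 P α₀) l

lemma eventually_bdd_sample (hR : ∀ᵐ u ∂P, |lin u (psi0 P α₀)| ≤ R)
    (hLaw : ∀ j, HasLaw (W j) P μ) :
    ∀ᶠ x in probFilter μ, ∀ j, |lin (sample W x.1 x.2 j) (psi0 P α₀)| ≤ R := by
  refine eventually_probFilter_of_forall_ae
    (q := fun x => ∀ j, |lin (sample W x.1 x.2 j) (psi0 P α₀)| ≤ R) fun n => ?_
  show ∀ᵐ ω ∂μ, ∀ j : Fin n, |lin (sample W n ω j) (psi0 P α₀)| ≤ R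
  refine ae_all_iff.2 fun j => ?_
  have h := hR
  rw [← (hLaw j).map_eq] at h
  exact ae_of_ae_map (hLaw j).aemeasurable h

variable [IsProbabilityMeasure μ]

lemma tendsto_avg_sample (hInd : iIndepFun W μ) (hLaw : ∀ j, HasLaw (W j) P μ) {g : Rec p → ℝ}
    (hg : Measurable g) (hint : Integrable g P) :
    Tendsto (fun x : ℕ × Ω => avg fun j => g (sample W x.1 x.2 j)) (probFilter μ)
      (𝓝 (∫ u, g u ∂P)) := by
  have e : ∀ x : ℕ × Ω, (avg fun j => g (sample W x.1 x.2 j))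
      = (∑ i ∈ Finset.range x.1, g (W i x.2)) / x.1 := fun x => by
    simp only [avg, sample, Finset.sum_range, div_eq_inv_mul]
  have hj : ∀ j, AEMeasurable (fun ω => g (W j ω)) μ := fun j =>
    hg.comp_aemeasurable (hLaw j).aemeasurable
  simp only [e]
  exact tendsto_probFilter_of_ae_tendsto (f := fun n ω => (∑ i ∈ Finset.range n, g (W i ω)) / n)
    (fun n => (Finset.aemeasurable_fun_sum (Finset.range n) fun j _ => hj j).div_const (n : ℝ))
    (ae_tendsto_avg hInd hLaw hg hint)

/-- By the strong law `env²` of the `n`-th unit is a.s. `o(n)`, hence so is the maximum of `env²`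
over the first `n` units. -/
lemma eventually_env_sample (hsq : Integrable (fun u => env u ^ 2) P)
    (hInd : iIndepFun W μ) (hLaw : ∀ j, HasLaw (W j) P μ) {ε : ℝ} (hε : 0 < ε) :
    ∀ᶠ x in probFilter μ, ∀ j, env (sample W x.1 x.2 j) ≤ ε * √x.1 := by
  refine eventually_probFilter_of_ae_eventually
    (q := fun x => ∀ j, env (sample W x.1 x.2 j) ≤ ε * √x.1) (fun n => ?_) ?_
  · show NullMeasurableSet {ω | ∀ j : Fin n, env (sample W n ω j) ≤ ε * √n} μ
    have h : {ω | ∀ j : Fin n, env (sample W n ω j) ≤ ε * √n}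
        = ⋂ j : Fin n, {ω | env (sample W n ω j) ≤ ε * √n} := by ext; simp
    rw [h]
    refine NullMeasurableSet.iInter fun j => ?_
    have hj : AEMeasurable (fun ω => env (sample W n ω j)) μ :=
      measurable_env.comp_aemeasurable (hLaw j).aemeasurable
    exact nullMeasurableSet_le hj aemeasurable_const
  · filter_upwards [ae_tendsto_avg hInd hLaw (measurable_env.pow_const 2) hsq] with ω hω
    filter_upwards [eventually_forall_lt_le_of_tendsto_div (tendsto_div_of_tendsto_avg hω)
      (sq_pos_of_pos hε)] with n hn j
    have h := hn j j.2
    have h0 : 0 ≤ ε * √n := by positivity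
    refine (abs_le_of_sq_le_sq' ?_ h0).2
    rw [mul_pow, Real.sq_sqrt (Nat.cast_nonneg n)]
    exact h

variable [IsProbabilityMeasure P]

/-- Every property but convergence of the score already holds along `probFilter` and is inherited by
finer filters. -/
lemma regime_of_le (hA : Assumptions P α₀) (hR : ∀ᵐ u ∂P, |lin u (psi0 P α₀)| ≤ R)
    (hInd : iIndepFun W μ) (hLaw : ∀ j, HasLaw (W j) P μ) {G : Filter (ℕ × Ω)}
    (hG : G ≤ probFilter μ) {z : Idx p → ℝ} (hz : Tendsto (scoreSum P α₀ W) G (𝓝 z)) :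
    Regime P α₀ R G Prod.fst (fun x => sample W x.1 x.2) z where
  tendsto_N := tendsto_fst_probFilter.mono_left hG
  bdd := hG (eventually_bdd_sample hR hLaw)
  lln _ hg hint := (tendsto_avg_sample hInd hLaw hg hint).mono_left hG
  env _ hε := hG (eventually_env_sample hA.integrable_env_sq hInd hLaw hε)
  score l := tendsto_pi_nhds.1 hz l

lemma scoreSum_tight (hA : Assumptions P α₀) (hInd : iIndepFun W μ)
    (hLaw : ∀ j, HasLaw (W j) P μ) :
    ∀ η > 0, ∃ M, ∀ᶠ n in atTop, μ {ω | M < ‖scoreSum P α₀ W (n, ω)‖} ≤ η := by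
  intro η hη
  set A : ℝ := ∑ l : Idx p, ∫ u, U u (psi0 P α₀) l ^ 2 ∂P with hAdef
  have hA0 : 0 ≤ A := Finset.sum_nonneg fun l _ => integral_nonneg fun u => sq_nonneg _
  have hlim : Tendsto (fun M : ℝ => ENNReal.ofReal (A / M ^ 2)) atTop (𝓝 0) := by
    rw [← ENNReal.ofReal_zero]
    exact ENNReal.tendsto_ofReal
      (tendsto_const_nhds.div_atTop (tendsto_pow_atTop two_ne_zero))
  obtain ⟨M, hM, hM0⟩ :=
    ((ENNReal.tendsto_nhds_zero.1 hlim η hη).and (eventually_gt_atTop 0)).exists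
  refine ⟨M, Eventually.of_forall fun n => le_trans ?_ hM⟩
  calc μ {ω | M < ‖scoreSum P α₀ W (n, ω)‖}
      ≤ μ (⋃ l, {ω | M < |scoreSum P α₀ W (n, ω) l|}) := by
        refine measure_mono fun ω (hω : M < ‖scoreSum P α₀ W (n, ω)‖) => ?_
        by_contra hcon
        simp only [Set.mem_iUnion, not_exists] at hcon
        refine absurd hω (not_lt.2 ((pi_norm_le_iff_of_nonneg hM0.le).2 fun l => ?_))
        exact not_lt.1 (hcon l)
    _ ≤ ∑ l, μ {ω | M < |scoreSum P α₀ W (n, ω) l|} := measure_iUnion_fintype_le _ _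
    _ ≤ ∑ l, ENNReal.ofReal ((∫ u, U u (psi0 P α₀) l ^ 2 ∂P) / M ^ 2) :=
        Finset.sum_le_sum fun l _ => measure_lt_abs_sum_le hInd hLaw (measurable_U _ l)
          (hA.memLp_U l) (hA.integral_U l) n hM0
    _ = ENNReal.ofReal (A / M ^ 2) := by
        rw [← ENNReal.ofReal_sum_of_nonneg fun l _ => div_nonneg
          (integral_nonneg fun u => sq_nonneg _) (by positivity), ← Finset.sum_div]

/-- The central limit theorem for the squared studentized influence function. -/
lemma tendstoInDistribution_influence (hA : Assumptions P α₀) (hInd : iIndepFun W μ)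
    (hLaw : ∀ j, HasLaw (W j) P μ) :
    TendstoInDistribution (fun (n : ℕ) ω =>
      ((popH P α₀)⁻¹.mulVec (scoreSum P α₀ W (n, ω)) (Sum.inl 1)) ^ 2 / asympVar P α₀)
      atTop (fun z : ℝ => z ^ 2) (fun _ => μ) (gaussianReal 0 1) := by
  -- The standardized influence function: centred because `U` is unbiased, of unit variance by
  -- `asympVar_eq`. A scalar central limit theorem followed by squaring is therefore enough.
  set φ : Rec p → ℝ := fun u => (popH P α₀)⁻¹.mulVec (U u (psi0 P α₀)) (Sum.inl 1) /
    √(asympVar P α₀) with hφ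
  have hφm : Measurable φ := by
    simp only [hφ, Matrix.mulVec, dotProduct]
    exact (Finset.measurable_fun_sum _ fun l _ => (measurable_U _ l).const_mul _).div_const _
  have h0 : ∫ u, φ u ∂P = 0 := by
    simp only [hφ, Matrix.mulVec, dotProduct]
    rw [integral_div, integral_finsetSum _ fun l _ => (hA.integrable_U l).const_mul _]
    simp [integral_const_mul, hA.integral_U]
  have h1 : ∫ u, φ u ^ 2 ∂P = 1 := by
    simp only [hφ, div_pow]
    rw [integral_div, ← hA.asympVar_eq, Real.sq_sqrt hA.asympVar_pos.le,
      div_self hA.asympVar_pos.ne']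
  have hclt := tendstoInDistribution_inv_sqrt_mul_sum (X := fun j ω => φ (W j ω)) (P := μ)
    (HasLaw.id (μ := gaussianReal 0 1))
    (((hLaw 0).integral_comp hφm.aestronglyMeasurable).trans h0)
    (((hLaw 0).integral_comp (hφm.pow_const 2).aestronglyMeasurable).trans h1)
    (hInd.comp (fun _ => φ) fun _ => hφm) (identDistrib_comp hLaw hφm)
  have hsq := hclt.continuous_comp (g := fun z : ℝ => z ^ 2) (by fun_prop)
  refine hsq.congr (fun n => Eventually.of_forall fun ω => ?_) (Eventually.of_forall fun z => rfl)
  have e : (√n)⁻¹ * ∑ k ∈ Finset.range n, φ (W k ω)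
      = (popH P α₀)⁻¹.mulVec (scoreSum P α₀ W (n, ω)) (Sum.inl 1) / √(asympVar P α₀) := by
    rw [Finset.sum_range]
    simp only [hφ, scoreSum, Matrix.mulVec, dotProduct, sample]
    rw [← Finset.sum_div, Finset.sum_comm, ← mul_div_assoc, Finset.mul_sum]
    congr 1
    refine Finset.sum_congr rfl fun l _ => ?_
    rw [← Finset.mul_sum]; ring
  simp only [Function.comp_apply, e, div_pow, Real.sq_sqrt hA.asympVar_pos.le]

end Sample

variable {p : ℕ}

/-! ### The limiting distribution of the likelihood ratio -/

/-- Minus twice the pseudo-empirical log-likelihood ratio, divided by `ĉ`. -/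
def scaledRatio {n : ℕ} (s : Fin n → Rec p) (α : Fin (p + 1) → ℝ) (qR qG : Fin n → ℝ) : ℝ :=
  -2 * (pel s α qR - pel s α qG) / cHat s α

section

variable {Ω : Type*} [MeasurableSpace Ω] {μ : Measure Ω}

lemma aemeasurable_scaledRatio {n : ℕ} {s : Ω → Fin n → Rec p} {α : Ω → Fin (p + 1) → ℝ}
    {qR qG : Ω → Fin n → ℝ} (hs : AEMeasurable s μ) (hα : AEMeasurable α μ)
    (hR : AEMeasurable qR μ) (hG : AEMeasurable qG μ) :
    AEMeasurable (fun ω => scaledRatio (s ω) (α ω) (qR ω) (qG ω)) μ := by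
  have hd := hs.prodMk hα
  have h1 := measurable_pel.comp_aemeasurable (hd.prodMk hR)
  have h0 := measurable_pel.comp_aemeasurable (hd.prodMk hG)
  have hc := measurable_cHat.comp_aemeasurable hd
  exact ((h1.sub h0).const_mul (-2)).div hc

lemma aemeasurable_sample {P : Measure (Rec p)} {W : ℕ → Ω → Rec p}
    (hLaw : ∀ j, HasLaw (W j) P μ) (n : ℕ) : AEMeasurable (sample W n) μ := by
  have h := aemeasurable_pi_lambda (fun ω (j : Fin n) => W j ω) fun j => (hLaw j).aemeasurable
  exact h

variable [IsProbabilityMeasure μ]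

/-- Attainment of the maxima, consistency of `ĉ`, and the expansion of the scaled likelihood
ratio, all in probability. -/
theorem tendsto_pelRatio_probFilter {P : Measure (Rec p)} [IsProbabilityMeasure P]
    {α₀ : Fin (p + 1) → ℝ} (hA : Assumptions P α₀) {W : ℕ → Ω → Rec p} (hInd : iIndepFun W μ)
    (hLaw : ∀ j, HasLaw (W j) P μ) {αs : ℕ × Ω → Fin (p + 1) → ℝ}
    {qG qR : ∀ x : ℕ × Ω, Fin x.1 → ℝ}
    (hα : ∀ᶠ x in probFilter μ, (∃ α, IsMLE (sample W x.1 x.2) α) →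
      IsMLE (sample W x.1 x.2) (αs x))
    (hG : ∀ᶠ x in probFilter μ,
      (∃ q, IsMaximizer (pel (sample W x.1 x.2) (αs x)) (normSet (sample W x.1 x.2)) q) →
      IsMaximizer (pel (sample W x.1 x.2) (αs x)) (normSet (sample W x.1 x.2)) (qG x))
    (hR : ∀ᶠ x in probFilter μ,
      (∃ q, IsMaximizer (pel (sample W x.1 x.2) (αs x)) (ateSet (sample W x.1 x.2) (ate P)) q) →
      IsMaximizer (pel (sample W x.1 x.2) (αs x)) (ateSet (sample W x.1 x.2) (ate P)) (qR x)) :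
    (∀ᶠ x in probFilter μ, (∃ α, IsMLE (sample W x.1 x.2) α) ∧
      (∃ q, IsMaximizer (pel (sample W x.1 x.2) (αs x)) (normSet (sample W x.1 x.2)) q) ∧
      (∃ q, IsMaximizer (pel (sample W x.1 x.2) (αs x)) (ateSet (sample W x.1 x.2) (ate P)) q)) ∧
    Tendsto (fun x => cHat (sample W x.1 x.2) (αs x)) (probFilter μ) (𝓝 (cPop P α₀)) ∧
    Tendsto (fun x => scaledRatio (sample W x.1 x.2) (αs x) (qR x) (qG x)
      - ((popH P α₀)⁻¹.mulVec (scoreSum P α₀ W x) (Sum.inl 1)) ^ 2 / asympVar P α₀)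
      (probFilter μ) (𝓝 0) := by
  obtain ⟨R, hbdd⟩ := hA.exists_bdd
  have hP := hA.model hbdd
  have tight := scoreSum_tight hA hInd hLaw
  have core := fun (z : Idx p → ℝ) (G : Filter (ℕ × Ω)) (hle : G ≤ probFilter μ)
    (hz : Tendsto (scoreSum P α₀ W) G (𝓝 z)) =>
      (regime_of_le hA hbdd hInd hLaw hle hz).tendsto_pelRatio hP hA.asympVar_pos
        (αs := αs) (qG := qG) (qR := qR) (hle hα) (hle hG) (hle hR)
  refine ⟨eventually_probFilter_of_tight tight fun z G hG hz => (core z G hG hz).1, ?_, ?_⟩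
  · rw [Metric.tendsto_nhds]
    exact fun ε hε => eventually_probFilter_of_tight tight fun z G hG hz =>
      Metric.tendsto_nhds.1 (core z G hG hz).2.1 ε hε
  · rw [Metric.tendsto_nhds]
    refine fun ε hε => eventually_probFilter_of_tight tight fun z G hG hz =>
      Metric.tendsto_nhds.1 ?_ ε hε
    -- Along `G` the ratio and the quadratic form in the score have the same limit, so `z` cancels
    -- in their difference and the conclusion no longer depends on the subfilter.
    have hcont : Continuous fun v : Idx p → ℝ =>
        ((popH P α₀)⁻¹.mulVec v (Sum.inl 1)) ^ 2 / asympVar P α₀ := by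
      unfold Matrix.mulVec dotProduct
      fun_prop
    have hinf : Tendsto (fun x => ((popH P α₀)⁻¹.mulVec (scoreSum P α₀ W x) (Sum.inl 1)) ^ 2
        / asympVar P α₀) G
        (𝓝 (((popH P α₀)⁻¹.mulVec z (Sum.inl 1)) ^ 2 / asympVar P α₀)) := by
      have h := (hcont.tendsto z).comp hz
      exact h
    have h := (core z G hG hz).2.2.sub hinf
    rw [sub_self] at h
    exact h

/-- Only the law of the limit matters, so the square of a normal variable may be replaced by the
identity under its image law. -/
lemma tendstoInDistribution_chiSquaredOne {X : ℕ → Ω → ℝ}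
    (h : TendstoInDistribution X atTop (fun z : ℝ => z ^ 2) (fun _ => μ) (gaussianReal 0 1)) :
    TendstoInDistribution X atTop (id : ℝ → ℝ) (fun _ => μ) chiSquaredOne := by
  refine ⟨h.forall_aemeasurable, measurable_id.aemeasurable, ?_⟩
  have e : chiSquaredOne.map (id : ℝ → ℝ) = (gaussianReal 0 1).map (fun z : ℝ => z ^ 2) :=
    Measure.map_id
  simp only [e]
  exact h.tendsto

/-- The limiting distribution of the scaled likelihood ratio, given its expansion. -/
theorem tendstoInDistribution_scaledRatio {P : Measure (Rec p)} [IsProbabilityMeasure P]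
    {α₀ : Fin (p + 1) → ℝ} (hA : Assumptions P α₀) {W : ℕ → Ω → Rec p} (hInd : iIndepFun W μ)
    (hLaw : ∀ j, HasLaw (W j) P μ) {αs : ℕ → Ω → Fin (p + 1) → ℝ}
    {qG qR : ∀ n : ℕ, Ω → Fin n → ℝ} (hα : ∀ n, AEMeasurable (αs n) μ)
    (hG : ∀ n, AEMeasurable (qG n) μ) (hR : ∀ n, AEMeasurable (qR n) μ)
    (h : Tendsto (fun x => scaledRatio (sample W x.1 x.2) (αs x.1 x.2) (qR x.1 x.2) (qG x.1 x.2)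
      - ((popH P α₀)⁻¹.mulVec (scoreSum P α₀ W x) (Sum.inl 1)) ^ 2 / asympVar P α₀)
      (probFilter μ) (𝓝 0)) :
    TendstoInDistribution
      (fun (n : ℕ) ω => scaledRatio (sample W n ω) (αs n ω) (qR n ω) (qG n ω))
      atTop (id : ℝ → ℝ) (fun _ => μ) chiSquaredOne := by
  set X : ℕ → Ω → ℝ := fun n ω => scaledRatio (sample W n ω) (αs n ω) (qR n ω) (qG n ω)
  set Z : ℕ → Ω → ℝ := fun n ω =>
    ((popH P α₀)⁻¹.mulVec (scoreSum P α₀ W (n, ω)) (Sum.inl 1)) ^ 2 / asympVar P α₀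
  have hX : ∀ n, AEMeasurable (X n) μ := fun n =>
    aemeasurable_scaledRatio (aemeasurable_sample hLaw n) (hα n) (hR n) (hG n)
  have hdiff : TendstoInMeasure μ (X - Z) atTop fun _ => 0 :=
    tendstoInMeasure_of_tendsto_probFilter (f := fun n ω => X n ω - Z n ω) h
  -- Slutsky's argument: a difference tending to zero in probability preserves the limit law.
  exact tendstoInDistribution_chiSquaredOne
    (tendstoInDistribution_of_tendstoInMeasure_sub X _
      (tendstoInDistribution_influence hA hInd hLaw) hdiff hX)

end

end PELCausal

end

/-! ### The main theorem. -/

theorem mainTheorem3 {p : ℕ} (P : Measure (PELCausal.Rec p)) [IsProbabilityMeasure P]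
    (α₀ : Fin (p + 1) → ℝ)
    -- strongly ignorable treatment assignment: `T` is independent of `(Y₁, Y₀)` given `x`
    (hSITA : CondIndepFun (MeasurableSpace.comap PELCausal.cov inferInstance)
      PELCausal.measurable_cov.comap_le PELCausal.trt
      (fun u => (PELCausal.Y₁ u, PELCausal.Y₀ u)) P)
    -- the logistic propensity score model is correct, with true parameter `α₀`
    (hPS : P[PELCausal.T | MeasurableSpace.comap PELCausal.cov inferInstance]
      =ᵐ[P] fun u => PELCausal.ps (PELCausal.cov u) α₀)
    -- finite second moments
    (hY₁ : MemLp PELCausal.Y₁ 2 P) (hY₀ : MemLp PELCausal.Y₀ 2 P) (hX : MemLp PELCausal.cov 2 P)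
    -- propensity scores bounded away from `0` and `1`
    (hτ : ∃ c₁ c₂ : ℝ, 0 < c₁ ∧ c₂ < 1 ∧
      ∀ᵐ u ∂P, c₁ ≤ PELCausal.ps (PELCausal.cov u) α₀ ∧ PELCausal.ps (PELCausal.cov u) α₀ ≤ c₂)
    -- nondegeneracy
    (hDesign : (PELCausal.design P).PosDef)
    (hV : 0 < PELCausal.asympVar P α₀)
    -- a random sample from `P`
    {Ω : Type*} [MeasurableSpace Ω] (μ : Measure Ω) [IsProbabilityMeasure μ]
    (W : ℕ → Ω → PELCausal.Rec p) (hInd : iIndepFun W μ) (hLaw : ∀ j, HasLaw (W j) P μ)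
    -- `αhat` is the maximum likelihood estimator (arbitrary where no maximum is attained)
    (αhat : ℕ → Ω → Fin (p + 1) → ℝ) (hα_meas : ∀ n, AEMeasurable (αhat n) μ)
    (hα : ∀ n, ∀ᵐ ω ∂μ, (∃ α, PELCausal.IsMLE (PELCausal.sample W n ω) α) →
      PELCausal.IsMLE (PELCausal.sample W n ω) (αhat n ω))
    -- `pG` is the global maximizer of the PEL function under normalization
    (pG : ∀ n : ℕ, Ω → Fin n → ℝ) (hG_meas : ∀ n, AEMeasurable (pG n) μ)
    (hG : ∀ n, ∀ᵐ ω ∂μ,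
      (∃ q, PELCausal.IsMaximizer (PELCausal.pel (PELCausal.sample W n ω) (αhat n ω))
        (PELCausal.normSet (PELCausal.sample W n ω)) q) →
      PELCausal.IsMaximizer (PELCausal.pel (PELCausal.sample W n ω) (αhat n ω))
        (PELCausal.normSet (PELCausal.sample W n ω)) (pG n ω))
    -- `pR` is the restricted maximizer under normalization and the constraint at `θ = θ⁰`
    (pR : ∀ n : ℕ, Ω → Fin n → ℝ) (hR_meas : ∀ n, AEMeasurable (pR n) μ)
    (hR : ∀ n, ∀ᵐ ω ∂μ,
      (∃ q, PELCausal.IsMaximizer (PELCausal.pel (PELCausal.sample W n ω) (αhat n ω))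
        (PELCausal.ateSet (PELCausal.sample W n ω) (PELCausal.ate P)) q) →
      PELCausal.IsMaximizer (PELCausal.pel (PELCausal.sample W n ω) (αhat n ω))
        (PELCausal.ateSet (PELCausal.sample W n ω) (PELCausal.ate P)) (pR n ω)) :
    -- with probability tending to one all three maxima are attained
    Tendsto (fun n : ℕ => μ {ω | ¬ ((∃ α, PELCausal.IsMLE (PELCausal.sample W n ω) α) ∧
        (∃ q, PELCausal.IsMaximizer (PELCausal.pel (PELCausal.sample W n ω) (αhat n ω))
          (PELCausal.normSet (PELCausal.sample W n ω)) q) ∧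
        (∃ q, PELCausal.IsMaximizer (PELCausal.pel (PELCausal.sample W n ω) (αhat n ω))
          (PELCausal.ateSet (PELCausal.sample W n ω) (PELCausal.ate P)) q))}) atTop (𝓝 0) ∧
    -- `ĉ` is consistent for the positive population constant `c`
    0 < PELCausal.cPop P α₀ ∧
    TendstoInMeasure μ (fun (n : ℕ) ω => PELCausal.cHat (PELCausal.sample W n ω) (αhat n ω)) atTop
      (fun _ => PELCausal.cPop P α₀) ∧
    -- `-2 r_PEL(θ⁰) / ĉ` converges in distribution to `χ²₁`
    TendstoInDistribution
      (fun (n : ℕ) ω => -2 * (PELCausal.pel (PELCausal.sample W n ω) (αhat n ω) (pR n ω)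
          - PELCausal.pel (PELCausal.sample W n ω) (αhat n ω) (pG n ω))
        / PELCausal.cHat (PELCausal.sample W n ω) (αhat n ω))
      atTop (id : ℝ → ℝ) (fun _ => μ) PELCausal.chiSquaredOne := by
  have hA : PELCausal.Assumptions P α₀ := ⟨hSITA, hPS, hY₁, hY₀, hX, hτ, hDesign, hV⟩
  obtain ⟨h₁, h₂, h₃⟩ := PELCausal.tendsto_pelRatio_probFilter hA hInd hLaw
    (αs := fun x => αhat x.1 x.2) (qG := fun x => pG x.1 x.2) (qR := fun x => pR x.1 x.2)
    (PELCausal.eventually_probFilter_of_forall_ae hα)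
    (PELCausal.eventually_probFilter_of_forall_ae hG)
    (PELCausal.eventually_probFilter_of_forall_ae hR)
  obtain ⟨R, hbdd⟩ := hA.exists_bdd
  refine ⟨PELCausal.eventually_probFilter.1 h₁,
    mul_pos (inv_pos.2 (mul_pos two_pos (hA.model hbdd).var_pos)) hV,
    PELCausal.tendstoInMeasure_of_tendsto_probFilter h₂, ?_⟩
  exact PELCausal.tendstoInDistribution_scaledRatio hA hInd hLaw hα_meas hG_meas hR_meas h₃
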